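/- Throughout, all systems are finite-dimensional, Boltzmann's constant is $1$, $S(\rho)=-\mathrm{Tr}(\rho\log\rho)$ is the von Neumann entropy, $\|\cdot\|_1$ is the trace norm, and $T=1/\beta$. **Setting.** Let $\mathcal Q=(Q^1,\dots,Q^n)$, $n\ge 1$, be pairwise commuting Hermitian observables on a finite-dimensional system, and $\mathbf v\in\mathbb R^n$. The class $[\mathbf v]_{\mathcal Q}$ of the macrostate $(\mathbf v,\mathcal Q)$ is the set of all density matrices $\rho$ with $\mathrm{Tr}(\rho Q^j)=v^j$ for all $j$; it is assumed to be non-empty. For $\mathbf b\in\mathbb R^n$ put $\gamma_{\mathbf b}(\mathcal Q)=e^{-\sum_j b_jQ^j}/\mathrm{Tr}(e^{-\sum_j b_jQ^j})$. The ensemble $\gamma_{\mathbf v}(\mathcal Q)$ of the macrostate is the element of $[\mathbf v]_{\mathcal Q}$ that is of this form or, if $\mathbf v$ lies on the boundary of the set of attainable values, a limit of states of this form. An environment at inverse temperatures $\boldsymbol\beta=(\beta_1,\dots,\beta_n)$ consists of $N\geq 0$ finite-dimensional systems $E^l$, each with $n$ commuting observables $Q^j_{E^l}$; its microstates are all products $\bigotimes_l\sigma^l$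 of density matrices with the thermal expectation values $\mathrm{Tr}(\sigma^lQ^j_{E^l})=\mathrm{Tr}(\gamma_{\boldsymbol\beta}(\mathcal Q_{E^l})\,Q^j_{E^l})$. The total observables are $Q^j_{SE}=Q^j+\sum_lQ^j_{E^l}$. One writes $(\mathbf v,\mathcal Q)\xrightarrow{\boldsymbol\beta\text{-mac}}\rho_f$ if for all $\epsilon,\epsilon'>0$ there are an environment and one unitary $U$ on $SE$ such that for all $\rho\in[\mathbf v]_{\mathcal Q}$ and all microstates $\sigma$ of the environment $$\|\mathrm{Tr}_E(U(\rho\otimes\sigma)U^\dagger)-\rho_f\|_1\le\epsilon,\qquad |\mathrm{Tr}(U(\rho\otimes\sigma)U^\dagger Q^j_{SE})-\mathrm{Tr}((\rho\otimes\sigma)Q^j_{SE})|\le\epsilon'\ \ (j=1,\dots,n).$$ For $n=1$, with a Hamiltonian $H$ as the only observable, one writes $(e,H)$, $\gamma_e(H)$, $\gamma_\beta(H)$ and $\xrightarrow{\beta\text{-mac}}$. **Second law and Clausius inequality.** Let $H$ be Hermitian, $\beta>0$ and $[e]_H\neq\emptyset$. Let $\mathcal F(\rho)=\mathrm{Tr}(\rho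 H)-TS(\rho)$. 1. The canonical ensemble $\gamma_e(H)$ exists and is unique, so that $F(e,H):=\mathcal F(\gamma_e(H))$ and $S(e,H):=(e-F(e,H))/T$ are functions of the macrostate; moreover $S(e,H)=S(\gamma_e(H))$. 2. For every density matrix $\rho_f$ of the system, $(e,H)\xrightarrow{\beta\text{-mac}}\rho_f$ if and only if $\mathcal F(\gamma_e(H))\ge\mathcal F(\rho_f)$. 3. For every $e'$ with $[e']_H\ne\emptyset$ the following are equivalent: (a) $(e,H)\xrightarrow{\beta\text{-mac}}\gamma_{e'}(H)$; (b) $(e,H)\xrightarrow{\beta\text{-mac}}\rho_f$ for some $\rho_f\in[e']_H$; (c) for all $\epsilon,\epsilon'>0$ there are an environment and one unitary on $SE$ that changes the mean total energy by at most $\epsilon'$ and takes the system to within $\epsilon$, in trace norm, of $[e']_H$, for all $\rho\in[e]_H$ and all microstates of the environment; (d) $\Delta Q\ge T\Delta S$, where $\Delta Q=e-e'$ and $\Delta S=S(e,H)-S(e',H)$ (here $\Delta$ means initial minus final value). 4. For every density matrix $\rho_f$ the greatest $W$ such that for all $\epsilon,\epsilon'>0$ there are an environment and one unitary on $SE$ that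 takes the system to $\rho_f$ up to $\epsilon$ in trace norm and decreases the mean total energy by $W$ up to $\epsilon'$, for all $\rho\in[e]_H$ and all microstates of the environment, is $\Delta\mathcal F_S=F(e,H)-\mathcal F(\rho_f)$. If the final state of the system is not prescribed, the greatest such $W$ is $F(e,H)-\mathcal F(\gamma_\beta(H))$. The latter is also the supremum over all environments and unitaries of the mean energy extracted when the system starts in $\gamma_e(H)$ and each environment system in its Gibbs state at inverse temperature $\beta$. **Several observables.** Let $\mathcal Q$ be as above, $\beta_j\ne0$ for all $j$ and $[\mathbf v]_{\mathcal Q}\ne\emptyset$. Then $\gamma_{\mathbf v}(\mathcal Q)$ exists and is unique, and for every density matrix $\rho_f$ $$(\mathbf v,\mathcal Q)\xrightarrow{\boldsymbol\beta\text{-mac}}\rho_f\iff\mathcal G(\gamma_{\mathbf v}(\mathcal Q))\ge\mathcal G(\rho_f),\qquad \mathcal G(\rho)=\sum_j\beta_j\mathrm{Tr}(\rho Q^j)-S(\rho).$$ -/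

import Mathlib

open scoped Kronecker ComplexOrder

noncomputable section

namespace MacroThermo

/-! Finite-dimensional quantum systems are described by complex matrices over a finite index set.
Boltzmann's constant is set to one, so that an environment at inverse temperature `β` has
temperature `T = 1 / β`. -/

/-! ### States, entropy and ensembles -/

/-- Density matrices (microstates). -/
def IsDensity {d : Type*} [Fintype d] (ρ : Matrix d d ℂ) : Prop :=
  ρ.PosSemidef ∧ ρ.trace = 1

/-- The expectation value `tr (ρ A)` (which is real for Hermitian `ρ` and `A`). -/
def expect {d : Type*} [Fintype d] (ρ A : Matrix d d ℂ) : ℝ := (ρ * A).trace.re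

/-- The trace norm `tr √(Aᴴ A)`, that is, the sum of the singular values of `A`. -/
def traceNorm {d : Type*} [Fintype d] [DecidableEq d] (A : Matrix d d ℂ) : ℝ :=
  ∑ i, √((Matrix.isHermitian_conjTranspose_mul_self A).eigenvalues i)

/-- The von Neumann entropy `- tr (ρ log ρ)`, through the functional calculus of the
Hermitian matrix `ρ` (with `0 log 0 = 0`). -/
def vonNeumannEntropy {d : Type*} [Fintype d] [DecidableEq d] (ρ : Matrix d d ℂ) : ℝ :=
  (cfc Real.negMulLog ρ).trace.re

/-- The generalised Gibbs state `exp (- ∑ j, b j Q j) / tr (exp (- ∑ j, b j Q j))`. -/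
def gibbs {ι d : Type*} [Fintype ι] [Fintype d] [DecidableEq d]
    (b : ι → ℝ) (Q : ι → Matrix d d ℂ) : Matrix d d ℂ :=
  (NormedSpace.exp (-∑ j, (b j : ℂ) • Q j)).trace⁻¹ • NormedSpace.exp (-∑ j, (b j : ℂ) • Q j)

/-- The class `[v]_Q` of the microstates compatible with the macrostate `(v, Q)`: all density
matrices `ρ` with `tr (ρ Q j) = v j` for all `j`. -/
def microstates {ι d : Type*} [Fintype d]
    (Q : ι → Matrix d d ℂ) (v : ι → ℝ) : Set (Matrix d d ℂ) :=
  {ρ | IsDensity ρ ∧ ∀ j, expect ρ (Q j) = v j}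

/-- `γ` is the maximum-entropy (generalised Gibbs) ensemble of the macrostate `(v, Q)`: it has the
expectation values `v` and it is of the form `gibbs b Q`, where the inverse temperatures `b` may
also be infinite, that is, a limit of such states is allowed. (Infinite inverse temperatures are
needed for the values `v` on the boundary of the set of attainable values; for the energy, these are
the ground state energy and the highest energy.) -/
def IsEnsemble {ι d : Type*} [Fintype ι] [Fintype d] [DecidableEq d]
    (Q : ι → Matrix d d ℂ) (v : ι → ℝ) (γ : Matrix d d ℂ) : Prop :=
  γ ∈ closure (Set.range fun b : ι → ℝ => gibbs b Q) ∧ ∀ j, expect γ (Q j) = v j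

open Classical in
/-- The ensemble `γ_v(Q)` of the macrostate `(v, Q)` (zero if there is none). -/
def ensemble {ι d : Type*} [Fintype ι] [Fintype d] [DecidableEq d]
    (Q : ι → Matrix d d ℂ) (v : ι → ℝ) : Matrix d d ℂ :=
  if h : ∃ γ, IsEnsemble Q v γ then h.choose else 0

/-! ### Composite systems -/

/-- The tensor product `⨂ l, A l` of matrices. -/
def piTensor {N : ℕ} {D : Fin N → ℕ} (A : (l : Fin N) → Matrix (Fin (D l)) (Fin (D l)) ℂ) :
    Matrix ((l : Fin N) → Fin (D l)) ((l : Fin N) → Fin (D l)) ℂ :=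
  Matrix.of fun a b => ∏ l, A l (a l) (b l)

/-- The partial trace over the second factor. -/
def partialTrace {d e : Type*} [Fintype e] (A : Matrix (d × e) (d × e) ℂ) : Matrix d d ℂ :=
  Matrix.of fun i j => ∑ k, A (i, k) (j, k)

/-- An environment: `N` finite-dimensional systems, each with its commuting conserved
observables `Q l j`. -/
structure Environment (ι : Type*) where
  N : ℕ
  dim : Fin N → ℕ
  dim_pos : ∀ l, 0 < dim l
  Q : (l : Fin N) → ι → Matrix (Fin (dim l)) (Fin (dim l)) ℂ
  hermitian : ∀ l j, (Q l j).IsHermitian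
  commute : ∀ l i j, Commute (Q l i) (Q l j)

namespace Environment

variable {ι : Type*} (E : Environment ι)

/-- The index set of the basis of the Hilbert space of the environment. -/
abbrev Idx : Type := (l : Fin E.N) → Fin (E.dim l)

/-- Families of matrices, one for each of the systems of the environment. -/
abbrev Family : Type := (l : Fin E.N) → Matrix (Fin (E.dim l)) (Fin (E.dim l)) ℂ

/-- The `j`-th observable of the environment: the sum over `l` of
`1 ⊗ ⋯ ⊗ Q l j ⊗ ⋯ ⊗ 1`. -/
def charge (j : ι) : Matrix E.Idx E.Idx ℂ :=
  ∑ l, piTensor (Function.update (fun _ => 1) l (E.Q l j))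

/-- The `j`-th observable of the compound of the system and the environment. -/
def totalCharge {d : Type*} [DecidableEq d] (Q : ι → Matrix d d ℂ) (j : ι) :
    Matrix (d × E.Idx) (d × E.Idx) ℂ :=
  Q j ⊗ₖ (1 : Matrix E.Idx E.Idx ℂ) + (1 : Matrix d d ℂ) ⊗ₖ E.charge j

/-- The microstates of the `N` systems compatible with the macrostates in which each
observable has its thermal expectation value at the inverse temperatures `β`. -/
def thermalMicrostates [Fintype ι] (β : ι → ℝ) : Set E.Family :=
  {σ | ∀ l, σ l ∈ microstates (E.Q l) fun j => expect (gibbs β (E.Q l)) (E.Q l j)}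

/-- The Gibbs states of the `N` systems at the inverse temperatures `β`. -/
def gibbsFamily [Fintype ι] (β : ι → ℝ) : E.Family := fun l => gibbs β (E.Q l)

/-- The initial state `ρ ⊗ ⨂ l, σ l` of the compound. -/
def initial {d : Type*} (ρ : Matrix d d ℂ) (σ : E.Family) :
    Matrix (d × E.Idx) (d × E.Idx) ℂ :=
  ρ ⊗ₖ piTensor σ

/-- The final state `U (ρ ⊗ ⨂ l, σ l) U†` of the compound. -/
def final {d : Type*} [Fintype d] [DecidableEq d] (U : Matrix.unitaryGroup (d × E.Idx) ℂ)
    (ρ : Matrix d d ℂ) (σ : E.Family) : Matrix (d × E.Idx) (d × E.Idx) ℂ :=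
  (U : Matrix (d × E.Idx) (d × E.Idx) ℂ) * E.initial ρ σ *
    (U : Matrix (d × E.Idx) (d × E.Idx) ℂ).conjTranspose

/-- The decrease of the expectation value of the `j`-th total observable under `U`. -/
def decrease {d : Type*} [Fintype d] [DecidableEq d] (Q : ι → Matrix d d ℂ)
    (U : Matrix.unitaryGroup (d × E.Idx) ℂ) (ρ : Matrix d d ℂ) (σ : E.Family) (j : ι) : ℝ :=
  expect (E.initial ρ σ) (E.totalCharge Q j) - expect (E.final U ρ σ) (E.totalCharge Q j)

end Environment

/-! ### Macrostate operations -/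

/-- `(v, Q) → ρf` by macrostate operations at the inverse temperatures `β`: up to arbitrarily small
errors, a single unitary on the system and some environment takes all microstates compatible with
the macrostates to `ρf`, while preserving the expectation values of all total observables. -/
def MacReach {ι d : Type*} [Fintype ι] [Fintype d] [DecidableEq d]
    (β : ι → ℝ) (Q : ι → Matrix d d ℂ) (v : ι → ℝ) (ρf : Matrix d d ℂ) : Prop :=
  ∀ ε > (0 : ℝ), ∀ ε' > (0 : ℝ),
    ∃ (E : Environment ι) (U : Matrix.unitaryGroup (d × E.Idx) ℂ),
      ∀ ρ ∈ microstates Q v, ∀ σ ∈ E.thermalMicrostates β,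
        traceNorm (partialTrace (E.final U ρ σ) - ρf) ≤ ε ∧
        ∀ j, |E.decrease Q U ρ σ j| ≤ ε'

/-- `(v, Q) → (v', Q)` by macrostate operations: up to arbitrarily small errors, a single unitary on
the system and some environment takes all microstates compatible with the initial macrostates to
(possibly different) microstates compatible with the final one, while preserving the expectation
values of all total observables. -/
def MacToMac {ι d : Type*} [Fintype ι] [Fintype d] [DecidableEq d]
    (β : ι → ℝ) (Q : ι → Matrix d d ℂ) (v v' : ι → ℝ) : Prop :=
  ∀ ε > (0 : ℝ), ∀ ε' > (0 : ℝ),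
    ∃ (E : Environment ι) (U : Matrix.unitaryGroup (d × E.Idx) ℂ),
      ∀ ρ ∈ microstates Q v, ∀ σ ∈ E.thermalMicrostates β,
        (∃ ρ' ∈ microstates Q v', traceNorm (partialTrace (E.final U ρ σ) - ρ') ≤ ε) ∧
        ∀ j, |E.decrease Q U ρ σ j| ≤ ε'

/-- The free entropy `∑ j, β j tr (ρ Q j) - S(ρ)`. -/
def freeEntropy {ι d : Type*} [Fintype ι] [Fintype d] [DecidableEq d]
    (β : ι → ℝ) (Q : ι → Matrix d d ℂ) (ρ : Matrix d d ℂ) : ℝ :=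
  ∑ j, β j * expect ρ (Q j) - vonNeumannEntropy ρ

/-! ### The energy as the only observable -/

section Energy

variable {d : Type*} [Fintype d] [DecidableEq d]

/-- The microstates of mean energy `e`. -/
def energyMicrostates (H : Matrix d d ℂ) (e : ℝ) : Set (Matrix d d ℂ) :=
  microstates (fun _ : Unit => H) fun _ => e

/-- `γ` is the canonical ensemble of the macrostate `(e, H)`. -/
def IsCanonical (H : Matrix d d ℂ) (e : ℝ) (γ : Matrix d d ℂ) : Prop :=
  IsEnsemble (fun _ : Unit => H) (fun _ => e) γ

/-- The canonical ensemble `γ_e(H)`. -/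
def canonical (H : Matrix d d ℂ) (e : ℝ) : Matrix d d ℂ :=
  ensemble (fun _ : Unit => H) fun _ => e

/-- The Gibbs state `γ_β(H)` at inverse temperature `β`. -/
def thermal (β : ℝ) (H : Matrix d d ℂ) : Matrix d d ℂ :=
  gibbs (fun _ : Unit => β) fun _ => H

/-- `(e, H) → ρf` by macrostate operations at inverse temperature `β`. -/
def EnergyMacReach (β : ℝ) (H : Matrix d d ℂ) (e : ℝ) (ρf : Matrix d d ℂ) : Prop :=
  MacReach (fun _ : Unit => β) (fun _ => H) (fun _ => e) ρf

/-- `(e, H) → (e', H)` by macrostate operations at inverse temperature `β`. -/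
def EnergyMacToMac (β : ℝ) (H : Matrix d d ℂ) (e e' : ℝ) : Prop :=
  MacToMac (fun _ : Unit => β) (fun _ => H) (fun _ => e) fun _ => e'

/-- The nonequilibrium free energy `tr (ρ H) - S(ρ) / β`. -/
def freeEnergy (β : ℝ) (H ρ : Matrix d d ℂ) : ℝ :=
  expect ρ H - vonNeumannEntropy ρ / β

/-- The free energy `F(e, H)` of a macrostate. -/
def macroFreeEnergy (β : ℝ) (H : Matrix d d ℂ) (e : ℝ) : ℝ := freeEnergy β H (canonical H e)

/-- The Gibbs entropy `S(e, H) = (e - F(e, H)) / T` of a macrostate, with `T = 1 / β`. -/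
def macroEntropy (β : ℝ) (H : Matrix d d ℂ) (e : ℝ) : ℝ :=
  (e - macroFreeEnergy β H e) / (1 / β)

/-- The energy decrease of the system with an environment under `U`, that is, the work extracted
by `U`. -/
def work (H : Matrix d d ℂ) (E : Environment Unit) (U : Matrix.unitaryGroup (d × E.Idx) ℂ)
    (ρ : Matrix d d ℂ) (σ : E.Family) : ℝ :=
  E.decrease (fun _ => H) U ρ σ ()

/-- The amounts of work that can be extracted from the macrostate `(e, H)`: up to arbitrarily small
errors, a single unitary on the system and some environment extracts the work `W` for all
microstates compatible with the macrostates. -/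
def extractableWork (β : ℝ) (H : Matrix d d ℂ) (e : ℝ) : Set ℝ :=
  {W | ∀ ε > (0 : ℝ), ∃ (E : Environment Unit) (U : Matrix.unitaryGroup (d × E.Idx) ℂ),
    ∀ ρ ∈ energyMicrostates H e, ∀ σ ∈ E.thermalMicrostates (fun _ => β),
      |work H E U ρ σ - W| ≤ ε}

/-- The amounts of work that can be extracted from the macrostate `(e, H)` while the system is taken
to the state `ρf`. -/
def extractableWorkTo (β : ℝ) (H : Matrix d d ℂ) (e : ℝ) (ρf : Matrix d d ℂ) : Set ℝ :=
  {W | ∀ ε > (0 : ℝ), ∀ ε' > (0 : ℝ),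
    ∃ (E : Environment Unit) (U : Matrix.unitaryGroup (d × E.Idx) ℂ),
      ∀ ρ ∈ energyMicrostates H e, ∀ σ ∈ E.thermalMicrostates (fun _ => β),
        traceNorm (partialTrace (E.final U ρ σ) - ρf) ≤ ε ∧ |work H E U ρ σ - W| ≤ ε'}

/-- The amounts of work that unitaries can extract from the system in the microstate `ρ` together
with environments in their Gibbs states. -/
def microWork (β : ℝ) (H ρ : Matrix d d ℂ) : Set ℝ :=
  {W | ∃ (E : Environment Unit) (U : Matrix.unitaryGroup (d × E.Idx) ℂ),
    W = work H E U ρ (E.gibbsFamily fun _ => β)}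

end Energy

end MacroThermo

end

/-!
Gibbs' inequality for the final state, against the product of the final state of the system and the
Gibbs state of the environment, turns the conservation of entropy under a unitary into a balance:
the decrease of the total observables, weighted with `β`, is at most `𝒢(ρ) - 𝒢(ρ')`. Applied to the
ensemble, which is one of the microstates, this gives all the upper bounds.

Conversely, the environment can be made of fresh qubits with arbitrary observables: their thermal
expectation values fix their populations, and collisions with qubits of known populations dephase
the system and exchange its populations whatever the coherences of the qubits are. Chains of many
such collisions with slowly varying populations move the system between two distributions `q` and
`r` with vanishing dissipation. From a state with other populations than `q` the same process
costs the cross entropy relative to `q`; if `q` is of the form `γ_b`, this is a function of the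
macrostate, and for `q` close to the ensemble it is close to the entropy of the ensemble. A surplus
in the balance is absorbed by the inversion of a polarised qubit.

The ensembles are obtained by minimising the dual function `log Z(b) + b ⬝ᵥ v`, with a penalty
`η ‖b‖²` that makes the minimum exist also on the boundary of the set of attainable values, and by
letting `η` tend to zero.
-/

namespace MacroThermo

open Matrix Filter Topology

/-! ### Matrices with a given spectral decomposition -/

section Spectral

variable {d : Type*} [Fintype d] [DecidableEq d]

/-- The Hermitian matrix with eigenvalues `p` and with the columns of `W` as eigenvectors. For fixed
`W` these matrices form a commutative real algebra, hence the bundling as a homomorphism. -/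
noncomputable def conjDiag (W : unitaryGroup d ℂ) : (d → ℝ) →⋆ₐ[ℝ] Matrix d d ℂ where
  toFun p := W * diagonal (fun i => (p i : ℂ)) * (W : Matrix d d ℂ)ᴴ
  map_zero' := by simp
  map_one' := by simp [← star_eq_conjTranspose]
  map_add' p q := by simp [← diagonal_add, mul_add, add_mul]
  map_mul' p q := by
    have hW : (W : Matrix d d ℂ)ᴴ * W = 1 := UnitaryGroup.star_mul_self W
    have hdiag : diagonal (fun i => (((p * q) i : ℝ) : ℂ)) =
        diagonal (fun i => (p i : ℂ)) * diagonal (fun i => (q i : ℂ)) := by simp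
    rw [hdiag]
    simp only [Matrix.mul_assoc]
    rw [← Matrix.mul_assoc (W : Matrix d d ℂ)ᴴ, hW, Matrix.one_mul]
  commutes' c := by
    have hW : (W : Matrix d d ℂ) * (W : Matrix d d ℂ)ᴴ = 1 := mem_unitaryGroup_iff.1 W.2
    have hdiag : diagonal (fun i => ((algebraMap ℝ (d → ℝ) c i : ℝ) : ℂ)) =
        c • (1 : Matrix d d ℂ) := by ext; simp [diagonal_apply, one_apply]
    rw [hdiag, Algebra.algebraMap_eq_smul_one]
    simp [hW]
  map_star' p := by
    simp [star_eq_conjTranspose, conjTranspose_mul, diagonal_conjTranspose, Matrix.mul_assoc,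
      Pi.star_def]

lemma conjDiag_apply (W : unitaryGroup d ℂ) (p : d → ℝ) :
    conjDiag W p = W * diagonal (fun i => (p i : ℂ)) * (W : Matrix d d ℂ)ᴴ := rfl

/-- The state `U A Uᴴ` into which the unitary `U` takes the state `A`. -/
def evolve (U : unitaryGroup d ℂ) (A : Matrix d d ℂ) : Matrix d d ℂ :=
  (U : Matrix d d ℂ) * A * (U : Matrix d d ℂ)ᴴ

lemma evolve_one (A : Matrix d d ℂ) : evolve 1 A = A := by
  simp [evolve]

lemma evolve_mul (U V : unitaryGroup d ℂ) (A : Matrix d d ℂ) :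
    evolve (U * V) A = evolve U (evolve V A) := by
  simp [evolve, Matrix.mul_assoc]

lemma evolve_conjDiag (V W : unitaryGroup d ℂ) (p : d → ℝ) :
    evolve V (conjDiag W p) = conjDiag (V * W) p :=
  (evolve_mul V W _).symm

lemma expect_evolve_of_commute {U : unitaryGroup d ℂ} {A : Matrix d d ℂ}
    (h : Commute (U : Matrix d d ℂ) A) (M : Matrix d d ℂ) :
    expect (evolve U M) A = expect M A := by
  have hU : (U : Matrix d d ℂ)ᴴ * U = 1 := UnitaryGroup.star_mul_self U
  have hA : (U : Matrix d d ℂ)ᴴ * A * (U : Matrix d d ℂ) = A := by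
    rw [Matrix.mul_assoc, ← h.eq, ← Matrix.mul_assoc, hU, Matrix.one_mul]
  have htr : (evolve U M * A).trace =
      (M * ((U : Matrix d d ℂ)ᴴ * A * (U : Matrix d d ℂ))).trace := by
    rw [evolve, Matrix.mul_assoc, Matrix.mul_assoc, trace_mul_comm]
    simp only [Matrix.mul_assoc]
  rw [expect, htr, hA, expect]

lemma isHermitian_conjDiag (W : unitaryGroup d ℂ) (p : d → ℝ) : (conjDiag W p).IsHermitian :=
  (IsSelfAdjoint.all p).map (conjDiag W)

lemma trace_conjDiag (W : unitaryGroup d ℂ) (p : d → ℝ) :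
    (conjDiag W p).trace = ((∑ i, p i : ℝ) : ℂ) := by
  have hW : (W : Matrix d d ℂ)ᴴ * W = 1 := UnitaryGroup.star_mul_self W
  rw [conjDiag_apply, trace_mul_cycle, hW, Matrix.one_mul, trace_diagonal, Complex.ofReal_sum]

lemma posSemidef_conjDiag (W : unitaryGroup d ℂ) {p : d → ℝ} (hp : 0 ≤ p) :
    (conjDiag W p).PosSemidef :=
  (posSemidef_diagonal_iff.2 fun i => by exact_mod_cast hp i).mul_mul_conjTranspose_same _

lemma isDensity_conjDiag (W : unitaryGroup d ℂ) {p : d → ℝ} (hp : p ∈ stdSimplex ℝ d) :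
    IsDensity (conjDiag W p) :=
  ⟨posSemidef_conjDiag W hp.1, by rw [trace_conjDiag, hp.2, Complex.ofReal_one]⟩

lemma exists_eq_conjDiag_eigenvalues {A : Matrix d d ℂ} (hA : A.IsHermitian) :
    ∃ W : unitaryGroup d ℂ, A = conjDiag W hA.eigenvalues :=
  ⟨hA.eigenvectorUnitary, hA.spectral_theorem⟩

lemma IsDensity.exists_eq_conjDiag {ρ : Matrix d d ℂ} (hρ : IsDensity ρ) :
    ∃ W : unitaryGroup d ℂ, ∃ p ∈ stdSimplex ℝ d, ρ = conjDiag W p := by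
  obtain ⟨W, hW⟩ := exists_eq_conjDiag_eigenvalues hρ.1.isHermitian
  refine ⟨W, _, ⟨hρ.1.eigenvalues_nonneg, ?_⟩, hW⟩
  have htr := trace_conjDiag W hρ.1.isHermitian.eigenvalues
  rw [← hW] at htr
  exact_mod_cast htr.symm.trans hρ.2

lemma cfc_conjDiag (f : ℝ → ℝ) (W : unitaryGroup d ℂ) (p : d → ℝ) :
    cfc f (conjDiag W p) = conjDiag W (f ∘ p) := by
  obtain ⟨P, hP⟩ := (Polynomial.exists_eval_eq_iff p (f ∘ p)).2 fun i j hij => congrArg f hij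
  have hspec : (spectrum ℝ (conjDiag W p)).EqOn f P.eval := by
    intro x hx
    have hx' := AlgHom.spectrum_apply_subset (conjDiag W).toAlgHom p hx
    rw [Pi.spectrum_eq, Set.mem_iUnion] at hx'
    obtain ⟨i, hi⟩ := hx'
    obtain rfl : x = p i := by
      rwa [show p i = algebraMap ℝ ℝ (p i) from rfl, spectrum.scalar_eq] at hi
    exact (hP i).symm
  calc cfc f (conjDiag W p) = cfc P.eval (conjDiag W p) := cfc_congr hspec
    _ = Polynomial.aeval (conjDiag W p) P :=
      cfc_polynomial P _ (isHermitian_conjDiag W p).isSelfAdjoint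
    _ = conjDiag W (Polynomial.aeval p P) := Polynomial.aeval_algHom_apply (conjDiag W) p P
    _ = conjDiag W (f ∘ p) := by
      rw [Polynomial.aeval_pi_apply]
      exact congrArg _ (funext hP)

lemma vonNeumannEntropy_conjDiag (W : unitaryGroup d ℂ) (p : d → ℝ) :
    vonNeumannEntropy (conjDiag W p) = ∑ i, Real.negMulLog (p i) := by
  rw [vonNeumannEntropy, cfc_conjDiag, trace_conjDiag, Complex.ofReal_re]
  rfl

/-- The diagonal of `A` in the orthonormal basis given by the columns of `W`: for a density matrix,
the distribution of the outcomes of a measurement in this basis. -/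
def population (W : unitaryGroup d ℂ) (A : Matrix d d ℂ) (i : d) : ℝ :=
  (((W : Matrix d d ℂ)ᴴ * A * (W : Matrix d d ℂ)) i i).re

/-- The probabilities `|U i j|²` of the transitions induced by a unitary `U`. -/
def transition (U : unitaryGroup d ℂ) : Matrix d d ℝ :=
  of fun i j => Complex.normSq ((U : Matrix d d ℂ) i j)

lemma sum_transition_col (U : unitaryGroup d ℂ) (j : d) : ∑ i, transition U i j = 1 := by
  have h := congrFun₂ (UnitaryGroup.star_mul_self U) j j
  rw [mul_apply, one_apply_eq] at h
  have hre := congrArg Complex.re h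
  rw [Complex.re_sum, Complex.one_re] at hre
  rw [← hre]
  exact Finset.sum_congr rfl fun i _ => by simp [transition, Complex.normSq_apply]

lemma transition_mem_doublyStochastic (U : unitaryGroup d ℂ) :
    transition U ∈ doublyStochastic ℝ d := by
  refine mem_doublyStochastic_iff_sum.2
    ⟨fun i j => Complex.normSq_nonneg _, fun i => ?_, sum_transition_col U⟩
  rw [← sum_transition_col U⁻¹ i]
  exact Finset.sum_congr rfl fun j _ => by simp [transition]

lemma population_conjDiag (W X : unitaryGroup d ℂ) (p : d → ℝ) :
    population W (conjDiag X p) = transition (W⁻¹ * X) *ᵥ p := by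
  have hconj : (W : Matrix d d ℂ)ᴴ * conjDiag X p * (W : Matrix d d ℂ) =
      conjDiag (W⁻¹ * X) p := by
    rw [← evolve_conjDiag, evolve, UnitaryGroup.inv_val, star_eq_conjTranspose,
      conjTranspose_conjTranspose]
  ext i
  rw [population, hconj, conjDiag_apply, mul_apply, Complex.re_sum]
  refine Finset.sum_congr rfl fun j _ => ?_
  rw [mul_diagonal, conjTranspose_apply, Complex.star_def, mul_right_comm, Complex.mul_conj,
    ← Complex.ofReal_mul, Complex.ofReal_re]
  rfl

lemma population_conjDiag_self (W : unitaryGroup d ℂ) (p : d → ℝ) :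
    population W (conjDiag W p) = p := by
  have hone : transition (1 : unitaryGroup d ℂ) = 1 := by
    ext i j; simp [transition, one_apply, apply_ite]
  rw [population_conjDiag, inv_mul_cancel, hone, one_mulVec]

lemma sum_population (W : unitaryGroup d ℂ) (A : Matrix d d ℂ) :
    ∑ i, population W A i = A.trace.re := by
  have hW : (W : Matrix d d ℂ) * (W : Matrix d d ℂ)ᴴ = 1 := mem_unitaryGroup_iff.1 W.2
  have htr : ((W : Matrix d d ℂ)ᴴ * A * (W : Matrix d d ℂ)).trace = A.trace := by
    rw [trace_mul_comm, ← Matrix.mul_assoc, hW, Matrix.one_mul]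
  rw [← htr, trace, Complex.re_sum]
  rfl

lemma IsDensity.population_mem_stdSimplex {ρ : Matrix d d ℂ} (hρ : IsDensity ρ)
    (W : unitaryGroup d ℂ) : population W ρ ∈ stdSimplex ℝ d :=
  ⟨fun i => (Complex.le_def.1 ((hρ.1.conjTranspose_mul_mul_same (W : Matrix d d ℂ)).diag_nonneg
    (i := i))).1, by rw [sum_population, hρ.2, Complex.one_re]⟩

lemma expect_conjDiag (ρ : Matrix d d ℂ) (W : unitaryGroup d ℂ) (p : d → ℝ) :
    expect ρ (conjDiag W p) = ∑ i, population W ρ i * p i := by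
  have htr : (ρ * conjDiag W p).trace = ((W : Matrix d d ℂ)ᴴ * ρ * (W : Matrix d d ℂ) *
      diagonal (fun i => (p i : ℂ))).trace := by
    rw [conjDiag_apply, ← Matrix.mul_assoc, trace_mul_comm]
    simp only [Matrix.mul_assoc]
  rw [expect, htr, trace, Complex.re_sum]
  refine Finset.sum_congr rfl fun i _ => ?_
  rw [diag_apply, mul_diagonal, Complex.re_mul_ofReal]
  rfl

end Spectral

/-! ### Entropy inequalities -/

section Entropy

variable {d : Type*} [Fintype d]

lemma sum_negMulLog_le_sum_negMulLog_mulVec [DecidableEq d] {M : Matrix d d ℝ}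
    (hM : M ∈ doublyStochastic ℝ d) {p : d → ℝ} (hp : 0 ≤ p) :
    ∑ j, Real.negMulLog (p j) ≤ ∑ i, Real.negMulLog ((M *ᵥ p) i) :=
  calc ∑ j, Real.negMulLog (p j) = ∑ j, (∑ i, M i j) * Real.negMulLog (p j) := by
        simp only [sum_col_of_mem_doublyStochastic hM, one_mul]
    _ = ∑ i, ∑ j, M i j • Real.negMulLog (p j) := by
        simp only [Finset.sum_mul, smul_eq_mul]
        exact Finset.sum_comm
    _ ≤ ∑ i, Real.negMulLog (∑ j, M i j • p j) := Finset.sum_le_sum fun i _ =>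
        Real.concaveOn_negMulLog.le_map_sum (fun j _ => nonneg_of_mem_doublyStochastic hM)
          (sum_row_of_mem_doublyStochastic hM i) fun j _ => hp j

/-- Gibbs' inequality. By Lean's convention `log 0 = 0`, points outside the support of `q` would
contribute `0` instead of `∞` to the right-hand side, whence `hsupp`. -/
lemma sum_negMulLog_le_sum_mul_neg_log {p q : d → ℝ} (hp : 0 ≤ p) (hq : 0 ≤ q)
    (hsum : ∑ i, q i ≤ ∑ i, p i) (hsupp : ∀ i, q i = 0 → p i = 0) :
    ∑ i, Real.negMulLog (p i) ≤ ∑ i, p i * -Real.log (q i) := by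
  have hterm : ∀ i, p i - q i ≤ p i * -Real.log (q i) - Real.negMulLog (p i) := by
    intro i
    rcases (hq i).eq_or_lt with hq0 | hq0
    · simp [hsupp i hq0.symm, ← hq0]
    rcases (hp i).eq_or_lt with hp0 | hp0
    · simpa [← hp0] using hq i
    have hlog := Real.log_le_sub_one_of_pos (div_pos hq0 hp0)
    rw [Real.log_div hq0.ne' hp0.ne'] at hlog
    have hmul : p i * (Real.log (q i) - Real.log (p i)) ≤ p i * (q i / p i - 1) :=
      mul_le_mul_of_nonneg_left hlog hp0.le
    rw [mul_sub (p i) (q i / p i), mul_div_cancel₀ _ hp0.ne'] at hmul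
    rw [Real.negMulLog]
    linarith
  have hsum' := Finset.sum_le_sum fun i (_ : i ∈ Finset.univ) => hterm i
  simp only [Finset.sum_sub_distrib] at hsum'
  linarith

lemma IsDensity.vonNeumannEntropy_le [DecidableEq d] {ρ : Matrix d d ℂ} (hρ : IsDensity ρ)
    (W : unitaryGroup d ℂ) {q : d → ℝ} (hq : 0 ≤ q) (hsum : ∑ i, q i ≤ 1)
    (hsupp : ∀ i, q i = 0 → population W ρ i = 0) :
    vonNeumannEntropy ρ ≤ ∑ i, population W ρ i * -Real.log (q i) := by
  have hpop := hρ.population_mem_stdSimplex W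
  refine le_trans ?_ (sum_negMulLog_le_sum_mul_neg_log hpop.1 hq (hsum.trans hpop.2.ge) hsupp)
  obtain ⟨X, p, hp, rfl⟩ := hρ.exists_eq_conjDiag
  rw [vonNeumannEntropy_conjDiag, population_conjDiag]
  exact sum_negMulLog_le_sum_negMulLog_mulVec (transition_mem_doublyStochastic _) hp.1

lemma IsDensity.nonempty {ρ : Matrix d d ℂ} (hρ : IsDensity ρ) : Nonempty d := by
  by_contra h
  rw [not_nonempty_iff] at h
  simpa [trace] using hρ.2

end Entropy

/-! ### The trace norm and expectation values -/

section TraceNorm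

variable {d : Type*} [Fintype d]

lemma sum_sqrt_eigenvalues_sq [DecidableEq d] (A : Matrix d d ℂ) :
    ∑ i, √((isHermitian_conjTranspose_mul_self A).eigenvalues i) ^ 2 =
      ∑ i, ∑ j, ‖A i j‖ ^ 2 := by
  have htrace : (Aᴴ * A).trace = ((∑ i, ∑ j, ‖A i j‖ ^ 2 : ℝ) : ℂ) := by
    rw [trace, Finset.sum_comm, Complex.ofReal_sum]
    refine Finset.sum_congr rfl fun j _ => ?_
    rw [diag_apply, mul_apply, Complex.ofReal_sum]
    exact Finset.sum_congr rfl fun i _ => by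
      rw [conjTranspose_apply, Complex.star_def, Complex.conj_mul', Complex.ofReal_pow]
  simp only [Real.sq_sqrt ((posSemidef_conjTranspose_mul_self A).eigenvalues_nonneg _)]
  have h := (isHermitian_conjTranspose_mul_self A).trace_eq_sum_eigenvalues
  rw [htrace] at h
  exact Complex.ofReal_injective (h.trans (Complex.ofReal_sum _ _).symm).symm

lemma sum_norm_sq_le_traceNorm_sq [DecidableEq d] (A : Matrix d d ℂ) :
    ∑ i, ∑ j, ‖A i j‖ ^ 2 ≤ traceNorm A ^ 2 :=
  (sum_sqrt_eigenvalues_sq A).symm.trans_le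
    (Finset.sum_sq_le_sq_sum_of_nonneg fun _ _ => Real.sqrt_nonneg _)

lemma traceNorm_sq_le_card_mul_sum_norm_sq [DecidableEq d] (A : Matrix d d ℂ) :
    traceNorm A ^ 2 ≤ Fintype.card d * ∑ i, ∑ j, ‖A i j‖ ^ 2 :=
  sq_sum_le_card_mul_sum_sq.trans_eq (congrArg _ (sum_sqrt_eigenvalues_sq A))

lemma traceNorm_nonneg [DecidableEq d] (A : Matrix d d ℂ) : 0 ≤ traceNorm A :=
  Finset.sum_nonneg fun _ _ => Real.sqrt_nonneg _

lemma norm_apply_le_traceNorm [DecidableEq d] (A : Matrix d d ℂ) (i j : d) :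
    ‖A i j‖ ≤ traceNorm A := by
  refine le_of_sq_le_sq ?_ (traceNorm_nonneg A)
  calc ‖A i j‖ ^ 2 ≤ ∑ j, ‖A i j‖ ^ 2 :=
        Finset.single_le_sum (fun j _ => sq_nonneg ‖A i j‖) (Finset.mem_univ j)
    _ ≤ ∑ i, ∑ j, ‖A i j‖ ^ 2 :=
        Finset.single_le_sum (f := fun i => ∑ j, ‖A i j‖ ^ 2)
          (fun i _ => Finset.sum_nonneg fun j _ => sq_nonneg _) (Finset.mem_univ i)
    _ ≤ traceNorm A ^ 2 := sum_norm_sq_le_traceNorm_sq A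

lemma traceNorm_le [DecidableEq d] {A : Matrix d d ℂ} {δ : ℝ} (hδ : 0 ≤ δ)
    (hA : ∀ i j, ‖A i j‖ ≤ δ) : traceNorm A ≤ (Fintype.card d : ℝ) ^ 2 * δ := by
  refine le_of_sq_le_sq ?_ (by positivity)
  calc traceNorm A ^ 2 ≤ Fintype.card d * ∑ i, ∑ j, ‖A i j‖ ^ 2 :=
        traceNorm_sq_le_card_mul_sum_norm_sq A
    _ ≤ Fintype.card d * ∑ _i : d, ∑ _j : d, δ ^ 2 := by
        gcongr with i _ j _
        exact hA i j
    _ = (Fintype.card d : ℝ) ^ 3 * δ ^ 2 := by simp; ring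
    _ ≤ (Fintype.card d : ℝ) ^ 4 * δ ^ 2 := by
        gcongr ?_ * _
        rcases Nat.eq_zero_or_pos (Fintype.card d) with h | h
        · simp [h]
        · exact pow_le_pow_right₀ (Nat.one_le_cast.2 h) (by norm_num)
    _ = ((Fintype.card d : ℝ) ^ 2 * δ) ^ 2 := by ring

lemma expect_add_right (ρ A B : Matrix d d ℂ) : expect ρ (A + B) = expect ρ A + expect ρ B := by
  simp [expect, mul_add]

lemma expect_sub_left (ρ σ A : Matrix d d ℂ) : expect (ρ - σ) A = expect ρ A - expect σ A := by
  simp [expect, sub_mul]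

lemma expect_smul_right (ρ A : Matrix d d ℂ) (c : ℝ) : expect ρ ((c : ℂ) • A) = c * expect ρ A := by
  simp [expect]

lemma expect_sum_right {κ : Type*} (s : Finset κ) (ρ : Matrix d d ℂ) (A : κ → Matrix d d ℂ) :
    expect ρ (∑ j ∈ s, A j) = ∑ j ∈ s, expect ρ (A j) := by
  simp [expect, Finset.mul_sum, trace_sum]

lemma expect_sum_smul_right {ι : Type*} [Fintype ι] (ρ : Matrix d d ℂ) (b : ι → ℝ)
    (Q : ι → Matrix d d ℂ) : expect ρ (∑ j, (b j : ℂ) • Q j) = ∑ j, b j * expect ρ (Q j) := by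
  simp only [expect_sum_right, expect_smul_right]

lemma expect_one [DecidableEq d] (ρ : Matrix d d ℂ) : expect ρ 1 = ρ.trace.re := by
  rw [expect, Matrix.mul_one]

lemma continuous_expect (A : Matrix d d ℂ) : Continuous fun ρ : Matrix d d ℂ => expect ρ A :=
  Complex.continuous_re.comp (by fun_prop)

/-- The sum of the absolute values of the entries of a matrix, by which expectation values are
bounded. -/
noncomputable def entrySum (A : Matrix d d ℂ) : ℝ := ∑ i, ∑ j, ‖A j i‖

lemma entrySum_nonneg (A : Matrix d d ℂ) : 0 ≤ entrySum A :=
  Finset.sum_nonneg fun _ _ => Finset.sum_nonneg fun _ _ => norm_nonneg _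

lemma abs_expect_le_of_norm_apply_le {ρ : Matrix d d ℂ} {δ : ℝ} (hρ : ∀ i j, ‖ρ i j‖ ≤ δ)
    (A : Matrix d d ℂ) : |expect ρ A| ≤ δ * entrySum A :=
  calc |expect ρ A| ≤ ‖(ρ * A).trace‖ := Complex.abs_re_le_norm _
    _ ≤ ∑ i, ∑ j, ‖ρ i j * A j i‖ :=
      (norm_sum_le _ _).trans (Finset.sum_le_sum fun _ _ => norm_sum_le _ _)
    _ ≤ ∑ i, ∑ j, δ * ‖A j i‖ := by
      gcongr with i _ j _
      rw [norm_mul]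
      exact mul_le_mul_of_nonneg_right (hρ i j) (norm_nonneg _)
    _ = δ * entrySum A := by simp only [entrySum, Finset.mul_sum]

lemma abs_expect_le [DecidableEq d] (ρ A : Matrix d d ℂ) :
    |expect ρ A| ≤ traceNorm ρ * entrySum A :=
  abs_expect_le_of_norm_apply_le (norm_apply_le_traceNorm ρ) A

lemma exists_pos_mem_stdSimplex_neg_log_le {p : d → ℝ} (hp : p ∈ stdSimplex ℝ d) {η : ℝ}
    (hη : 0 < η) : ∃ q ∈ stdSimplex ℝ d, (∀ i, 0 < q i) ∧
      ∑ i, p i * -Real.log (q i) ≤ ∑ i, Real.negMulLog (p i) + η := by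
  have : Nonempty d := by
    by_contra h
    rw [not_nonempty_iff] at h
    simpa using hp.2
  have hcard : (0 : ℝ) < Fintype.card d := by exact_mod_cast Fintype.card_pos
  have ht : Real.exp (-η) < 1 := by simpa using hη
  have huniform : 0 < (1 - Real.exp (-η)) / Fintype.card d := div_pos (by linarith) hcard
  set q : d → ℝ := fun i => Real.exp (-η) * p i + (1 - Real.exp (-η)) / Fintype.card d with hq
  have hqp : ∀ i, Real.exp (-η) * p i < q i := fun i => by simp only [hq]; linarith
  have hpos : ∀ i, 0 < q i := fun i =>
    (mul_nonneg (Real.exp_pos _).le (hp.1 i)).trans_lt (hqp i)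
  refine ⟨q, ⟨fun i => (hpos i).le, ?_⟩, hpos, ?_⟩
  · simp only [hq, Finset.sum_add_distrib, ← Finset.mul_sum, hp.2, Finset.sum_const,
      Finset.card_univ, nsmul_eq_mul]
    field_simp
    ring
  · have hterm : ∀ i, p i * -Real.log (q i) ≤ Real.negMulLog (p i) + η * p i := by
      intro i
      rcases (hp.1 i).eq_or_lt with h | h
      · simp [← h]
      have hlog := Real.log_le_log (mul_pos (Real.exp_pos _) h) (hqp i).le
      rw [Real.log_mul (Real.exp_pos _).ne' h.ne', Real.log_exp] at hlog
      rw [Real.negMulLog]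
      nlinarith
    calc ∑ i, p i * -Real.log (q i) ≤ ∑ i, (Real.negMulLog (p i) + η * p i) :=
          Finset.sum_le_sum fun i _ => hterm i
      _ = ∑ i, Real.negMulLog (p i) + η := by
          rw [Finset.sum_add_distrib, ← Finset.mul_sum, hp.2, mul_one]

lemma IsDensity.exists_vonNeumannEntropy_le_expect [DecidableEq d] {ρ : Matrix d d ℂ}
    (hρ : IsDensity ρ) {η : ℝ} (hη : 0 < η) :
    ∃ K : Matrix d d ℂ, (∀ σ, IsDensity σ → vonNeumannEntropy σ ≤ expect σ K) ∧
      expect ρ K ≤ vonNeumannEntropy ρ + η := by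
  obtain ⟨W, p, hp, rfl⟩ := hρ.exists_eq_conjDiag
  obtain ⟨q, hq, hpos, hcross⟩ := exists_pos_mem_stdSimplex_neg_log_le hp hη
  refine ⟨conjDiag W fun i => -Real.log (q i), fun σ hσ => ?_, ?_⟩
  · rw [expect_conjDiag]
    exact hσ.vonNeumannEntropy_le W hq.1 hq.2.le fun i hi => absurd hi (hpos i).ne'
  · rwa [expect_conjDiag, population_conjDiag_self, vonNeumannEntropy_conjDiag]

end TraceNorm

/-! ### Composite systems -/

section Composite

variable {d e : Type*}

lemma kronecker_sum_smul {ι : Type*} [Fintype ι] (A : Matrix d d ℂ) (b : ι → ℂ)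
    (C : ι → Matrix e e ℂ) : A ⊗ₖ (∑ j, b j • C j) = ∑ j, b j • (A ⊗ₖ C j) := by
  ext
  simp only [kroneckerMap_apply, Matrix.sum_apply, Matrix.smul_apply, smul_eq_mul,
    Finset.mul_sum, mul_left_comm]

variable [Fintype e]

lemma partialTrace_kronecker (A : Matrix d d ℂ) (B : Matrix e e ℂ) :
    partialTrace (A ⊗ₖ B) = B.trace • A := by
  ext i j
  simp [partialTrace, trace, Finset.mul_sum, mul_comm]

lemma posSemidef_partialTrace {A : Matrix (d × e) (d × e) ℂ} (hA : A.PosSemidef) :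
    (partialTrace A).PosSemidef := by
  have hsum : partialTrace A = ∑ k : e, A.submatrix (fun i => (i, k)) (fun i => (i, k)) := by
    ext i j
    simp [partialTrace, Matrix.sum_apply]
  rw [hsum]
  exact posSemidef_sum _ fun k _ => hA.submatrix _

variable [Fintype d]

lemma trace_partialTrace (A : Matrix (d × e) (d × e) ℂ) : (partialTrace A).trace = A.trace := by
  simp only [trace, diag_apply, partialTrace, of_apply, Fintype.sum_prod_type]

lemma IsDensity.partialTrace {A : Matrix (d × e) (d × e) ℂ} (hA : IsDensity A) :
    IsDensity (partialTrace A) :=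
  ⟨posSemidef_partialTrace hA.1, by rw [trace_partialTrace, hA.2]⟩

lemma IsDensity.kronecker {A : Matrix d d ℂ} {B : Matrix e e ℂ} (hA : IsDensity A)
    (hB : IsDensity B) : IsDensity (A ⊗ₖ B) :=
  ⟨hA.1.kronecker hB.1, by rw [trace_kronecker, hA.2, hB.2, mul_one]⟩

lemma expect_kronecker_one_kronecker [DecidableEq d] {A : Matrix d d ℂ} (hA : A.trace = 1)
    (B C : Matrix e e ℂ) :
    expect (A ⊗ₖ B) ((1 : Matrix d d ℂ) ⊗ₖ C) = expect B C := by
  rw [expect, ← mul_kronecker_mul, Matrix.mul_one, trace_kronecker, hA, one_mul, expect]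

variable [DecidableEq e]

lemma expect_kronecker_one (F : Matrix (d × e) (d × e) ℂ) (A : Matrix d d ℂ) :
    expect F (A ⊗ₖ (1 : Matrix e e ℂ)) = expect (partialTrace F) A := by
  rw [expect, expect]
  congr 1
  simp only [trace, diag_apply, mul_apply, partialTrace, of_apply, Fintype.sum_prod_type,
    kroneckerMap_apply, Finset.sum_mul, one_apply, mul_ite, mul_one, mul_zero,
    Finset.sum_ite_eq', Finset.mem_univ, if_true]
  exact Finset.sum_congr rfl fun i _ => Finset.sum_comm

variable [DecidableEq d]

/-- The tensor product of two unitaries. -/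
def kroneckerUnitary (W : unitaryGroup d ℂ) (V : unitaryGroup e ℂ) : unitaryGroup (d × e) ℂ :=
  ⟨(W : Matrix d d ℂ) ⊗ₖ (V : Matrix e e ℂ), kronecker_mem_unitary W.2 V.2⟩

lemma conjDiag_kronecker_conjDiag (W : unitaryGroup d ℂ) (V : unitaryGroup e ℂ) (p : d → ℝ)
    (q : e → ℝ) :
    conjDiag W p ⊗ₖ conjDiag V q = conjDiag (kroneckerUnitary W V) fun x => p x.1 * q x.2 := by
  simp only [conjDiag_apply, mul_kronecker_mul, conjTranspose_kronecker, kroneckerUnitary,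
    diagonal_kronecker_diagonal, Complex.ofReal_mul]

lemma one_kronecker_conjDiag (W : unitaryGroup d ℂ) (V : unitaryGroup e ℂ) (q : e → ℝ) :
    (1 : Matrix d d ℂ) ⊗ₖ conjDiag V q = conjDiag (kroneckerUnitary W V) fun x => q x.2 := by
  rw [← map_one (conjDiag W), conjDiag_kronecker_conjDiag]
  simp only [Pi.one_apply, one_mul]

lemma conjDiag_kronecker_one (W : unitaryGroup d ℂ) (V : unitaryGroup e ℂ) (p : d → ℝ) :
    conjDiag W p ⊗ₖ (1 : Matrix e e ℂ) = conjDiag (kroneckerUnitary W V) fun x => p x.1 := by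
  rw [← map_one (conjDiag V), conjDiag_kronecker_conjDiag]
  simp only [Pi.one_apply, mul_one]

lemma IsDensity.evolve {A : Matrix d d ℂ} (hA : IsDensity A) (U : unitaryGroup d ℂ) :
    IsDensity (evolve U A) := by
  obtain ⟨W, p, hp, rfl⟩ := hA.exists_eq_conjDiag
  rw [evolve_conjDiag]
  exact isDensity_conjDiag _ hp

lemma IsDensity.vonNeumannEntropy_evolve {A : Matrix d d ℂ} (hA : IsDensity A)
    (U : unitaryGroup d ℂ) : vonNeumannEntropy (MacroThermo.evolve U A) = vonNeumannEntropy A := by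
  obtain ⟨W, p, -, rfl⟩ := hA.exists_eq_conjDiag
  rw [evolve_conjDiag, vonNeumannEntropy_conjDiag, vonNeumannEntropy_conjDiag]

lemma IsDensity.vonNeumannEntropy_kronecker {A : Matrix d d ℂ} {B : Matrix e e ℂ}
    (hA : IsDensity A) (hB : IsDensity B) :
    vonNeumannEntropy (A ⊗ₖ B) = vonNeumannEntropy A + vonNeumannEntropy B := by
  obtain ⟨W, p, hp, rfl⟩ := hA.exists_eq_conjDiag
  obtain ⟨V, q, hq, rfl⟩ := hB.exists_eq_conjDiag
  simp only [conjDiag_kronecker_conjDiag, vonNeumannEntropy_conjDiag, Real.negMulLog_mul,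
    Fintype.sum_prod_type, Finset.sum_add_distrib, ← Finset.sum_mul, ← Finset.mul_sum, hp.2, hq.2,
    one_mul]

lemma sum_population_kroneckerUnitary (W : unitaryGroup d ℂ) (V : unitaryGroup e ℂ)
    (F : Matrix (d × e) (d × e) ℂ) (i : d) :
    ∑ k, population (kroneckerUnitary W V) F (i, k) = population W (partialTrace F) i := by
  have h := expect_kronecker_one F (conjDiag W (Pi.single i 1))
  rw [conjDiag_kronecker_one W V, expect_conjDiag, expect_conjDiag, Fintype.sum_prod_type] at h
  simpa [Pi.single_apply, Finset.sum_ite_irrel] using h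

/-- Gibbs' inequality with the product of the reduced state and the state `conjDiag V g` as the
reference. -/
lemma IsDensity.vonNeumannEntropy_le_add_expect {F : Matrix (d × e) (d × e) ℂ} (hF : IsDensity F)
    (V : unitaryGroup e ℂ) {g : e → ℝ} (hg : ∀ k, 0 < g k) (hsum : ∑ k, g k = 1) :
    vonNeumannEntropy F ≤ vonNeumannEntropy (MacroThermo.partialTrace F) +
      expect F ((1 : Matrix d d ℂ) ⊗ₖ conjDiag V fun k => -Real.log (g k)) := by
  obtain ⟨Y, s, hs, hY⟩ := hF.partialTrace.exists_eq_conjDiag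
  have hmarginal : ∀ i, ∑ k, population (kroneckerUnitary Y V) F (i, k) = s i := fun i => by
    rw [sum_population_kroneckerUnitary, hY, population_conjDiag_self]
  have hzero : ∀ i, s i = 0 → ∀ k, population (kroneckerUnitary Y V) F (i, k) = 0 := fun i hi k =>
    (Finset.sum_eq_zero_iff_of_nonneg fun k _ =>
      (hF.population_mem_stdSimplex _).1 (i, k)).1 ((hmarginal i).trans hi) k (Finset.mem_univ k)
  have hlog : ∀ x : d × e,
      population (kroneckerUnitary Y V) F x * -Real.log (s x.1 * g x.2) =
        population (kroneckerUnitary Y V) F x * -Real.log (s x.1) +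
          population (kroneckerUnitary Y V) F x * -Real.log (g x.2) := by
    rintro ⟨i, k⟩
    by_cases hi : s i = 0
    · simp only [hzero i hi k, zero_mul, add_zero]
    · rw [Real.log_mul hi (hg k).ne']
      ring
  refine (hF.vonNeumannEntropy_le (kroneckerUnitary Y V) (q := fun x => s x.1 * g x.2)
    (fun x => mul_nonneg (hs.1 _) (hg _).le) ?_ fun x hx =>
      hzero x.1 ((mul_eq_zero.1 hx).resolve_right (hg _).ne') x.2).trans_eq ?_
  · rw [Fintype.sum_prod_type]
    simp only [← Finset.mul_sum, hsum, mul_one, hs.2, le_refl]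
  · rw [hY, vonNeumannEntropy_conjDiag, one_kronecker_conjDiag Y V, expect_conjDiag,
      Finset.sum_congr rfl fun x _ => hlog x, Finset.sum_add_distrib]
    congr 1
    rw [Fintype.sum_prod_type]
    simp only [← Finset.sum_mul, hmarginal, Real.negMulLog]
    exact Finset.sum_congr rfl fun i _ => by ring

end Composite

section Tensor

variable {N : ℕ} {D : Fin N → ℕ}

lemma piTensor_mul (A B : (l : Fin N) → Matrix (Fin (D l)) (Fin (D l)) ℂ) :
    piTensor A * piTensor B = piTensor fun l => A l * B l := by
  ext a b
  simp only [piTensor, mul_apply, of_apply]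
  rw [Finset.prod_univ_sum, Fintype.piFinset_univ]
  exact Finset.sum_congr rfl fun c _ => Finset.prod_mul_distrib.symm

lemma piTensor_diagonal (g : (l : Fin N) → Fin (D l) → ℂ) :
    piTensor (fun l => diagonal (g l)) = diagonal fun x => ∏ l, g l (x l) := by
  ext a b
  simp only [piTensor, of_apply, diagonal_apply]
  split_ifs with h
  · subst h; simp
  · obtain ⟨l, hl⟩ := Function.ne_iff.1 h
    exact Finset.prod_eq_zero (Finset.mem_univ l) (if_neg hl)

lemma piTensor_one : piTensor (fun l => (1 : Matrix (Fin (D l)) (Fin (D l)) ℂ)) = 1 := by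
  have hdiag := piTensor_diagonal (D := D) fun _ _ => 1
  simpa using hdiag

lemma conjTranspose_piTensor (A : (l : Fin N) → Matrix (Fin (D l)) (Fin (D l)) ℂ) :
    (piTensor A)ᴴ = piTensor fun l => (A l)ᴴ := by
  ext a b
  simp [piTensor, conjTranspose_apply]

lemma trace_piTensor (A : (l : Fin N) → Matrix (Fin (D l)) (Fin (D l)) ℂ) :
    (piTensor A).trace = ∏ l, (A l).trace := by
  simp only [trace, diag_apply, piTensor, of_apply]
  rw [Finset.prod_univ_sum, Fintype.piFinset_univ]

/-- The tensor product of a family of unitaries. -/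
def piTensorUnitary (W : (l : Fin N) → unitaryGroup (Fin (D l)) ℂ) :
    unitaryGroup ((l : Fin N) → Fin (D l)) ℂ :=
  ⟨piTensor fun l => W l, by
    rw [mem_unitaryGroup_iff, star_eq_conjTranspose, conjTranspose_piTensor, piTensor_mul,
      ← piTensor_one]
    exact congrArg piTensor (funext fun l => mem_unitaryGroup_iff.1 (W l).2)⟩

lemma piTensor_conjDiag (W : (l : Fin N) → unitaryGroup (Fin (D l)) ℂ)
    (g : (l : Fin N) → Fin (D l) → ℝ) :
    piTensor (fun l => conjDiag (W l) (g l)) =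
      conjDiag (piTensorUnitary W) fun x => ∏ l, g l (x l) := by
  simp only [conjDiag_apply, ← piTensor_mul, piTensorUnitary, conjTranspose_piTensor,
    piTensor_diagonal, Complex.ofReal_prod]

lemma isDensity_piTensor {A : (l : Fin N) → Matrix (Fin (D l)) (Fin (D l)) ℂ}
    (hA : ∀ l, IsDensity (A l)) : IsDensity (piTensor A) := by
  choose W p hp hW using fun l => (hA l).exists_eq_conjDiag
  refine ⟨?_, by rw [trace_piTensor]; exact Finset.prod_eq_one fun l _ => (hA l).2⟩
  rw [funext hW, piTensor_conjDiag]
  exact posSemidef_conjDiag _ fun x => Finset.prod_nonneg fun l _ => (hp l).1 (x l)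

lemma piTensor_update_one_apply (l : Fin N) (M : Matrix (Fin (D l)) (Fin (D l)) ℂ)
    (a b : (l : Fin N) → Fin (D l)) :
    piTensor (Function.update (fun _ => 1) l M) a b =
      M (a l) (b l) * ∏ k ∈ Finset.univ.erase l,
        (1 : Matrix (Fin (D k)) (Fin (D k)) ℂ) (a k) (b k) := by
  rw [piTensor, of_apply, ← Finset.mul_prod_erase _ _ (Finset.mem_univ l), Function.update_self]
  congr 1
  refine Finset.prod_congr rfl fun k hk => ?_
  rw [Function.update_of_ne (Finset.ne_of_mem_erase hk)]

lemma piTensor_update_one_sum_smul {ι : Type*} [Fintype ι] (l : Fin N) (b : ι → ℂ)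
    (M : ι → Matrix (Fin (D l)) (Fin (D l)) ℂ) :
    piTensor (Function.update (fun _ => 1) l (∑ j, b j • M j)) =
      ∑ j, b j • piTensor (Function.update (fun _ => 1) l (M j)) := by
  ext
  simp only [piTensor_update_one_apply, Matrix.sum_apply, Matrix.smul_apply, smul_eq_mul,
    Finset.sum_mul, mul_assoc]

lemma piTensor_update_one_conjDiag (W : (l : Fin N) → unitaryGroup (Fin (D l)) ℂ) (l : Fin N)
    (m : Fin (D l) → ℝ) :
    piTensor (Function.update (fun _ => 1) l (conjDiag (W l) m)) =
      conjDiag (piTensorUnitary W) fun x => m (x l) := by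
  have hupdate : (Function.update (fun _ => 1) l (conjDiag (W l) m) :
      (l : Fin N) → Matrix (Fin (D l)) (Fin (D l)) ℂ) = fun k => conjDiag (W k)
        (Function.update (β := fun k => Fin (D k) → ℝ) (fun _ => 1) l m k) := by
    funext k
    rcases eq_or_ne k l with rfl | hk
    · simp only [Function.update_self]
    · rw [Function.update_of_ne hk, Function.update_of_ne hk, map_one]
  rw [hupdate, piTensor_conjDiag]
  congr 1
  funext x
  rw [← Finset.mul_prod_erase _ _ (Finset.mem_univ l), Function.update_self, Finset.prod_eq_one,
    mul_one]
  intro k hk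
  rw [Function.update_of_ne (Finset.ne_of_mem_erase hk), Pi.one_apply]

end Tensor

/-! ### Gibbs states -/

section Gibbs

variable {ι d : Type*} [Fintype ι]

lemma isHermitian_sum_smul {Q : ι → Matrix d d ℂ} (hQ : ∀ j, (Q j).IsHermitian) (b : ι → ℝ) :
    (∑ j, (b j : ℂ) • Q j).IsHermitian := by
  rw [IsHermitian, conjTranspose_sum]
  exact Finset.sum_congr rfl fun j _ => by
    rw [conjTranspose_smul, hQ j, Complex.star_def, Complex.conj_ofReal]

variable [Fintype d]

/-- The partition function of a system with the energy levels `m`, at unit temperature. -/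
noncomputable def partition (m : d → ℝ) : ℝ := ∑ i, Real.exp (-m i)

/-- The Gibbs distribution over the energy levels `m`, at unit temperature. -/
noncomputable def boltzmann (m : d → ℝ) (i : d) : ℝ := Real.exp (-m i) / partition m

lemma partition_pos [Nonempty d] (m : d → ℝ) : 0 < partition m :=
  Finset.sum_pos (fun _ _ => Real.exp_pos _) Finset.univ_nonempty

lemma boltzmann_pos [Nonempty d] (m : d → ℝ) (i : d) : 0 < boltzmann m i :=
  div_pos (Real.exp_pos _) (partition_pos m)

lemma boltzmann_mem_stdSimplex [Nonempty d] (m : d → ℝ) : boltzmann m ∈ stdSimplex ℝ d := by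
  refine ⟨fun i => (boltzmann_pos m i).le, ?_⟩
  simp only [boltzmann, ← Finset.sum_div]
  exact div_self (partition_pos m).ne'

lemma neg_log_boltzmann [Nonempty d] (m : d → ℝ) (i : d) :
    -Real.log (boltzmann m i) = m i + Real.log (partition m) := by
  rw [boltzmann, Real.log_div (Real.exp_pos _).ne' (partition_pos m).ne', Real.log_exp]
  ring

variable [DecidableEq d]

lemma exp_conjDiag (W : unitaryGroup d ℂ) (p : d → ℝ) :
    NormedSpace.exp (conjDiag W p) = conjDiag W fun i => Real.exp (p i) := by
  have hinv : (W : Matrix d d ℂ)⁻¹ = (W : Matrix d d ℂ)ᴴ :=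
    inv_eq_right_inv (mem_unitaryGroup_iff.1 W.2)
  have hunit : IsUnit (W : Matrix d d ℂ) := (Unitary.toUnits W).isUnit
  rw [conjDiag_apply, conjDiag_apply, ← hinv, exp_conj _ _ hunit, exp_diagonal]
  congr 3
  funext i
  rw [Pi.coe_exp, ← Complex.exp_eq_exp_ℂ, ← Complex.ofReal_exp]

lemma gibbs_eq_conjDiag {b : ι → ℝ} {Q : ι → Matrix d d ℂ} {W : unitaryGroup d ℂ} {m : d → ℝ}
    (h : ∑ j, (b j : ℂ) • Q j = conjDiag W m) : gibbs b Q = conjDiag W (boltzmann m) := by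
  have hboltzmann : boltzmann m = (partition m)⁻¹ • fun i => Real.exp (-m i) := by
    ext i
    rw [boltzmann, div_eq_inv_mul, Pi.smul_apply, smul_eq_mul]
  rw [gibbs, h, ← map_neg, exp_conjDiag, trace_conjDiag, hboltzmann, map_smul, ← Complex.ofReal_inv,
    Complex.coe_smul]
  rfl

lemma isDensity_gibbs [Nonempty d] {Q : ι → Matrix d d ℂ} (hQ : ∀ j, (Q j).IsHermitian)
    (b : ι → ℝ) : IsDensity (gibbs b Q) := by
  obtain ⟨W, h⟩ := exists_eq_conjDiag_eigenvalues (isHermitian_sum_smul hQ b)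
  rw [gibbs_eq_conjDiag h]
  exact isDensity_conjDiag W (boltzmann_mem_stdSimplex _)

end Gibbs

/-! ### The entropy balance -/

namespace Environment

variable {ι : Type*} (E : Environment ι)

instance (l : Fin E.N) : Nonempty (Fin (E.dim l)) := ⟨⟨0, E.dim_pos l⟩⟩

lemma gibbsFamily_mem_thermalMicrostates [Fintype ι] (β : ι → ℝ) :
    E.gibbsFamily β ∈ E.thermalMicrostates β := fun l =>
  ⟨isDensity_gibbs (E.hermitian l) β, fun _ => rfl⟩

lemma exists_piTensor_gibbsFamily_eq_conjDiag [Fintype ι] (β : ι → ℝ) :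
    ∃ (V : unitaryGroup E.Idx ℂ) (g : E.Idx → ℝ) (c : ℝ), (∀ x, 0 < g x) ∧
      piTensor (E.gibbsFamily β) = conjDiag V g ∧
      conjDiag V (fun x => -Real.log (g x)) = ∑ j, (β j : ℂ) • E.charge j + (c : ℂ) • 1 := by
  choose V hV using fun l =>
    exists_eq_conjDiag_eigenvalues (isHermitian_sum_smul (E.hermitian l) β)
  set m := fun l => (isHermitian_sum_smul (E.hermitian l) β).eigenvalues
  refine ⟨piTensorUnitary V, fun x => ∏ l, boltzmann (m l) (x l), ∑ l, Real.log (partition (m l)),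
    fun x => Finset.prod_pos fun l _ => boltzmann_pos _ _, ?_, ?_⟩
  · rw [← piTensor_conjDiag]
    exact congrArg piTensor (funext fun l => gibbs_eq_conjDiag (hV l))
  have hcharge : ∑ j, (β j : ℂ) • E.charge j =
      conjDiag (piTensorUnitary V) (∑ l, fun x => m l (x l)) := by
    simp only [charge, Finset.smul_sum, map_sum]
    rw [Finset.sum_comm]
    refine Finset.sum_congr rfl fun l _ => ?_
    rw [← piTensor_update_one_sum_smul, hV l, piTensor_update_one_conjDiag]
  have hlog : (fun x : E.Idx => -Real.log (∏ l, boltzmann (m l) (x l))) =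
      (∑ l, fun x => m l (x l)) + (∑ l, Real.log (partition (m l))) • 1 := by
    funext x
    rw [Real.log_prod fun l _ => (boltzmann_pos _ _).ne', ← Finset.sum_neg_distrib]
    simp only [neg_log_boltzmann, Finset.sum_add_distrib, Pi.add_apply, Finset.sum_apply,
      Pi.smul_apply, Pi.one_apply, smul_eq_mul, mul_one]
  rw [hlog, map_add, map_smul, map_one, hcharge, Complex.coe_smul]

lemma partialTrace_initial {d : Type*} (ρ : Matrix d d ℂ) {σ : E.Family}
    (hσ : ∀ l, IsDensity (σ l)) : partialTrace (E.initial ρ σ) = ρ := by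
  rw [initial, partialTrace_kronecker, (isDensity_piTensor hσ).2, one_smul]

variable {d : Type*} [Fintype d]

lemma isDensity_initial {ρ : Matrix d d ℂ} (hρ : IsDensity ρ) {σ : E.Family}
    (hσ : ∀ l, IsDensity (σ l)) : IsDensity (E.initial ρ σ) :=
  hρ.kronecker (isDensity_piTensor hσ)

variable [DecidableEq d]

/-- The increase of the expectation value of the `j`-th observable of the environment. -/
noncomputable def envIncrease (U : unitaryGroup (d × E.Idx) ℂ) (ρ : Matrix d d ℂ)
    (σ : E.Family) (j : ι) : ℝ :=
  expect (E.final U ρ σ) ((1 : Matrix d d ℂ) ⊗ₖ E.charge j) -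
    expect (E.initial ρ σ) ((1 : Matrix d d ℂ) ⊗ₖ E.charge j)

lemma final_eq_evolve (U : unitaryGroup (d × E.Idx) ℂ) (ρ : Matrix d d ℂ) (σ : E.Family) :
    E.final U ρ σ = evolve U (E.initial ρ σ) := rfl

lemma isDensity_final (U : unitaryGroup (d × E.Idx) ℂ) {ρ : Matrix d d ℂ} (hρ : IsDensity ρ)
    {σ : E.Family} (hσ : ∀ l, IsDensity (σ l)) : IsDensity (E.final U ρ σ) :=
  (E.isDensity_initial hρ hσ).evolve U

lemma decrease_eq (Q : ι → Matrix d d ℂ) (U : unitaryGroup (d × E.Idx) ℂ) (ρ : Matrix d d ℂ)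
    {σ : E.Family} (hσ : ∀ l, IsDensity (σ l)) (j : ι) :
    E.decrease Q U ρ σ j = expect ρ (Q j) - expect (partialTrace (E.final U ρ σ)) (Q j) -
      E.envIncrease U ρ σ j := by
  rw [decrease, totalCharge, expect_add_right, expect_add_right, expect_kronecker_one,
    expect_kronecker_one, E.partialTrace_initial ρ hσ, envIncrease]
  ring

lemma vonNeumannEntropy_le_add_sum_mul_envIncrease [Fintype ι] (β : ι → ℝ)
    (U : unitaryGroup (d × E.Idx) ℂ) {ρ : Matrix d d ℂ} (hρ : IsDensity ρ) :
    vonNeumannEntropy ρ ≤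
      vonNeumannEntropy (partialTrace (E.final U ρ (E.gibbsFamily β))) +
        ∑ j, β j * E.envIncrease U ρ (E.gibbsFamily β) j := by
  have hσ : ∀ l, IsDensity (E.gibbsFamily β l) :=
    fun l => (E.gibbsFamily_mem_thermalMicrostates β l).1
  obtain ⟨V, g, c, hg, hgibbs, hlog⟩ := E.exists_piTensor_gibbsFamily_eq_conjDiag β
  have hγ : IsDensity (conjDiag V g) := hgibbs ▸ isDensity_piTensor hσ
  have hsum : ∑ x, g x = 1 := by exact_mod_cast (trace_conjDiag V g).symm.trans hγ.2
  set K := conjDiag V fun x => -Real.log (g x)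
  have hexpect : ∀ F : Matrix (d × E.Idx) (d × E.Idx) ℂ, F.trace = 1 →
      expect F ((1 : Matrix d d ℂ) ⊗ₖ K) =
        ∑ j, β j * expect F ((1 : Matrix d d ℂ) ⊗ₖ E.charge j) + c := by
    intro F hF
    rw [hlog, kronecker_add, kronecker_smul, one_kronecker_one, kronecker_sum_smul,
      expect_add_right, expect_smul_right, expect_sum_smul_right, expect_one, hF, Complex.one_re,
      mul_one]
  have hinitial : vonNeumannEntropy (E.final U ρ (E.gibbsFamily β)) =
      vonNeumannEntropy ρ + expect (E.initial ρ (E.gibbsFamily β)) ((1 : Matrix d d ℂ) ⊗ₖ K) := by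
    rw [final_eq_evolve, (E.isDensity_initial hρ hσ).vonNeumannEntropy_evolve, initial, hgibbs,
      hρ.vonNeumannEntropy_kronecker hγ, expect_kronecker_one_kronecker hρ.2, expect_conjDiag,
      population_conjDiag_self, vonNeumannEntropy_conjDiag]
    simp only [Real.negMulLog, neg_mul, mul_neg]
  have hfinal := (E.isDensity_final U hρ hσ).vonNeumannEntropy_le_add_expect V hg hsum
  rw [hinitial, hexpect _ (E.isDensity_final U hρ hσ).2,
    hexpect _ (E.isDensity_initial hρ hσ).2] at hfinal
  simp only [envIncrease, mul_sub, Finset.sum_sub_distrib]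
  linarith

lemma sum_mul_decrease_le [Fintype ι] (β : ι → ℝ) (Q : ι → Matrix d d ℂ)
    (U : unitaryGroup (d × E.Idx) ℂ) {ρ : Matrix d d ℂ} (hρ : IsDensity ρ) :
    ∑ j, β j * E.decrease Q U ρ (E.gibbsFamily β) j ≤
      freeEntropy β Q ρ - freeEntropy β Q (partialTrace (E.final U ρ (E.gibbsFamily β))) := by
  have hentropy := E.vonNeumannEntropy_le_add_sum_mul_envIncrease β U hρ
  simp only [E.decrease_eq Q U ρ fun l => (E.gibbsFamily_mem_thermalMicrostates β l).1, mul_sub,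
    Finset.sum_sub_distrib, freeEntropy]
  linarith

end Environment

/-! ### Enlarging the environment -/

section Submatrix

variable {d e f : Type*} [Fintype e]

/-- The equivalence that exchanges the second and the third factor. -/
def swapRight (d e f : Type*) : (d × f) × e ≃ (d × e) × f where
  toFun x := ((x.1.1, x.2), x.1.2)
  invFun x := ((x.1.1, x.2), x.1.2)

lemma partialTrace_submatrix_swapRight (X : Matrix (d × e) (d × e) ℂ) (s : Matrix f f ℂ) :
    partialTrace ((X ⊗ₖ s).submatrix (swapRight d e f) (swapRight d e f)) =
      partialTrace X ⊗ₖ s := by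
  ext ⟨a, x⟩ ⟨b, y⟩
  simp [partialTrace, swapRight, Finset.sum_mul]

variable [Fintype d]

lemma expect_submatrix (g : d ≃ e) (M A : Matrix e e ℂ) :
    expect (M.submatrix g g) (A.submatrix g g) = expect M A := by
  rw [expect, expect, submatrix_mul_equiv]
  exact congrArg Complex.re (Equiv.sum_comp g fun i => (M * A) i i)

variable [DecidableEq d]

lemma expect_submatrix_swapRight [Fintype f] [DecidableEq f] (X : Matrix (d × e) (d × e) ℂ)
    {s : Matrix f f ℂ} (hs : s.trace = 1) (A : Matrix e e ℂ) :
    expect ((X ⊗ₖ s).submatrix (swapRight d e f) (swapRight d e f))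
      ((1 : Matrix (d × f) (d × f) ℂ) ⊗ₖ A) = expect X ((1 : Matrix d d ℂ) ⊗ₖ A) := by
  have hswap : (1 : Matrix (d × f) (d × f) ℂ) ⊗ₖ A =
      (((1 : Matrix d d ℂ) ⊗ₖ A) ⊗ₖ (1 : Matrix f f ℂ)).submatrix
        (swapRight d e f) (swapRight d e f) := by
    rw [← one_kronecker_one]
    ext ⟨⟨a, x⟩, k⟩ ⟨⟨b, y⟩, k'⟩
    exact mul_right_comm _ _ _
  rw [hswap, expect_submatrix, expect_kronecker_one, partialTrace_kronecker, hs, one_smul]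

variable [DecidableEq e]

/-- A unitary in a relabelled basis. -/
def submatrixUnitary (g : d ≃ e) (W : unitaryGroup e ℂ) : unitaryGroup d ℂ :=
  ⟨(W : Matrix e e ℂ).submatrix g g, by
    rw [mem_unitaryGroup_iff, star_eq_conjTranspose, conjTranspose_submatrix,
      submatrix_mul_equiv, ← star_eq_conjTranspose, mem_unitaryGroup_iff.1 W.2,
      submatrix_one_equiv]⟩

lemma evolve_submatrix (g : d ≃ e) (W : unitaryGroup e ℂ) (A : Matrix e e ℂ) :
    evolve (submatrixUnitary g W) (A.submatrix g g) = (evolve W A).submatrix g g := by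
  simp only [evolve, submatrixUnitary, conjTranspose_submatrix, submatrix_mul_equiv]

lemma evolve_kronecker (U : unitaryGroup d ℂ) (V : unitaryGroup e ℂ) (A : Matrix d d ℂ)
    (B : Matrix e e ℂ) :
    evolve (kroneckerUnitary U V) (A ⊗ₖ B) = evolve U A ⊗ₖ evolve V B := by
  simp only [evolve, kroneckerUnitary, conjTranspose_kronecker, mul_kronecker_mul]

lemma partialTrace_evolve_kroneckerUnitary_one (V : unitaryGroup d ℂ)
    (M : Matrix (d × e) (d × e) ℂ) :
    partialTrace (evolve (kroneckerUnitary V 1) M) = evolve V (partialTrace M) := by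
  ext a b
  simp only [partialTrace, evolve, kroneckerUnitary, of_apply, mul_apply, conjTranspose_apply,
    Fintype.sum_prod_type, kroneckerMap_apply, UnitaryGroup.one_val, one_apply, mul_ite, ite_mul,
    apply_ite star, star_zero, mul_one, mul_zero, zero_mul, Finset.sum_ite_eq, Finset.mem_univ,
    if_true, Finset.mul_sum, Finset.sum_mul]
  rw [Finset.sum_comm]
  exact Finset.sum_congr rfl fun y _ => Finset.sum_comm

lemma expect_evolve_kroneckerUnitary_one (V : unitaryGroup d ℂ) (M : Matrix (d × e) (d × e) ℂ)
    (A : Matrix e e ℂ) :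
    expect (evolve (kroneckerUnitary V 1) M) ((1 : Matrix d d ℂ) ⊗ₖ A) =
      expect M ((1 : Matrix d d ℂ) ⊗ₖ A) := by
  refine expect_evolve_of_commute ?_ M
  rw [kroneckerUnitary, Commute, SemiconjBy, ← mul_kronecker_mul, ← mul_kronecker_mul,
    UnitaryGroup.one_val, Matrix.one_mul, Matrix.mul_one, Matrix.one_mul, Matrix.mul_one]

end Submatrix

section Tensor

variable {N : ℕ} {D : Fin (N + 1) → ℕ}

lemma piTensor_succ (A : (l : Fin (N + 1)) → Matrix (Fin (D l)) (Fin (D l)) ℂ)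
    (a b : (l : Fin (N + 1)) → Fin (D l)) :
    piTensor A a b = A 0 (a 0) (b 0) *
      piTensor (fun l : Fin N => A l.succ) (fun l => a l.succ) (fun l => b l.succ) :=
  Fin.prod_univ_succ _

lemma sum_piTensor_update_one_succ (M : (l : Fin (N + 1)) → Matrix (Fin (D l)) (Fin (D l)) ℂ)
    (a b : (l : Fin (N + 1)) → Fin (D l)) :
    (∑ l, piTensor (Function.update (fun _ => 1) l (M l))) a b =
      M 0 (a 0) (b 0) * (1 : Matrix ((l : Fin N) → Fin (D l.succ)) _ ℂ)
        (fun l : Fin N => a l.succ) (fun l : Fin N => b l.succ) +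
      (1 : Matrix (Fin (D 0)) (Fin (D 0)) ℂ) (a 0) (b 0) *
        (∑ l : Fin N, piTensor (D := fun l : Fin N => D l.succ)
          (Function.update (fun _ => 1) l (M l.succ))) (fun l => a l.succ) (fun l => b l.succ) := by
  rw [Fin.sum_univ_succ, Matrix.add_apply, Matrix.sum_apply, Matrix.sum_apply, Finset.mul_sum]
  congr 1
  · rw [piTensor_succ, Function.update_self, ← piTensor_one]
    congr 2
  · refine Finset.sum_congr rfl fun l _ => ?_
    rw [piTensor_succ, Function.update_of_ne (Fin.succ_ne_zero l).symm]
    congr 2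
    funext k
    rcases eq_or_ne k l with rfl | hk
    · rw [Function.update_self, Function.update_self]
    · rw [Function.update_of_ne hk, Function.update_of_ne fun h => hk (Fin.succ_injective _ h)]

end Tensor

namespace Environment

variable {ι : Type*} {m : ℕ} [NeZero m] (E : Environment ι)

/-- The environment with an additional system of dimension `m`. -/
def cons (q : ι → Matrix (Fin m) (Fin m) ℂ) (hq : ∀ j, (q j).IsHermitian)
    (hc : ∀ i j, Commute (q i) (q j)) : Environment ι where
  N := E.N + 1
  dim := Fin.cons m E.dim
  dim_pos := Fin.cases (NeZero.pos m) E.dim_pos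
  Q := Fin.cases (motive := fun l => ι → Matrix (Fin ((Fin.cons m E.dim : Fin (E.N + 1) → ℕ) l))
    (Fin ((Fin.cons m E.dim : Fin (E.N + 1) → ℕ) l)) ℂ) q E.Q
  hermitian := Fin.cases hq E.hermitian
  commute := Fin.cases hc E.commute

variable {E} {q : ι → Matrix (Fin m) (Fin m) ℂ} {hq : ∀ j, (q j).IsHermitian}
  {hc : ∀ i j, Commute (q i) (q j)}

/-- The matrix of the additional system in a family for the enlarged environment. -/
def head (σ : (E.cons q hq hc).Family) : Matrix (Fin m) (Fin m) ℂ := σ (0 : Fin (E.N + 1))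

/-- The matrices of the old systems in a family for the enlarged environment. -/
def tail (σ : (E.cons q hq hc).Family) : E.Family := fun l => σ (Fin.succ l)

/-- The basis of the enlarged environment, in terms of those of the additional system and of the
old environment. -/
def consIdx : Fin m × E.Idx ≃ (E.cons q hq hc).Idx :=
  Fin.consEquiv fun l => Fin ((E.cons q hq hc).dim l)

lemma piTensor_consIdx (A : (E.cons q hq hc).Family) (a b : Fin m) (x y : E.Idx) :
    piTensor A (consIdx (a, x)) (consIdx (b, y)) = head A a b * piTensor (tail A) x y :=
  piTensor_succ (D := (E.cons q hq hc).dim) A (consIdx (a, x)) (consIdx (b, y))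

lemma charge_consIdx (j : ι) (a b : Fin m) (x y : E.Idx) :
    (E.cons q hq hc).charge j (consIdx (a, x)) (consIdx (b, y)) =
      q j a b * (1 : Matrix E.Idx E.Idx ℂ) x y +
        (1 : Matrix (Fin m) (Fin m) ℂ) a b * E.charge j x y :=
  sum_piTensor_update_one_succ (D := (E.cons q hq hc).dim) (fun l => (E.cons q hq hc).Q l j)
    (consIdx (a, x)) (consIdx (b, y))

lemma head_mem_microstates [Fintype ι] {β : ι → ℝ} {σ : (E.cons q hq hc).Family}
    (hσ : σ ∈ (E.cons q hq hc).thermalMicrostates β) :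
    head σ ∈ microstates q fun j => expect (gibbs β q) (q j) :=
  hσ (0 : Fin (E.N + 1))

lemma tail_mem_thermalMicrostates [Fintype ι] {β : ι → ℝ} {σ : (E.cons q hq hc).Family}
    (hσ : σ ∈ (E.cons q hq hc).thermalMicrostates β) : tail σ ∈ E.thermalMicrostates β :=
  fun l => hσ (Fin.succ l)

variable {d : Type*}

/-- The basis of the system with the enlarged environment, where the additional system is grouped
with the system. -/
def compIdx : d × (E.cons q hq hc).Idx ≃ (d × Fin m) × E.Idx :=
  ((Equiv.prodAssoc d (Fin m) E.Idx).trans (Equiv.prodCongr (Equiv.refl d) consIdx)).symm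

lemma compIdx_consIdx (a : d) (x : Fin m) (k : E.Idx) :
    compIdx (a, consIdx (q := q) (hq := hq) (hc := hc) (x, k)) = ((a, x), k) := by
  simp [compIdx]

lemma initial_cons (ρ : Matrix d d ℂ) (σ : (E.cons q hq hc).Family) :
    (E.cons q hq hc).initial ρ σ =
      ((E.initial ρ (tail σ) ⊗ₖ head σ).submatrix (swapRight d E.Idx (Fin m))
        (swapRight d E.Idx (Fin m))).submatrix compIdx compIdx := by
  ext ⟨a, k⟩ ⟨b, k'⟩
  obtain ⟨⟨x, i⟩, rfl⟩ := consIdx.surjective k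
  obtain ⟨⟨y, i'⟩, rfl⟩ := consIdx.surjective k'
  simp only [initial, kroneckerMap_apply, piTensor_consIdx, submatrix_apply, compIdx_consIdx,
    swapRight, Equiv.coe_fn_mk]
  ring

lemma one_kronecker_charge_cons [DecidableEq d] (j : ι) :
    (1 : Matrix d d ℂ) ⊗ₖ (E.cons q hq hc).charge j =
      (((1 : Matrix d d ℂ) ⊗ₖ q j) ⊗ₖ (1 : Matrix E.Idx E.Idx ℂ) +
        (1 : Matrix (d × Fin m) (d × Fin m) ℂ) ⊗ₖ E.charge j).submatrix compIdx compIdx := by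
  ext ⟨a, k⟩ ⟨b, k'⟩
  obtain ⟨⟨x, i⟩, rfl⟩ := consIdx.surjective k
  obtain ⟨⟨y, i'⟩, rfl⟩ := consIdx.surjective k'
  rw [← one_kronecker_one]
  simp only [kroneckerMap_apply, charge_consIdx, submatrix_apply, compIdx_consIdx,
    Matrix.add_apply]
  ring

lemma partialTrace_submatrix_compIdx (M : Matrix ((d × Fin m) × E.Idx) ((d × Fin m) × E.Idx) ℂ) :
    partialTrace (M.submatrix (compIdx (q := q) (hq := hq) (hc := hc)) compIdx) =
      partialTrace (partialTrace M) := by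
  ext a b
  simp only [partialTrace, of_apply, submatrix_apply]
  rw [← Equiv.sum_comp (consIdx (q := q) (hq := hq) (hc := hc)), Fintype.sum_prod_type]
  simp only [compIdx_consIdx]

variable [Fintype d] [DecidableEq d]

variable (E q hq hc) in
/-- The unitary `U` on the system and the old environment, followed by the unitary `V` on the system
and the additional system. -/
def consGate (U : unitaryGroup (d × E.Idx) ℂ) (V : unitaryGroup (d × Fin m) ℂ) :
    unitaryGroup (d × (E.cons q hq hc).Idx) ℂ :=
  submatrixUnitary compIdx (kroneckerUnitary V 1 *
    submatrixUnitary (swapRight d E.Idx (Fin m)) (kroneckerUnitary U 1))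

lemma final_cons (U : unitaryGroup (d × E.Idx) ℂ) (V : unitaryGroup (d × Fin m) ℂ)
    (ρ : Matrix d d ℂ) (σ : (E.cons q hq hc).Family) :
    (E.cons q hq hc).final (consGate E q hq hc U V) ρ σ =
      (evolve (kroneckerUnitary V 1) ((E.final U ρ (tail σ) ⊗ₖ head σ).submatrix
        (swapRight d E.Idx (Fin m)) (swapRight d E.Idx (Fin m)))).submatrix compIdx compIdx := by
  rw [final_eq_evolve, final_eq_evolve, initial_cons, consGate, evolve_submatrix, evolve_mul,
    evolve_submatrix, evolve_kronecker, evolve_one]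

lemma partialTrace_final_cons (U : unitaryGroup (d × E.Idx) ℂ) (V : unitaryGroup (d × Fin m) ℂ)
    (ρ : Matrix d d ℂ) (σ : (E.cons q hq hc).Family) :
    partialTrace ((E.cons q hq hc).final (consGate E q hq hc U V) ρ σ) =
      partialTrace (evolve V (partialTrace (E.final U ρ (tail σ)) ⊗ₖ head σ)) := by
  rw [final_cons, partialTrace_submatrix_compIdx, partialTrace_evolve_kroneckerUnitary_one,
    partialTrace_submatrix_swapRight]

lemma envIncrease_cons (U : unitaryGroup (d × E.Idx) ℂ) (V : unitaryGroup (d × Fin m) ℂ)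
    {ρ : Matrix d d ℂ} (hρ : IsDensity ρ) {σ : (E.cons q hq hc).Family}
    (htail : ∀ l, IsDensity (tail σ l)) (hhead : IsDensity (head σ)) (j : ι) :
    (E.cons q hq hc).envIncrease (consGate E q hq hc U V) ρ σ j =
      E.envIncrease U ρ (tail σ) j +
        (expect (evolve V (partialTrace (E.final U ρ (tail σ)) ⊗ₖ head σ))
          ((1 : Matrix d d ℂ) ⊗ₖ q j) - expect (head σ) (q j)) := by
  rw [envIncrease, envIncrease, final_cons, initial_cons, one_kronecker_charge_cons,
    expect_submatrix, expect_submatrix, expect_add_right, expect_add_right, expect_kronecker_one,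
    expect_kronecker_one, partialTrace_evolve_kroneckerUnitary_one,
    partialTrace_submatrix_swapRight, partialTrace_submatrix_swapRight,
    E.partialTrace_initial ρ htail, expect_kronecker_one_kronecker hρ.2,
    expect_evolve_kroneckerUnitary_one, expect_submatrix_swapRight _ hhead.2,
    expect_submatrix_swapRight _ hhead.2]
  ring

end Environment

/-! ### Realizable processes -/

section Realizable

variable {ι d : Type*} [Fintype ι] [Fintype d] [DecidableEq d] {β : ι → ℝ}
  {C C' : Matrix d d ℂ → Matrix d d ℂ → (ι → ℝ) → Prop}

/-- Some unitary with some environment at the inverse temperatures `β` takes each initial state `ρ`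
of the system, for all microstates of the environment, to a final state `ρ'` with increases `c` of
the observables of the environment such that `C ρ ρ' c`. -/
def Realizable (β : ι → ℝ) (C : Matrix d d ℂ → Matrix d d ℂ → (ι → ℝ) → Prop) : Prop :=
  ∃ (E : Environment ι) (U : unitaryGroup (d × E.Idx) ℂ),
    ∀ ρ, IsDensity ρ → ∀ σ ∈ E.thermalMicrostates β,
      C ρ (partialTrace (E.final U ρ σ)) (E.envIncrease U ρ σ)

lemma Realizable.mono (h : Realizable β C)
    (hC : ∀ ρ ρ' c, IsDensity ρ → IsDensity ρ' → C ρ ρ' c → C' ρ ρ' c) : Realizable β C' := by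
  obtain ⟨E, U, h⟩ := h
  exact ⟨E, U, fun ρ hρ σ hσ => hC _ _ _ hρ
    (E.isDensity_final U hρ fun l => (hσ l).1).partialTrace (h ρ hρ σ hσ)⟩

lemma realizable_eq (β : ι → ℝ) : Realizable (d := d) β fun ρ ρ' c => ρ' = ρ ∧ c = 0 := by
  refine ⟨⟨0, Fin.elim0, fun l => l.elim0, fun l => l.elim0, fun l => l.elim0, fun l => l.elim0⟩,
    1, fun ρ _ σ hσ => ⟨?_, ?_⟩⟩
  · rw [Environment.final_eq_evolve, evolve_one, Environment.partialTrace_initial]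
    exact fun l => (hσ l).1
  · funext j
    rw [Environment.envIncrease, Environment.final_eq_evolve, evolve_one, sub_self, Pi.zero_apply]

lemma Realizable.gate (h : Realizable β C) {m : ℕ} [NeZero m] {q : ι → Matrix (Fin m) (Fin m) ℂ}
    (hq : ∀ j, (q j).IsHermitian) (hc : ∀ i j, Commute (q i) (q j))
    (V : unitaryGroup (d × Fin m) ℂ) :
    Realizable β fun ρ ρ' c => ∃ ρ₁ c₁, ∃ s ∈ microstates q fun j => expect (gibbs β q) (q j),
      IsDensity ρ₁ ∧ C ρ ρ₁ c₁ ∧ ρ' = partialTrace (evolve V (ρ₁ ⊗ₖ s)) ∧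
      ∀ j, c j = c₁ j + (expect (evolve V (ρ₁ ⊗ₖ s)) ((1 : Matrix d d ℂ) ⊗ₖ q j) -
        expect s (q j)) := by
  obtain ⟨E, U, h⟩ := h
  refine ⟨E.cons q hq hc, Environment.consGate E q hq hc U V, fun ρ hρ σ hσ => ?_⟩
  have htail := Environment.tail_mem_thermalMicrostates hσ
  have hhead := Environment.head_mem_microstates hσ
  exact ⟨_, _, _, hhead, (E.isDensity_final U hρ fun l => (htail l).1).partialTrace,
    h ρ hρ _ htail, Environment.partialTrace_final_cons U V ρ σ,
    Environment.envIncrease_cons U V hρ (fun l => (htail l).1) hhead.1⟩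

end Realizable

/-! ### Qubits as sources of known randomness -/

section Qubit

variable {ι : Type*}

/-- The observables of a qubit: the `j`-th one vanishes in the lower level and takes the value `h j`
in the upper level. -/
noncomputable def qubit (h : ι → ℝ) (j : ι) : Matrix (Fin 2) (Fin 2) ℂ := conjDiag 1 ![0, h j]

lemma isHermitian_qubit (h : ι → ℝ) (j : ι) : (qubit h j).IsHermitian :=
  isHermitian_conjDiag _ _

lemma commute_qubit (h : ι → ℝ) (i j : ι) : Commute (qubit h i) (qubit h j) :=
  (Commute.all ![0, h i] ![0, h j]).map (conjDiag 1)

lemma expect_qubit (h : ι → ℝ) (s : Matrix (Fin 2) (Fin 2) ℂ) (j : ι) :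
    expect s (qubit h j) = h j * (s 1 1).re := by
  rw [qubit, expect_conjDiag]
  simp [population, mul_comm]

lemma expect_one_kronecker_qubit {d : Type*} [Fintype d] [DecidableEq d] (h : ι → ℝ)
    (M : Matrix (d × Fin 2) (d × Fin 2) ℂ) (j : ι) :
    expect M ((1 : Matrix d d ℂ) ⊗ₖ qubit h j) = h j * ∑ a, (M (a, 1) (a, 1)).re := by
  rw [qubit, one_kronecker_conjDiag 1, expect_conjDiag, Fintype.sum_prod_type, Finset.mul_sum]
  simp [population, kroneckerUnitary, mul_comm]

variable [Fintype ι]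

lemma gibbs_qubit_apply (β h : ι → ℝ) :
    (gibbs β (qubit h) 1 1).re = Real.sigmoid (-∑ j, β j * h j) := by
  have hsum : ∑ j, (β j : ℂ) • qubit h j = conjDiag 1 ![0, ∑ j, β j * h j] := by
    ext a b
    fin_cases a <;> fin_cases b <;> simp [qubit, conjDiag_apply, Matrix.sum_apply]
  have hupper : (gibbs β (qubit h) 1 1).re = boltzmann ![0, ∑ j, β j * h j] 1 := by
    rw [gibbs_eq_conjDiag hsum]
    simp [conjDiag_apply]
  rw [hupper, ← Real.sigmoid_mul_rexp_neg, boltzmann, partition, Real.sigmoid_def]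
  simp [div_eq_inv_mul]

lemma diag_of_mem_microstates_qubit {β h : ι → ℝ} (hh : h ≠ 0) {s : Matrix (Fin 2) (Fin 2) ℂ}
    (hs : s ∈ microstates (qubit h) fun j => expect (gibbs β (qubit h)) (qubit h j)) :
    s 0 0 = ((1 - Real.sigmoid (-∑ j, β j * h j) : ℝ) : ℂ) ∧
      s 1 1 = (Real.sigmoid (-∑ j, β j * h j) : ℂ) := by
  obtain ⟨j, hj⟩ := Function.ne_iff.1 hh
  have hmean := hs.2 j
  simp only [expect_qubit, gibbs_qubit_apply] at hmean
  have hupper : s 1 1 = (Real.sigmoid (-∑ j, β j * h j) : ℂ) := by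
    rw [← mul_left_cancel₀ hj hmean]
    exact (hs.1.1.isHermitian.coe_re_apply_self 1).symm
  refine ⟨?_, hupper⟩
  have htr := hs.1.2
  rw [trace_fin_two, hupper] at htr
  push_cast
  exact eq_sub_of_add_eq htr

end Qubit

section Gates

variable {d : Type*} [Fintype d]

lemma IsDensity.sum_re_apply_self {ρ : Matrix d d ℂ} (hρ : IsDensity ρ) :
    ∑ a, (ρ a a).re = 1 := by
  rw [← Complex.re_sum]
  exact congrArg Complex.re hρ.2

variable [DecidableEq d]

/-- The unitary that permutes the vectors of the standard basis. -/
noncomputable def permUnitary (g : Equiv.Perm d) : unitaryGroup d ℂ :=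
  ⟨g.permMatrix ℂ, by
    rw [mem_unitaryGroup_iff, star_eq_conjTranspose, conjTranspose_permMatrix, ← permMatrix_mul,
      inv_mul_cancel, permMatrix_one]⟩

lemma evolve_permUnitary (g : Equiv.Perm d) (A : Matrix d d ℂ) :
    evolve (permUnitary g) A = A.submatrix g g := by
  simp only [evolve, permUnitary, conjTranspose_permMatrix, PEquiv.toMatrix_toPEquiv_mul,
    PEquiv.mul_toMatrix_toPEquiv]
  rfl

/-- The change of the sign of the level `k` of the system, controlled by a qubit. -/
def controlledSign (k : d) : unitaryGroup (d × Fin 2) ℂ :=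
  ⟨diagonal fun x => if x = (k, 1) then -1 else 1, by
    rw [mem_unitaryGroup_iff, star_eq_conjTranspose, diagonal_conjTranspose,
      diagonal_mul_diagonal, ← diagonal_one]
    congr 1
    funext x
    by_cases hx : x = (k, 1) <;> simp [hx]⟩

lemma evolve_controlledSign_apply (k : d) (X : Matrix (d × Fin 2) (d × Fin 2) ℂ)
    (x y : d × Fin 2) :
    evolve (controlledSign k) X x y = if x = (k, 1) ↔ y = (k, 1) then X x y else -X x y := by
  simp only [evolve, controlledSign, diagonal_conjTranspose, mul_diagonal, diagonal_mul]
  by_cases hx : x = (k, 1) <;> by_cases hy : y = (k, 1) <;> simp [hx, hy]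

end Gates

section Exchange

variable {d : Type*} [DecidableEq d]

/-- The populations after the exchange of the transition between the levels `i` and `k` with a
two-level system with the populations `1 - u` and `u`. -/
def mix (i k : d) (u : ℝ) (p : d → ℝ) (a : d) : ℝ :=
  if a = i then (p i + p k) * (1 - u) else if a = k then (p i + p k) * u else p a

/-- The exchange of the transition between the levels `i` and `k` of the system with the one of a
qubit. -/
def exchangePerm (i k : d) : Equiv.Perm (d × Fin 2) := Equiv.swap (i, 1) (k, 0)

lemma exchangePerm_apply_zero (i : d) {k a : d} (ha : a ≠ k) :
    exchangePerm i k (a, 0) = (a, 0) :=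
  Equiv.swap_apply_of_ne_of_ne (by simp) (by simp [ha])

lemma exchangePerm_apply_one {i a : d} (k : d) (ha : a ≠ i) :
    exchangePerm i k (a, 1) = (a, 1) :=
  Equiv.swap_apply_of_ne_of_ne (by simp [ha]) (by simp)

variable {ρ : Matrix d d ℂ} {s : Matrix (Fin 2) (Fin 2) ℂ} {u : ℝ} {i k : d}

lemma re_partialTrace_submatrix_exchangePerm (ρ : Matrix d d ℂ)
    (h0 : s 0 0 = ((1 - u : ℝ) : ℂ)) (h1 : s 1 1 = (u : ℂ)) (hik : i ≠ k) (a : d) :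
    (partialTrace ((ρ ⊗ₖ s).submatrix (exchangePerm i k) (exchangePerm i k)) a a).re =
      mix i k u (fun a => (ρ a a).re) a := by
  simp only [partialTrace, of_apply, Fin.sum_univ_two, submatrix_apply, mix]
  by_cases hi : a = i
  · subst hi
    rw [exchangePerm_apply_zero a hik, exchangePerm, Equiv.swap_apply_left, if_pos rfl]
    simp only [kroneckerMap_apply, h0, Complex.add_re, Complex.re_mul_ofReal]
    ring
  rw [exchangePerm_apply_one k hi, if_neg hi]
  by_cases hk : a = k
  · subst hk
    rw [exchangePerm, Equiv.swap_apply_right, if_pos rfl]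
    simp only [kroneckerMap_apply, h1, Complex.add_re, Complex.re_mul_ofReal]
    ring
  · rw [exchangePerm_apply_zero i hk, if_neg hk]
    simp only [kroneckerMap_apply, h0, h1, Complex.add_re, Complex.re_mul_ofReal]
    ring

variable [Fintype d]

lemma sum_re_submatrix_exchangePerm (hρ : IsDensity ρ)
    (h0 : s 0 0 = ((1 - u : ℝ) : ℂ)) (h1 : s 1 1 = (u : ℂ)) (i k : d) :
    ∑ a, ((ρ ⊗ₖ s).submatrix (exchangePerm i k) (exchangePerm i k) (a, 1) (a, 1)).re =
      (ρ k k).re * (1 - u) + (1 - (ρ i i).re) * u := by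
  rw [← Finset.add_sum_erase _ _ (Finset.mem_univ i)]
  congr 1
  · rw [submatrix_apply, exchangePerm, Equiv.swap_apply_left, kroneckerMap_apply, h0,
      Complex.re_mul_ofReal]
  · rw [← hρ.sum_re_apply_self, ← Finset.sum_erase_eq_sub (Finset.mem_univ i), Finset.sum_mul]
    refine Finset.sum_congr rfl fun a ha => ?_
    rw [submatrix_apply, exchangePerm_apply_one k (Finset.ne_of_mem_erase ha),
      kroneckerMap_apply, h1, Complex.re_mul_ofReal]

end Exchange

section QubitProcesses

variable {ι d : Type*} [Fintype ι] [Fintype d] [DecidableEq d] {β h : ι → ℝ}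
  {C : Matrix d d ℂ → Matrix d d ℂ → (ι → ℝ) → Prop}

lemma Realizable.qubitGate (hC : Realizable β C) (hh : h ≠ 0) {u : ℝ}
    (hu : Real.sigmoid (-∑ j, β j * h j) = u) (V : unitaryGroup (d × Fin 2) ℂ) :
    Realizable β fun ρ ρ' c => ∃ (ρ₁ : Matrix d d ℂ) (c₁ : ι → ℝ) (s : Matrix (Fin 2) (Fin 2) ℂ),
      IsDensity ρ₁ ∧ C ρ ρ₁ c₁ ∧ s 0 0 = ((1 - u : ℝ) : ℂ) ∧ s 1 1 = (u : ℂ) ∧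
      ρ' = partialTrace (evolve V (ρ₁ ⊗ₖ s)) ∧
      ∀ j, c j = c₁ j + h j * (∑ a, (evolve V (ρ₁ ⊗ₖ s) (a, 1) (a, 1)).re - u) := by
  refine (hC.gate (isHermitian_qubit h) (commute_qubit h) V).mono ?_
  rintro ρ ρ' c - - ⟨ρ₁, c₁, s, hs, hρ₁, hC, hρ', hc⟩
  obtain ⟨h0, h1⟩ := diag_of_mem_microstates_qubit hh hs
  rw [hu] at h0 h1
  refine ⟨ρ₁, c₁, s, hρ₁, hC, h0, h1, hρ', fun j => ?_⟩
  rw [hc j, expect_one_kronecker_qubit, expect_qubit, h1, Complex.ofReal_re]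
  ring

lemma Realizable.unitary [Nonempty ι] (hC : Realizable β C) (V : unitaryGroup d ℂ) :
    Realizable β fun ρ ρ' c => ∃ ρ₁, C ρ ρ₁ c ∧ ρ' = MacroThermo.evolve V ρ₁ := by
  refine (hC.qubitGate (one_ne_zero' (ι → ℝ)) rfl (kroneckerUnitary V 1)).mono ?_
  rintro ρ ρ' c - - ⟨ρ₁, c₁, s, hρ₁, hC, h0, h1, hρ', hc⟩
  rw [evolve_kronecker, evolve_one] at hρ' hc
  have htr : s.trace = 1 := by rw [trace_fin_two, h0, h1]; push_cast; ring
  have hcc : c = c₁ := by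
    funext j
    rw [hc j]
    simp only [kroneckerMap_apply, h1, Complex.re_mul_ofReal, ← Finset.sum_mul]
    rw [(hρ₁.evolve V).sum_re_apply_self]
    ring
  rw [partialTrace_kronecker, htr, one_smul] at hρ'
  exact ⟨ρ₁, hcc ▸ hC, hρ'⟩

lemma Realizable.invert (hC : Realizable β C) (hh : h ≠ 0) :
    Realizable β fun ρ ρ' c => ∃ c₁, C ρ ρ' c₁ ∧
      ∀ j, c j = c₁ j + h j * (1 - 2 * Real.sigmoid (-∑ j, β j * h j)) := by
  refine (hC.qubitGate hh rfl
    (permUnitary (Equiv.prodCongr (Equiv.refl d) (Equiv.swap (0 : Fin 2) 1)))).mono ?_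
  rintro ρ ρ' c - - ⟨ρ₁, c₁, s, hρ₁, hC, h0, h1, hρ', hc⟩
  rw [evolve_permUnitary] at hρ' hc
  have hρρ : ρ' = ρ₁ := by
    rw [hρ']
    ext a b
    simp only [MacroThermo.partialTrace, of_apply, Fin.sum_univ_two, submatrix_apply,
      Equiv.prodCongr_apply, Prod.map, Equiv.refl_apply, Equiv.swap_apply_left,
      Equiv.swap_apply_right, kroneckerMap_apply, h0, h1]
    push_cast
    ring
  refine ⟨c₁, hρρ ▸ hC, fun j => ?_⟩
  rw [hc j]
  simp only [submatrix_apply, Equiv.prodCongr_apply, Prod.map, Equiv.refl_apply,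
    Equiv.swap_apply_right, kroneckerMap_apply, h0, Complex.re_mul_ofReal,
    ← Finset.sum_mul, hρ₁.sum_re_apply_self]
  ring

lemma Realizable.signFlip (hC : Realizable β C) (hh : h ≠ 0) (k : d) :
    Realizable β fun ρ ρ' c => ∃ ρ₁, C ρ ρ₁ c ∧
      ∀ a b, ρ' a b = if a = k ↔ b = k then ρ₁ a b else
        ((1 - 2 * Real.sigmoid (-∑ j, β j * h j) : ℝ) : ℂ) * ρ₁ a b := by
  refine (hC.qubitGate hh rfl (controlledSign k)).mono ?_
  rintro ρ ρ' c - - ⟨ρ₁, c₁, s, hρ₁, hC, h0, h1, hρ', hc⟩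
  have hcc : c = c₁ := by
    funext j
    rw [hc j]
    simp only [evolve_controlledSign_apply, iff_self, if_true, kroneckerMap_apply, h1,
      Complex.re_mul_ofReal, ← Finset.sum_mul, hρ₁.sum_re_apply_self]
    ring
  refine ⟨ρ₁, hcc ▸ hC, fun a b => ?_⟩
  rw [hρ']
  simp only [MacroThermo.partialTrace, of_apply, Fin.sum_univ_two, evolve_controlledSign_apply,
    kroneckerMap_apply, h0, h1, Prod.mk.injEq, zero_ne_one, and_false, and_true, if_true]
  split_ifs
  · push_cast
    ring
  · push_cast
    ring

lemma Realizable.dephase (hC : Realizable β C) (hh : h ≠ 0) {δ : ℝ}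
    (hδ : |1 - 2 * Real.sigmoid (-∑ j, β j * h j)| ≤ δ) (hδ1 : δ ≤ 1) (S : Finset d) :
    Realizable β fun ρ ρ' c => ∃ ρ₁, IsDensity ρ₁ ∧ C ρ ρ₁ c ∧ (∀ a, ρ' a a = ρ₁ a a) ∧
      (∀ a b, ‖ρ' a b‖ ≤ ‖ρ₁ a b‖) ∧ ∀ a ∈ S, ∀ b, a ≠ b → ‖ρ' a b‖ ≤ δ * ‖ρ₁ a b‖ := by
  induction S using Finset.induction with
  | empty =>
    exact hC.mono fun ρ ρ' c _ hρ' h => ⟨ρ', hρ', h, fun _ => rfl, fun _ _ => le_rfl, by simp⟩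
  | insert k S hk ih =>
    refine (ih.signFlip hh k).mono ?_
    rintro ρ ρ' c - - ⟨ρ₂, ⟨ρ₁, hρ₁, hC, hdiag, hle, hS⟩, hflip⟩
    have hle₂ : ∀ a b, ‖ρ' a b‖ ≤ ‖ρ₂ a b‖ := by
      intro a b
      rw [hflip]
      split_ifs
      · exact le_rfl
      · rw [norm_mul, Complex.norm_real, Real.norm_eq_abs]
        exact mul_le_of_le_one_left (norm_nonneg _) (hδ.trans hδ1)
    refine ⟨ρ₁, hρ₁, hC, fun a => ?_, fun a b => (hle₂ a b).trans (hle a b),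
      fun a ha b hab => ?_⟩
    · rw [hflip, if_pos Iff.rfl, hdiag]
    rcases Finset.mem_insert.1 ha with rfl | ha
    · rw [hflip, if_neg (by simpa using hab.symm), norm_mul, Complex.norm_real, Real.norm_eq_abs]
      exact mul_le_mul hδ (hle _ _) (norm_nonneg _) ((abs_nonneg _).trans hδ)
    · exact (hle₂ a b).trans (hS a ha b hab)

lemma Realizable.exchange (hC : Realizable β C) (hh : h ≠ 0) {u : ℝ}
    (hu : Real.sigmoid (-∑ j, β j * h j) = u) {i k : d} (hik : i ≠ k) :
    Realizable β fun ρ ρ' c => ∃ ρ₁ c₁, C ρ ρ₁ c₁ ∧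
      (∀ a, (ρ' a a).re = mix i k u (fun a => (ρ₁ a a).re) a) ∧
      ∀ j, c j = c₁ j + h j * ((ρ₁ k k).re * (1 - u) - (ρ₁ i i).re * u) := by
  refine (hC.qubitGate hh hu (permUnitary (exchangePerm i k))).mono ?_
  rintro ρ ρ' c - - ⟨ρ₁, c₁, s, hρ₁, hC, h0, h1, hρ', hc⟩
  rw [evolve_permUnitary] at hρ' hc
  refine ⟨ρ₁, c₁, hC, fun a => ?_, fun j => ?_⟩
  · rw [hρ', re_partialTrace_submatrix_exchangePerm ρ₁ h0 h1 hik]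
  · rw [hc j, sum_re_submatrix_exchangePerm hρ₁ h0 h1]
    ring

end QubitProcesses

/-! ### Quasi-static processes -/

section ThermalGap

/-- The gap, in units of the temperature, of a qubit whose upper level has the thermal population
`u`. This is also the derivative of the binary entropy at `u`. -/
noncomputable def thermalGap (u : ℝ) : ℝ := Real.log (1 - u) - Real.log u

lemma sigmoid_neg_thermalGap {u : ℝ} (hu : u ∈ Set.Ioo 0 1) : Real.sigmoid (-thermalGap u) = u := by
  have hu₀ := hu.1.ne'
  rw [Real.sigmoid_def, neg_neg, thermalGap, Real.exp_sub, Real.exp_log (sub_pos.2 hu.2),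
    Real.exp_log hu.1]
  field_simp
  ring

lemma continuousAt_thermalGap {u : ℝ} (hu : u ∈ Set.Ioo 0 1) : ContinuousAt thermalGap u := by
  have hu₀ := hu.1.ne'
  have hu₁ := (sub_pos.2 hu.2).ne'
  unfold thermalGap
  fun_prop (disch := assumption)

lemma thermalGap_lt_thermalGap {u v : ℝ} (hu : 0 < u) (huv : u < v) (hv : v < 1) :
    thermalGap v < thermalGap u :=
  sub_lt_sub (Real.log_lt_log (by linarith) (by linarith)) (Real.log_lt_log hu huv)

lemma binEntropy_sub_le {x y : ℝ} (hx : x ∈ Set.Ioo 0 1) (hy : y ∈ Set.Ioo 0 1) :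
    Real.binEntropy x - Real.binEntropy y ≤ thermalGap y * (x - y) := by
  have hgibbs := sum_negMulLog_le_sum_mul_neg_log (p := ![x, 1 - x]) (q := ![y, 1 - y])
    (by simp [Pi.le_def, Fin.forall_fin_two, hx.1.le, hx.2.le])
    (by simp [Pi.le_def, Fin.forall_fin_two, hy.1.le, hy.2.le]) (by simp)
    (by simp [Fin.forall_fin_two, hy.1.ne', (sub_pos.2 hy.2).ne'])
  simp only [Fin.sum_univ_two, cons_val_zero, cons_val_one] at hgibbs
  rw [← Real.binEntropy_eq_negMulLog_add_negMulLog_one_sub] at hgibbs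
  rw [Real.binEntropy_eq_negMulLog_add_negMulLog_one_sub y, thermalGap, Real.negMulLog,
    Real.negMulLog]
  linarith

lemma binEntropy_sub_le_sum_thermalGap_mul {x : ℕ → ℝ} {n : ℕ}
    (hx : ∀ m ≤ n, x m ∈ Set.Ioo 0 1) :
    Real.binEntropy (x 0) - Real.binEntropy (x n) ≤
      ∑ m ∈ Finset.range n, thermalGap (x (m + 1)) * (x m - x (m + 1)) := by
  rw [← Finset.sum_range_sub' fun m => Real.binEntropy (x m)]
  refine Finset.sum_le_sum fun m hm => ?_
  have hm := Finset.mem_range.1 hm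
  exact binEntropy_sub_le (hx m hm.le) (hx (m + 1) hm)

lemma sum_thermalGap_mul_le {x : ℕ → ℝ} {n : ℕ} (hx : ∀ m ≤ n, x m ∈ Set.Ioo 0 1) {Δ : ℝ}
    (hΔ : ∀ m, x m - x (m + 1) = Δ) :
    ∑ m ∈ Finset.range n, thermalGap (x (m + 1)) * (x m - x (m + 1)) ≤
      Real.binEntropy (x 0) - Real.binEntropy (x n) +
        (thermalGap (x n) - thermalGap (x 0)) * Δ := by
  rw [← Finset.sum_range_sub' fun m => Real.binEntropy (x m),
    ← Finset.sum_range_sub fun m => thermalGap (x m), Finset.sum_mul, ← Finset.sum_add_distrib]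
  refine Finset.sum_le_sum fun m hm => ?_
  have hm := Finset.mem_range.1 hm
  have htangent := binEntropy_sub_le (hx (m + 1) hm) (hx m hm.le)
  rw [← neg_sub (x m), hΔ] at htangent
  rw [hΔ]
  linarith

lemma sum_thermalGap_mul_lineMap_mem_Icc {u y : ℝ} (hu : u ∈ Set.Ioo 0 1) (hy : y ∈ Set.Ioo 0 1)
    {x : ℕ → ℝ} {n : ℕ} (hn : 0 < n) (hx : ∀ m, x m = AffineMap.lineMap u y ((m : ℝ) / n)) :
    ∑ m ∈ Finset.range n, thermalGap (x (m + 1)) * (x m - x (m + 1)) ∈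
      Set.Icc (Real.binEntropy u - Real.binEntropy y) (Real.binEntropy u - Real.binEntropy y +
        (thermalGap y - thermalGap u) * (u - y) / n) := by
  have hstart : x 0 = u := by simp [hx]
  have hend : x n = y := by
    rw [hx, div_self (Nat.cast_ne_zero.2 hn.ne'), AffineMap.lineMap_apply_one]
  have hmem : ∀ m ≤ n, x m ∈ Set.Ioo 0 1 := fun m hm => hx m ▸ (convex_Ioo 0 1).lineMap_mem hu hy
    ⟨by positivity, div_le_one_of_le₀ (Nat.cast_le.2 hm) n.cast_nonneg⟩
  have hstep : ∀ m, x m - x (m + 1) = (u - y) / n := fun m => by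
    simp only [hx, AffineMap.lineMap_apply_ring']
    push_cast
    ring
  have hlower := binEntropy_sub_le_sum_thermalGap_mul hmem
  have hupper := sum_thermalGap_mul_le hmem hstep
  rw [hstart, hend] at hlower hupper
  exact ⟨hlower, by rwa [mul_div_assoc]⟩

lemma mul_binEntropy_div {R r : ℝ} (h : R = 0 → r = 0) :
    R * Real.binEntropy (r / R) =
      Real.negMulLog r + Real.negMulLog (R - r) - Real.negMulLog R := by
  rcases eq_or_ne R 0 with hR | hR
  · simp [hR, h hR]
  have hr : Real.negMulLog r = Real.negMulLog (R * (r / R)) := by rw [mul_div_cancel₀ _ hR]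
  have hRr : Real.negMulLog (R - r) = Real.negMulLog (R * (1 - r / R)) := by
    rw [mul_sub, mul_one, mul_div_cancel₀ _ hR]
  rw [hr, hRr, Real.negMulLog_mul, Real.negMulLog_mul,
    Real.binEntropy_eq_negMulLog_add_negMulLog_one_sub]
  ring

end ThermalGap

section Mix

variable {d : Type*} {i k : d} {u : ℝ} {p : d → ℝ}

lemma add_le_two_of_mem_stdSimplex [Fintype d] (hp : p ∈ stdSimplex ℝ d) (i k : d) :
    p i + p k ≤ 2 := by
  linarith [(mem_Icc_of_mem_stdSimplex hp i).2, (mem_Icc_of_mem_stdSimplex hp k).2]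

variable [DecidableEq d]

lemma mix_mix (hik : i ≠ k) (u v : ℝ) (p : d → ℝ) :
    mix i k v (mix i k u p) = mix i k v p := by
  funext a
  simp only [mix, if_neg hik.symm, if_true]
  split_ifs <;> ring

lemma abs_mix_sub_le (hu : u ∈ Set.Icc 0 1) {p' : d → ℝ} {ε : ℝ} (h : ∀ a, |p a - p' a| ≤ ε)
    (a : d) : |mix i k u p a - mix i k u p' a| ≤ 2 * ε := by
  have hε : 0 ≤ ε := (abs_nonneg _).trans (h a)
  have hpair : |p i + p k - (p' i + p' k)| ≤ 2 * ε := by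
    rw [add_sub_add_comm, two_mul]
    exact (abs_add_le _ _).trans (add_le_add (h i) (h k))
  simp only [mix]
  split_ifs
  · rw [← sub_mul, abs_mul, abs_of_nonneg (sub_nonneg.2 hu.2)]
    exact (mul_le_of_le_one_right (abs_nonneg _) (sub_le_self _ hu.1)).trans hpair
  · rw [← sub_mul, abs_mul, abs_of_nonneg hu.1]
    exact (mul_le_of_le_one_right (abs_nonneg _) hu.2).trans hpair
  · exact (h a).trans (by linarith)

variable [Fintype d]

lemma mix_mem_stdSimplex (hik : i ≠ k) (hu : u ∈ Set.Icc 0 1) (hp : p ∈ stdSimplex ℝ d) :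
    mix i k u p ∈ stdSimplex ℝ d := by
  have hpair : 0 ≤ p i + p k := add_nonneg (hp.1 i) (hp.1 k)
  refine ⟨fun a => ?_, ?_⟩
  · rw [mix]
    split_ifs
    · exact mul_nonneg hpair (sub_nonneg.2 hu.2)
    · exact mul_nonneg hpair hu.1
    · exact hp.1 a
  · have hmix : mix i k u p = p + Pi.single i ((p i + p k) * (1 - u) - p i) +
        Pi.single k ((p i + p k) * u - p k) := by
      funext a
      by_cases hai : a = i
      · subst hai
        simp [mix, hik]
      · by_cases hak : a = k
        · subst hak
          simp [mix, hai]
        · simp [mix, hai, hak]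
    simp only [hmix, Pi.add_apply, Finset.sum_add_distrib, hp.2, Finset.sum_pi_single',
      Finset.mem_univ, if_true]
    ring

lemma abs_mix_sub_mix_le (hp : p ∈ stdSimplex ℝ d) (i k : d) (u v : ℝ) (a : d) :
    |mix i k u p a - mix i k v p a| ≤ 2 * |u - v| := by
  have hpair : |p i + p k| ≤ 2 := by
    rw [abs_of_nonneg (add_nonneg (hp.1 i) (hp.1 k))]
    exact add_le_two_of_mem_stdSimplex hp i k
  simp only [mix]
  split_ifs
  · rw [← mul_sub, abs_mul, sub_sub_sub_cancel_left, abs_sub_comm v]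
    exact mul_le_mul_of_nonneg_right hpair (abs_nonneg _)
  · rw [← mul_sub, abs_mul]
    exact mul_le_mul_of_nonneg_right hpair (abs_nonneg _)
  · simp

end Mix

section Drives

variable {ι d : Type*} [Fintype ι] [Fintype d] [DecidableEq d]

/-- Up to arbitrarily small errors, some unitary with some environment turns the populations `p` in
the basis `W` into the populations `f p` in the standard basis, while it increases the observables
of the environment by `c p` along `t`. -/
structure Drives (β t : ι → ℝ) (W : unitaryGroup d ℂ) (f : (d → ℝ) → d → ℝ)
    (c : (d → ℝ) → ℝ) : Prop where
  mapsTo : Set.MapsTo f (stdSimplex ℝ d) (stdSimplex ℝ d)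
  realizable : ∀ ε > 0, Realizable β fun ρ ρ' e => ∃ C : ℝ, (∀ j, e j = t j * C) ∧
    |C - c (population W ρ)| ≤ ε ∧ ∀ i, |(ρ' i i).re - f (population W ρ) i| ≤ ε

namespace Drives

variable {β t : ι → ℝ} {W : unitaryGroup d ℂ} {f f' : (d → ℝ) → d → ℝ} {c c' : (d → ℝ) → ℝ}

protected lemma id [Nonempty ι] : Drives β t W (fun p => p) fun _ => 0 where
  mapsTo _ hp := hp
  realizable ε hε := by
    refine ((realizable_eq β).unitary W⁻¹).mono ?_
    rintro ρ ρ' e - - ⟨ρ₁, ⟨rfl, rfl⟩, rfl⟩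
    exact ⟨0, by simp, by simpa using hε.le, fun i => by
      simpa [population, evolve, star_eq_conjTranspose] using hε.le⟩

lemma of_tendsto {α : Type*} {l : Filter α} [l.NeBot] {F : α → (d → ℝ) → d → ℝ}
    {C : α → (d → ℝ) → ℝ} {g : α → ℝ} (h : ∀ᶠ x in l, Drives β t W (F x) (C x))
    (hg : Tendsto g l (𝓝 0))
    (hF : ∀ᶠ x in l, ∀ p ∈ stdSimplex ℝ d, ∀ i, |F x p i - f p i| ≤ g x)
    (hC : ∀ᶠ x in l, ∀ p ∈ stdSimplex ℝ d, |C x p - c p| ≤ g x) : Drives β t W f c where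
  mapsTo p hp := by
    refine (isClosed_stdSimplex ℝ d).mem_of_tendsto (f := fun x => F x p) (b := l)
      (tendsto_pi_nhds.2 fun i => ?_) (h.mono fun x hx => hx.mapsTo hp)
    exact tendsto_iff_norm_sub_tendsto_zero.2 (squeeze_zero' (Eventually.of_forall fun _ =>
      norm_nonneg _) (hF.mono fun x hx => hx p hp i) hg)
  realizable ε hε := by
    obtain ⟨x, hx, hgx, hFx, hCx⟩ :=
      (h.and ((hg.eventually_le_const (half_pos hε)).and (hF.and hC))).exists
    refine (hx.realizable (ε / 2) (half_pos hε)).mono ?_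
    rintro ρ ρ' e hρ - ⟨K, he, hK, hρ'⟩
    have hpop := hρ.population_mem_stdSimplex W
    exact ⟨K, he, (abs_sub_le _ _ _).trans (by linarith [hCx _ hpop]),
      fun i => (abs_sub_le _ _ _).trans (by linarith [hρ' i, hFx _ hpop i])⟩

lemma congr (h : Drives β t W f c) (hf : ∀ p ∈ stdSimplex ℝ d, f p = f' p)
    (hc : ∀ p ∈ stdSimplex ℝ d, c p = c' p) : Drives β t W f' c' :=
  of_tendsto (l := pure ()) (g := 0) (Eventually.of_forall fun _ => h) (tendsto_const_nhds)
    (Eventually.of_forall fun _ p hp i => by simp [hf p hp])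
    (Eventually.of_forall fun _ p hp => by simp [hc p hp])

variable {i k : d} {u y : ℝ}

lemma exchange_of_ne (h : Drives β t W f c) (ht : ∑ j, β j * t j = 1) (hik : i ≠ k)
    (hu : u ∈ Set.Ioo 0 1) (hgap : thermalGap u ≠ 0) :
    Drives β t W (fun p => mix i k u (f p))
      fun p => c p + thermalGap u * (f p k * (1 - u) - f p i * u) where
  mapsTo p hp := mix_mem_stdSimplex hik (Set.Ioo_subset_Icc_self hu) (h.mapsTo hp)
  realizable ε hε := by
    have hsum : ∑ j, β j * (thermalGap u • t) j = thermalGap u := by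
      simp only [Pi.smul_apply, smul_eq_mul, mul_left_comm _ (thermalGap u),
        ← Finset.mul_sum, ht, mul_one]
    have hne : thermalGap u • t ≠ 0 := by
      refine smul_ne_zero hgap ?_
      rintro rfl
      simp at ht
    have hL : 0 < 2 + |thermalGap u| := by positivity
    obtain ⟨δ, hδ, hδε⟩ : ∃ δ > 0, (2 + |thermalGap u|) * δ = ε :=
      ⟨ε / (2 + |thermalGap u|), div_pos hε hL, mul_div_cancel₀ _ hL.ne'⟩
    refine ((h.realizable δ hδ).exchange hne (hsum.symm ▸ sigmoid_neg_thermalGap hu) hik).mono ?_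
    rintro ρ ρ' e - - ⟨ρ₁, c₁, ⟨K, hc₁, hK, hρ₁⟩, hρ', he⟩
    refine ⟨K + thermalGap u * ((ρ₁ k k).re * (1 - u) - (ρ₁ i i).re * u), fun j => ?_, ?_,
      fun a => ?_⟩
    · rw [he j, hc₁ j, Pi.smul_apply, smul_eq_mul]
      ring
    · set p := f (population W ρ)
      have hflow : |((ρ₁ k k).re - p k) * (1 - u) - ((ρ₁ i i).re - p i) * u| ≤ δ := by
        refine (abs_sub _ _).trans ?_
        rw [abs_mul, abs_mul, abs_of_pos hu.1, abs_of_pos (sub_pos.2 hu.2)]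
        nlinarith [hρ₁ k, hρ₁ i, hu.1, hu.2]
      calc _ = |(K - c (population W ρ)) + thermalGap u *
            (((ρ₁ k k).re - p k) * (1 - u) - ((ρ₁ i i).re - p i) * u)| := by ring_nf
        _ ≤ δ + |thermalGap u| * δ := by
          refine (abs_add_le _ _).trans (add_le_add hK ?_)
          rw [abs_mul]
          exact mul_le_mul_of_nonneg_left hflow (abs_nonneg _)
        _ ≤ ε := by linarith
    · rw [hρ' a]
      refine (abs_mix_sub_le (Set.Ioo_subset_Icc_self hu) hρ₁ a).trans ?_
      linarith [mul_nonneg (abs_nonneg (thermalGap u)) hδ.le]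

lemma exchange (h : Drives β t W f c) (ht : ∑ j, β j * t j = 1) (hik : i ≠ k)
    (hu : u ∈ Set.Ioo 0 1) :
    Drives β t W (fun p => mix i k u (f p))
      fun p => c p + thermalGap u * (f p k * (1 - u) - f p i * u) := by
  by_cases hgap : thermalGap u ≠ 0
  · exact h.exchange_of_ne ht hik hu hgap
  rw [not_not] at hgap
  have hIoo : ∀ᶠ v in 𝓝[>] u, v ∈ Set.Ioo u 1 := Ioo_mem_nhdsGT hu.2
  refine of_tendsto (l := 𝓝[>] u) (g := fun v => |thermalGap v| + 2 * |v - u|)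
    (hIoo.mono fun v hv => h.exchange_of_ne ht hik ⟨hu.1.trans hv.1, hv.2⟩
      (hgap ▸ thermalGap_lt_thermalGap hu.1 hv.1 hv.2).ne) ?_
    (Eventually.of_forall fun v p hp a => ?_) (hIoo.mono fun v hv p hp => ?_)
  · have hcont : ContinuousAt (fun v => |thermalGap v| + 2 * |v - u|) u := by
      have := continuousAt_thermalGap hu
      fun_prop
    simpa [ContinuousAt, hgap] using hcont.tendsto.mono_left nhdsWithin_le_nhds
  · exact (abs_mix_sub_mix_le (h.mapsTo hp) i k v u a).trans
      (le_add_of_nonneg_left (abs_nonneg _))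
  · have hi := mem_Icc_of_mem_stdSimplex (h.mapsTo hp) i
    have hk := mem_Icc_of_mem_stdSimplex (h.mapsTo hp) k
    have hflow : |f p k * (1 - v) - f p i * v| ≤ 1 := by
      rw [abs_le]
      constructor <;> nlinarith [hi.1, hi.2, hk.1, hk.2, hv.1, hv.2, hu.1]
    rw [hgap, zero_mul, add_zero, add_sub_cancel_left, abs_mul]
    exact (mul_le_of_le_one_right (abs_nonneg _) hflow).trans
      (le_add_of_nonneg_right (by positivity))

lemma chain (h : Drives β t W f c) (ht : ∑ j, β j * t j = 1) (hik : i ≠ k) {x : ℕ → ℝ} {n : ℕ}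
    (hx : ∀ m ≤ n, x m ∈ Set.Ioo 0 1) :
    Drives β t W (fun p => mix i k (x n) (f p)) fun p =>
      c p + thermalGap (x 0) * (f p k * (1 - x 0) - f p i * x 0) +
        (f p i + f p k) * ∑ m ∈ Finset.range n, thermalGap (x (m + 1)) * (x m - x (m + 1)) := by
  induction n with
  | zero => simpa using h.exchange ht hik (hx 0 le_rfl)
  | succ n ih =>
    refine ((ih fun m hm => hx m (hm.trans n.le_succ)).exchange ht hik (hx _ le_rfl)).congr
      (fun p _ => mix_mix hik _ _ _) fun p _ => ?_
    simp only [mix, if_neg hik.symm, if_true, Finset.sum_range_succ]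
    ring

lemma quasistatic_of_mem_Ioo (h : Drives β t W f c) (ht : ∑ j, β j * t j = 1) (hik : i ≠ k)
    (hu : u ∈ Set.Ioo 0 1) (hy : y ∈ Set.Ioo 0 1) :
    Drives β t W (fun p => mix i k y (f p)) fun p =>
      c p - f p i * Real.log (1 - u) - f p k * Real.log u -
        (f p i + f p k) * Real.binEntropy y := by
  let x (n m : ℕ) : ℝ := AffineMap.lineMap u y ((m : ℝ) / n)
  have hmem : ∀ n, ∀ m ≤ n, x n m ∈ Set.Ioo 0 1 := fun n m hm => (convex_Ioo 0 1).lineMap_mem hu hy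
    ⟨by positivity, div_le_one_of_le₀ (Nat.cast_le.2 hm) n.cast_nonneg⟩
  have hstart : ∀ n, x n 0 = u := fun n => by simp [x]
  have hend : ∀ n, 0 < n → x n n = y := fun n hn => by
    simp only [x, div_self (Nat.cast_ne_zero.2 hn.ne' : (n : ℝ) ≠ 0), AffineMap.lineMap_apply_one]
  refine of_tendsto (l := atTop)
    (g := fun n : ℕ => 2 * ((thermalGap y - thermalGap u) * (u - y)) / n)
    (Eventually.of_forall fun n => h.chain ht hik (hmem n))
    (tendsto_const_div_atTop_nhds_zero_nat _) ?_ ?_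
  all_goals
    filter_upwards [eventually_gt_atTop 0] with n hn p hp
    obtain ⟨hlower, hupper⟩ := sum_thermalGap_mul_lineMap_mem_Icc hu hy hn fun m => rfl (a := x n m)
  · intro a
    rw [hend n hn, sub_self, abs_zero, mul_div_assoc]
    linarith
  · rw [hstart]
    set s := ∑ m ∈ Finset.range n, thermalGap (x n (m + 1)) * (x n m - x n (m + 1))
    have hdiff : c p + thermalGap u * (f p k * (1 - u) - f p i * u) + (f p i + f p k) * s -
        (c p - f p i * Real.log (1 - u) - f p k * Real.log u -
          (f p i + f p k) * Real.binEntropy y) =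
        (f p i + f p k) * (s - (Real.binEntropy u - Real.binEntropy y)) := by
      rw [Real.binEntropy_eq_negMulLog_add_negMulLog_one_sub u, Real.negMulLog, Real.negMulLog,
        thermalGap]
      ring
    have hpair := add_nonneg ((h.mapsTo hp).1 i) ((h.mapsTo hp).1 k)
    rw [hdiff, abs_of_nonneg (mul_nonneg hpair (sub_nonneg.2 hlower)), mul_div_assoc]
    exact mul_le_mul (add_le_two_of_mem_stdSimplex (h.mapsTo hp) i k) (by linarith)
      (sub_nonneg.2 hlower) zero_le_two

lemma quasistatic (h : Drives β t W f c) (ht : ∑ j, β j * t j = 1) (hik : i ≠ k)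
    (hu : u ∈ Set.Ioo 0 1) (hy : y ∈ Set.Icc 0 1) :
    Drives β t W (fun p => mix i k y (f p)) fun p =>
      c p - f p i * Real.log (1 - u) - f p k * Real.log u -
        (f p i + f p k) * Real.binEntropy y := by
  have : (𝓝[Set.Ioo 0 1] y).NeBot := mem_closure_iff_nhdsWithin_neBot.1
    (by rwa [closure_Ioo zero_ne_one])
  refine of_tendsto (l := 𝓝[Set.Ioo 0 1] y)
    (g := fun z => 2 * |Real.binEntropy y - Real.binEntropy z| + 2 * |z - y|)
    (eventually_mem_nhdsWithin.mono fun z hz => h.quasistatic_of_mem_Ioo ht hik hu hz) ?_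
    (Eventually.of_forall fun z p hp a => ?_) (Eventually.of_forall fun z p hp => ?_)
  · have hcont : Continuous fun z => 2 * |Real.binEntropy y - Real.binEntropy z| + 2 * |z - y| := by
      fun_prop
    simpa using (hcont.tendsto y).mono_left nhdsWithin_le_nhds
  · exact (abs_mix_sub_mix_le (h.mapsTo hp) i k z y a).trans
      (le_add_of_nonneg_left (by positivity))
  · have hpair := add_nonneg ((h.mapsTo hp).1 i) ((h.mapsTo hp).1 k)
    rw [sub_sub_sub_cancel_left, ← mul_sub, abs_mul, abs_of_nonneg hpair]
    exact (mul_le_mul_of_nonneg_right (add_le_two_of_mem_stdSimplex (h.mapsTo hp) i k)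
      (abs_nonneg _)).trans (le_add_of_nonneg_right (by positivity))

lemma populate (h : Drives β t W f c) (ht : ∑ j, β j * t j = 1) (hik : i ≠ k)
    (hk : ∀ p ∈ stdSimplex ℝ d, f p k = 0) (hy : y ∈ Set.Icc 0 1) :
    Drives β t W (fun p => mix i k y (f p)) fun p => c p - f p i * Real.binEntropy y := by
  refine of_tendsto (l := 𝓝[>] 0) (g := fun η : ℝ => η)
    (eventually_mem_nhdsWithin.mono fun η hη => h.quasistatic ht hik (u := 1 - Real.exp (-η))
      ⟨by simpa using hη, by linarith [Real.exp_pos (-η)]⟩ hy)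
    (tendsto_id.mono_left nhdsWithin_le_nhds) ?_ ?_
  all_goals filter_upwards [eventually_mem_nhdsWithin] with η (hη : 0 < η) p hp
  · intro a
    simpa using hη.le
  · have hi := mem_Icc_of_mem_stdSimplex (h.mapsTo hp) i
    have hdiff : c p - f p i * -η - 0 * Real.log (1 - Real.exp (-η)) -
        (f p i + 0) * Real.binEntropy y - (c p - f p i * Real.binEntropy y) = f p i * η := by
      ring
    rw [hk p hp, sub_sub_cancel, Real.log_exp, hdiff, abs_of_nonneg (mul_nonneg hi.1 hη.le)]
    exact mul_le_of_le_one_left hη.le hi.2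

lemma merge [Nonempty ι] (ht : ∑ j, β j * t j = 1) {q : d → ℝ} (hq : ∀ a, 0 < q a) (i : d)
    (A : Finset d) (hA : i ∉ A) :
    Drives β t W (fun p a => if a = i then p i + ∑ b ∈ A, p b else if a ∈ A then 0 else p a)
      fun p => (p i + ∑ b ∈ A, p b) * Real.log (q i + ∑ b ∈ A, q b) -
        (p i * Real.log (q i) + ∑ b ∈ A, p b * Real.log (q b)) := by
  induction A using Finset.induction with
  | empty =>
    refine Drives.id.congr (fun p _ => ?_) fun p _ => by simp
    funext a
    by_cases h : a = i <;> simp [h]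
  | insert k A hk ih =>
    rw [Finset.mem_insert, not_or] at hA
    set Q := q i + ∑ b ∈ A, q b with hQ
    have hQ₀ : 0 < Q := add_pos_of_pos_of_nonneg (hq i) (Finset.sum_nonneg fun b _ => (hq b).le)
    have hQk : 0 < Q + q k := add_pos hQ₀ (hq k)
    have hinsert : q i + ∑ b ∈ insert k A, q b = Q + q k := by
      rw [Finset.sum_insert hk, hQ]
      ring
    have hratio : 1 - q k / (Q + q k) = Q / (Q + q k) := by
      field_simp
      ring
    refine ((ih hA.2).quasistatic ht hA.1 (u := q k / (Q + q k))
      ⟨div_pos (hq k) hQk, (div_lt_one hQk).2 (lt_add_of_pos_left _ hQ₀)⟩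
      (Set.left_mem_Icc.2 zero_le_one)).congr (fun p _ => ?_) fun p _ => ?_
    · funext a
      simp only [mix, if_true, if_neg (Ne.symm hA.1), if_neg hk, sub_zero, mul_one, mul_zero,
        Finset.sum_insert hk, Finset.mem_insert]
      by_cases hai : a = i
      · simp only [hai, if_true]
        ring
      · by_cases hak : a = k <;> simp [hai, hak, Ne.symm hA.1]
    · simp only [if_true, if_neg (Ne.symm hA.1), if_neg hk]
      rw [hinsert, hratio, Real.log_div hQ₀.ne' hQk.ne', Real.log_div (hq k).ne' hQk.ne',
        Finset.sum_insert hk, Finset.sum_insert hk, Real.binEntropy_zero]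
      ring

lemma split (ht : ∑ j, β j * t j = 1) {r : d → ℝ} (hr : r ∈ stdSimplex ℝ d)
    (h : Drives β t W (fun _ => Pi.single i 1) c) (A : Finset d) (hA : i ∉ A) :
    Drives β t W (fun _ a => if a ∈ A then r a else if a = i then 1 - ∑ b ∈ A, r b else 0)
      fun p => c p - (∑ b ∈ A, Real.negMulLog (r b) + Real.negMulLog (1 - ∑ b ∈ A, r b)) := by
  induction A using Finset.induction with
  | empty =>
    refine h.congr (fun p _ => ?_) fun p _ => by simp
    funext a
    simp [Pi.single_apply]
  | insert k A hk ih =>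
    rw [Finset.mem_insert, not_or] at hA
    have hinsert : 1 - ∑ b ∈ insert k A, r b = 1 - ∑ b ∈ A, r b - r k := by
      rw [Finset.sum_insert hk, add_comm, sub_sub]
    have hle : ∑ b ∈ insert k A, r b ≤ 1 := by
      rw [← hr.2]
      exact Finset.sum_le_univ_sum_of_nonneg hr.1
    set R := 1 - ∑ b ∈ A, r b
    have hRk : r k ≤ R := by linarith
    have hR₀ : R = 0 → r k = 0 := fun h0 => le_antisymm (h0 ▸ hRk) (hr.1 k)
    refine ((ih hA.2).populate ht hA.1 (fun p _ => by simp [hk, Ne.symm hA.1]) (y := r k / R)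
      ⟨div_nonneg (hr.1 k) ((hr.1 k).trans hRk),
        div_le_one_of_le₀ hRk ((hr.1 k).trans hRk)⟩).congr (fun p _ => ?_) fun p _ => ?_
    · funext a
      simp only [mix, if_neg hA.2, if_true, if_neg hk, if_neg (Ne.symm hA.1), add_zero, mul_sub,
        mul_one, mul_div_cancel_of_imp' hR₀, Finset.mem_insert, hinsert]
      by_cases hai : a = i
      · simp [hai, hA.1, hA.2]
      · by_cases hak : a = k <;> simp [hai, hak, Ne.symm hA.1]
    · simp only [if_neg hA.2, if_true]
      rw [mul_binEntropy_div hR₀, hinsert, Finset.sum_insert hk]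
      ring

lemma const (ht : ∑ j, β j * t j = 1) {q : d → ℝ} (hq : ∀ a, 0 < q a) (hq₁ : ∑ a, q a = 1)
    {r : d → ℝ} (hr : r ∈ stdSimplex ℝ d) :
    Drives β t W (fun _ => r)
      fun p => ∑ a, p a * -Real.log (q a) - ∑ a, Real.negMulLog (r a) := by
  have : Nonempty ι := Finset.univ_nonempty_iff.1
    (Finset.nonempty_of_sum_ne_zero (ht ▸ one_ne_zero))
  obtain ⟨i, -⟩ := Finset.nonempty_of_sum_ne_zero (hq₁ ▸ one_ne_zero)
  have hi : i ∉ Finset.univ.erase i := Finset.notMem_erase _ _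
  have hsum : ∀ g : d → ℝ, g i + ∑ b ∈ Finset.univ.erase i, g b = ∑ b, g b := fun g =>
    Finset.add_sum_erase _ _ (Finset.mem_univ i)
  have hmerge : Drives β t W (fun _ => Pi.single i 1) fun p => ∑ a, p a * -Real.log (q a) := by
    refine (Drives.merge ht hq i _ hi).congr (fun p hp => ?_) fun p _ => ?_
    · funext a
      rw [hsum, hp.2]
      by_cases h : a = i <;> simp [h]
    · rw [hsum, hsum q, hq₁, hsum fun a => p a * Real.log (q a), Real.log_one, mul_zero, zero_sub,
        ← Finset.sum_neg_distrib]
      simp only [mul_neg]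
  have hri : 1 - ∑ b ∈ Finset.univ.erase i, r b = r i := by
    rw [← hr.2, ← hsum r, add_sub_cancel_right]
  refine (hmerge.split ht hr _ hi).congr (fun p _ => ?_) fun p _ => ?_
  · funext a
    rw [hri]
    by_cases h : a = i <;> simp [h]
  · rw [hri, add_comm, hsum fun a => Real.negMulLog (r a)]

end Drives

end Drives

/-! ### Joint diagonalisation -/

section JointDiagonalisation

open Module.End in
lemma exists_orthonormalBasis_apply_eq_smul {𝕜 E ι d : Type*} [RCLike 𝕜] [NormedAddCommGroup E]
    [InnerProductSpace 𝕜 E] [FiniteDimensional 𝕜 E] [Fintype d] {T : ι → E →ₗ[𝕜] E}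
    (hT : ∀ j, (T j).IsSymmetric) (hcomm : Pairwise (Function.onFun Commute T))
    (hcard : Module.finrank 𝕜 E = Fintype.card d) :
    ∃ (b : OrthonormalBasis d 𝕜 E) (lam : ι → d → ℝ), ∀ j i, T j (b i) = (lam j i : 𝕜) • b i := by
  classical
  have hint := LinearMap.IsSymmetric.directSum_isInternal_of_pairwise_commute hT hcomm
  let u (χ : ι → 𝕜) := (stdOrthonormalBasis 𝕜 (⨅ j, eigenspace (T j) (χ j) : Submodule 𝕜 E)).toBasis
  let B := hint.collectedBasis u
  have hB : Orthonormal 𝕜 B := by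
    rw [hint.collectedBasis_coe]
    exact (LinearMap.IsSymmetric.orthogonalFamily_iInf_eigenspaces
      hT).orthonormal_sigma_orthonormal (v_family := fun χ => u χ) fun χ => by simp [u]
  have := Module.Finite.finite_basis B
  have := Fintype.ofFinite (Σ χ : ι → 𝕜,
    Fin (Module.finrank 𝕜 (⨅ j, eigenspace (T j) (χ j) : Submodule 𝕜 E)))
  let e := Fintype.equivOfCardEq ((Module.finrank_eq_card_basis B).symm.trans hcard)
  let b := (B.toOrthonormalBasis hB).reindex e
  have hb : ∀ j i, T j (b i) = (e.symm i).1 j • b i := fun j i => by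
    have hmem : b i ∈ (⨅ j, eigenspace (T j) ((e.symm i).1 j) : Submodule 𝕜 E) := by
      rw [show b i = B (e.symm i) by simp [b]]
      exact hint.collectedBasis_mem u (e.symm i)
    exact mem_eigenspace_iff.1 ((Submodule.mem_iInf _).1 hmem j)
  refine ⟨b, fun j i => RCLike.re ((e.symm i).1 j), fun j i => ?_⟩
  have heig : HasEigenvalue (T j) ((e.symm i).1 j) :=
    hasEigenvalue_of_hasEigenvector
      ⟨mem_eigenspace_iff.2 (hb j i), b.toBasis.ne_zero i ∘ fun h => by simpa using h⟩
  rw [hb, RCLike.conj_eq_iff_re.1 ((hT j).conj_eigenvalue_eq_self heig)]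

lemma exists_eq_conjDiag_of_commute {ι d : Type*} [Fintype d] [DecidableEq d]
    {Q : ι → Matrix d d ℂ} (hQ : ∀ j, (Q j).IsHermitian) (hcomm : ∀ i j, Commute (Q i) (Q j)) :
    ∃ (W : unitaryGroup d ℂ) (lam : Matrix ι d ℝ), ∀ j, Q j = conjDiag W (lam j) := by
  have hcommLin : Pairwise (Function.onFun Commute fun j => toEuclideanLin (Q j)) := by
    intro i j _
    ext1 x
    simp only [Module.End.mul_apply, toLpLin_apply, mulVec_mulVec, (hcomm i j).eq]
  obtain ⟨b, lam, hb⟩ := exists_orthonormalBasis_apply_eq_smul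
    (fun j => isSymmetric_toEuclideanLin_iff.2 (hQ j)) hcommLin finrank_euclideanSpace
  let W : unitaryGroup d ℂ := ⟨(EuclideanSpace.basisFun d ℂ).toBasis.toMatrix b.toBasis,
    (EuclideanSpace.basisFun d ℂ).toMatrix_orthonormalBasis_mem_unitary b⟩
  have hWapply : ∀ a i, (W : Matrix d d ℂ) a i = b i a := fun a i => by
    simp [W, Module.Basis.toMatrix_apply]
  refine ⟨W, lam, fun j => ?_⟩
  have hQW : Q j * W = W * diagonal fun i => (lam j i : ℂ) := by
    ext a i
    have h := congrArg (fun x : EuclideanSpace ℂ d => x a) (hb j i)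
    simp only [toLpLin_apply, PiLp.smul_apply, smul_eq_mul] at h
    rw [mul_diagonal, hWapply, mul_comm, ← RCLike.ofReal_eq_complex_ofReal, ← h]
    simp only [mul_apply, hWapply]
    rfl
  have hW : (W : Matrix d d ℂ) * (W : Matrix d d ℂ)ᴴ = 1 := mem_unitaryGroup_iff.1 W.2
  rw [conjDiag_apply, ← hQW, Matrix.mul_assoc, hW, Matrix.mul_one]

end JointDiagonalisation

/-! ### The Gibbs variational principle -/

section Variational

variable {ι d : Type*} [Fintype ι] [Fintype d] [DecidableEq d]

lemma IsDensity.sum_population_mul_neg_log_boltzmann {ρ : Matrix d d ℂ} (hρ : IsDensity ρ)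
    {W : unitaryGroup d ℂ} {Q : ι → Matrix d d ℂ} {b : ι → ℝ} {m : d → ℝ}
    (h : ∑ j, (b j : ℂ) • Q j = conjDiag W m) :
    ∑ i, population W ρ i * -Real.log (boltzmann m i) =
      ∑ j, b j * expect ρ (Q j) + Real.log (partition m) := by
  have := hρ.nonempty
  simp only [neg_log_boltzmann, mul_add, Finset.sum_add_distrib, ← Finset.sum_mul]
  rw [(hρ.population_mem_stdSimplex W).2, one_mul, ← expect_conjDiag, ← h, expect_sum_smul_right]

lemma IsDensity.vonNeumannEntropy_le_add_log_partition {ρ : Matrix d d ℂ} (hρ : IsDensity ρ)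
    {W : unitaryGroup d ℂ} {Q : ι → Matrix d d ℂ} {b : ι → ℝ} {m : d → ℝ}
    (h : ∑ j, (b j : ℂ) • Q j = conjDiag W m) :
    vonNeumannEntropy ρ ≤ ∑ j, b j * expect ρ (Q j) + Real.log (partition m) := by
  have := hρ.nonempty
  rw [← hρ.sum_population_mul_neg_log_boltzmann h]
  exact hρ.vonNeumannEntropy_le W (boltzmann_mem_stdSimplex m).1 (boltzmann_mem_stdSimplex m).2.le
    fun i hi => absurd hi (boltzmann_pos m i).ne'

lemma vonNeumannEntropy_gibbs [Nonempty d] {W : unitaryGroup d ℂ} {Q : ι → Matrix d d ℂ}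
    {b : ι → ℝ} {m : d → ℝ} (h : ∑ j, (b j : ℂ) • Q j = conjDiag W m) :
    vonNeumannEntropy (gibbs b Q) =
      ∑ j, b j * expect (gibbs b Q) (Q j) + Real.log (partition m) := by
  have hgibbs := gibbs_eq_conjDiag h
  have hdens : IsDensity (gibbs b Q) :=
    hgibbs ▸ isDensity_conjDiag W (boltzmann_mem_stdSimplex m)
  rw [← hdens.sum_population_mul_neg_log_boltzmann h, hgibbs, vonNeumannEntropy_conjDiag,
    population_conjDiag_self]
  exact Finset.sum_congr rfl fun i _ => by rw [Real.negMulLog, neg_mul_comm]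

lemma freeEntropy_gibbs_le {Q : ι → Matrix d d ℂ} (hQ : ∀ j, (Q j).IsHermitian) (β : ι → ℝ)
    {ρ : Matrix d d ℂ} (hρ : IsDensity ρ) :
    freeEntropy β Q (gibbs β Q) ≤ freeEntropy β Q ρ := by
  have := hρ.nonempty
  obtain ⟨W, h⟩ := exists_eq_conjDiag_eigenvalues (isHermitian_sum_smul hQ β)
  rw [freeEntropy, freeEntropy, vonNeumannEntropy_gibbs h]
  linarith [hρ.vonNeumannEntropy_le_add_log_partition h]

end Variational

/-! ### The dual function -/

section Dual

variable {ι d : Type*} [Fintype ι] [Fintype d]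

/-- The dual function of the maximisation of the entropy under the constraints `lam *ᵥ p = v`: its
infimum over `b` is the entropy of the ensemble. -/
noncomputable def dual (lam : Matrix ι d ℝ) (v b : ι → ℝ) : ℝ :=
  b ⬝ᵥ v + Real.log (partition (b ᵥ* lam))

lemma hasDerivAt_log_partition [Nonempty d] (m l : d → ℝ) :
    HasDerivAt (fun s : ℝ => Real.log (partition (m + s • l))) (-(l ⬝ᵥ boltzmann m)) 0 := by
  have hterm : ∀ i, HasDerivAt (fun s : ℝ => Real.exp (-(m + s • l) i))
      (Real.exp (-m i) * -l i) 0 := fun i => by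
    have hlin : HasDerivAt (fun s : ℝ => -(m i + s * l i)) (-l i) 0 := by
      simpa using (((hasDerivAt_id' (0 : ℝ)).mul_const (l i)).const_add (m i)).fun_neg
    simpa using hlin.exp
  have hpart : HasDerivAt (fun s : ℝ => partition (m + s • l))
      (∑ i, Real.exp (-m i) * -l i) 0 := HasDerivAt.fun_sum fun i _ => hterm i
  refine (hpart.log (partition_pos _).ne').congr_deriv ?_
  rw [zero_smul, add_zero, Finset.sum_div, dotProduct, ← Finset.sum_neg_distrib]
  exact Finset.sum_congr rfl fun i _ => by rw [boltzmann]; ring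

lemma hasDerivAt_dual [Nonempty d] (lam : Matrix ι d ℝ) (v b w : ι → ℝ) :
    HasDerivAt (fun s : ℝ => dual lam v (b + s • w))
      (w ⬝ᵥ (v - lam *ᵥ boltzmann (b ᵥ* lam))) 0 := by
  have hlin : HasDerivAt (fun s : ℝ => (b + s • w) ⬝ᵥ v) (w ⬝ᵥ v) 0 := by
    simpa [add_dotProduct, smul_dotProduct] using
      ((hasDerivAt_id (0 : ℝ)).mul_const (w ⬝ᵥ v)).const_add (b ⬝ᵥ v)
  have hlog := hasDerivAt_log_partition (b ᵥ* lam) (w ᵥ* lam)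
  simp only [← smul_vecMul, ← add_vecMul] at hlog
  rw [dotProduct_sub, dotProduct_mulVec, sub_eq_add_neg]
  exact hlin.add hlog

lemma continuous_dual [Nonempty d] (lam : Matrix ι d ℝ) (v : ι → ℝ) :
    Continuous (dual lam v) := by
  have hpart : Continuous fun b : ι → ℝ => partition (b ᵥ* lam) := by
    unfold partition vecMul dotProduct
    fun_prop
  have hlin : Continuous fun b : ι → ℝ => b ⬝ᵥ v := by
    unfold dotProduct
    fun_prop
  exact hlin.add (hpart.log fun b => (partition_pos _).ne')

lemma norm_sq_le_dotProduct_self (b : ι → ℝ) : ‖b‖ ^ 2 ≤ b ⬝ᵥ b := by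
  have hnonneg : 0 ≤ b ⬝ᵥ b := Finset.sum_nonneg fun j _ => mul_self_nonneg _
  refine (Real.le_sqrt (norm_nonneg _) hnonneg).1
    ((pi_norm_le_iff_of_nonneg (Real.sqrt_nonneg _)).2 fun j => ?_)
  rw [Real.norm_eq_abs]
  refine Real.abs_le_sqrt ?_
  rw [sq]
  exact Finset.single_le_sum (f := fun j => b j * b j) (fun j _ => mul_self_nonneg _)
    (Finset.mem_univ j)

lemma hasDerivAt_mul_dotProduct_self (η : ℝ) (b w : ι → ℝ) :
    HasDerivAt (fun s : ℝ => η * ((b + s • w) ⬝ᵥ (b + s • w))) (w ⬝ᵥ (2 * η) • b) 0 := by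
  have hexpand : ∀ s : ℝ, η * ((b + s • w) ⬝ᵥ (b + s • w)) =
      η * (b ⬝ᵥ b) + s * (w ⬝ᵥ (2 * η) • b) + η * (w ⬝ᵥ w) * s ^ 2 := fun s => by
    simp only [add_dotProduct, dotProduct_add, smul_dotProduct, dotProduct_smul, smul_eq_mul,
      dotProduct_comm b w]
    ring
  simp only [hexpand]
  simpa using (((hasDerivAt_id' (0 : ℝ)).mul_const (w ⬝ᵥ (2 * η) • b)).const_add
    (η * (b ⬝ᵥ b))).fun_add (((hasDerivAt_id' (0 : ℝ)).fun_pow 2).const_mul (η * (w ⬝ᵥ w)))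

lemma mulVec_boltzmann_eq_of_forall_le [Nonempty d] {lam : Matrix ι d ℝ} {v b : ι → ℝ} {η : ℝ}
    (hb : ∀ b', dual lam v b + η * (b ⬝ᵥ b) ≤ dual lam v b' + η * (b' ⬝ᵥ b')) :
    lam *ᵥ boltzmann (b ᵥ* lam) = v + (2 * η) • b := by
  have hstationary : ∀ w, w ⬝ᵥ (v - lam *ᵥ boltzmann (b ᵥ* lam) + (2 * η) • b) = 0 := by
    intro w
    have hmin : IsLocalMin (fun s : ℝ => dual lam v (b + s • w) +
        η * ((b + s • w) ⬝ᵥ (b + s • w))) 0 :=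
      Eventually.of_forall fun s => by simpa using hb (b + s • w)
    rw [dotProduct_add]
    exact hmin.hasDerivAt_eq_zero
      ((hasDerivAt_dual lam v b w).add (hasDerivAt_mul_dotProduct_self η b w))
  have hzero := dotProduct_eq_zero _ fun w => (dotProduct_comm _ w).trans (hstationary w)
  exact (sub_eq_zero.1 (by rw [← hzero]; abel)).symm

/-- The penalty `η ‖b‖²` makes the infimum of the dual function attained. -/
lemma exists_mulVec_boltzmann_eq [Nonempty d] {lam : Matrix ι d ℝ} {v : ι → ℝ} {S η : ℝ}
    (hS : ∀ b, S ≤ dual lam v b) (hη : 0 < η) :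
    ∃ b, lam *ᵥ boltzmann (b ᵥ* lam) = v + (2 * η) • b ∧ η * (b ⬝ᵥ b) ≤ dual lam v 0 - S := by
  let Φ (b : ι → ℝ) := dual lam v b + η * (b ⬝ᵥ b)
  have hΦ0 : Φ 0 = dual lam v 0 := by simp [Φ]
  have hcont : Continuous Φ := by
    refine (continuous_dual lam v).add (continuous_const.mul ?_)
    unfold dotProduct
    fun_prop
  have hcoercive : ∀ᶠ b in cocompact (ι → ℝ), Φ 0 ≤ Φ b := by
    have hC : 0 ≤ (dual lam v 0 - S) / η := div_nonneg (sub_nonneg.2 (hS 0)) hη.le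
    filter_upwards [tendsto_norm_cocompact_atTop.eventually_ge_atTop
      ((dual lam v 0 - S) / η + 1)] with b hb
    have hsq : (dual lam v 0 - S) / η ≤ b ⬝ᵥ b := by nlinarith [norm_sq_le_dotProduct_self b]
    rw [div_le_iff₀ hη] at hsq
    rw [hΦ0]
    linarith [hS b]
  obtain ⟨b, hb⟩ := hcont.exists_forall_le' 0 hcoercive
  exact ⟨b, mulVec_boltzmann_eq_of_forall_le hb, by linarith [hS b, hb 0]⟩

lemma exists_abs_mulVec_boltzmann_sub_le [Nonempty d] {lam : Matrix ι d ℝ} {v : ι → ℝ} {S ε : ℝ}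
    (hS : ∀ b, S ≤ dual lam v b) (hε : 0 < ε) :
    ∃ b, ∀ j, |(lam *ᵥ boltzmann (b ᵥ* lam)) j - v j| ≤ ε := by
  set C := dual lam v 0 - S
  have hC : 0 ≤ C := sub_nonneg.2 (hS 0)
  have hη : 0 < ε ^ 2 / (4 * (C + 1)) := by positivity
  set η := ε ^ 2 / (4 * (C + 1)) with hη_def
  obtain ⟨b, hb, hbound⟩ := exists_mulVec_boltzmann_eq hS hη
  refine ⟨b, fun j => ?_⟩
  have hbj : b j * b j ≤ b ⬝ᵥ b := Finset.single_le_sum (f := fun j => b j * b j)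
    (fun j _ => mul_self_nonneg _) (Finset.mem_univ j)
  have hηC : η * (4 * (C + 1)) = ε ^ 2 := by rw [hη_def]; field_simp
  rw [hb, Pi.add_apply, add_sub_cancel_left, Pi.smul_apply, smul_eq_mul]
  refine abs_le_of_sq_le_sq ?_ hε.le
  calc (2 * η * b j) ^ 2 = 4 * η * (η * (b j * b j)) := by ring
    _ ≤ 4 * η * (η * (b ⬝ᵥ b)) := by gcongr
    _ ≤ 4 * η * C := by gcongr
    _ ≤ ε ^ 2 := by linarith

end Dual

/-! ### Existence and uniqueness of the ensemble -/

section Ensemble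

lemma tendsto_sum_mul_neg_log {κ d : Type*} [Fintype d] {l : Filter κ} {q : κ → d → ℝ}
    {p : d → ℝ} (h : Tendsto q l (𝓝 p)) :
    Tendsto (fun n => ∑ i, p i * -Real.log (q n i)) l (𝓝 (∑ i, Real.negMulLog (p i))) := by
  refine tendsto_finsetSum _ fun i _ => ?_
  rw [Real.negMulLog, neg_mul_comm]
  rcases eq_or_ne (p i) 0 with hpi | hpi
  · simp only [hpi, zero_mul]
    exact tendsto_const_nhds
  · exact ((tendsto_pi_nhds.1 h i).log hpi).neg.const_mul (p i)

variable {ι d : Type*} [Fintype d] [DecidableEq d]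

lemma continuous_conjDiag (W : unitaryGroup d ℂ) : Continuous (conjDiag W) := by
  have hdiag : Continuous fun p : d → ℝ => diagonal fun i => (p i : ℂ) :=
    Continuous.matrix_diagonal (by fun_prop)
  exact (continuous_const.matrix_mul hdiag).matrix_mul continuous_const

lemma continuous_population (W : unitaryGroup d ℂ) : Continuous (population W) :=
  continuous_pi fun i => Complex.continuous_re.comp
    (((continuous_const.matrix_mul continuous_id).matrix_mul continuous_const).matrix_elem i i)

variable {W : unitaryGroup d ℂ} {Q : ι → Matrix d d ℂ} {lam : Matrix ι d ℝ} {v : ι → ℝ}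

lemma expect_eq_mulVec_population (hQ : ∀ j, Q j = conjDiag W (lam j)) (ρ : Matrix d d ℂ) (j : ι) :
    expect ρ (Q j) = (lam *ᵥ population W ρ) j := by
  rw [hQ, expect_conjDiag]
  exact dotProduct_comm _ _

variable [Fintype ι]

lemma sum_smul_eq_conjDiag_vecMul (hQ : ∀ j, Q j = conjDiag W (lam j)) (b : ι → ℝ) :
    ∑ j, (b j : ℂ) • Q j = conjDiag W (b ᵥ* lam) := by
  simp only [hQ, Complex.coe_smul, ← map_smul, ← map_sum]
  congr 1
  ext i
  simp [vecMul, dotProduct, Finset.sum_apply]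

lemma sum_population_mul_neg_log_boltzmann_vecMul (hQ : ∀ j, Q j = conjDiag W (lam j))
    {ρ : Matrix d d ℂ} (hρ : ρ ∈ microstates Q v) (b : ι → ℝ) :
    ∑ i, population W ρ i * -Real.log (boltzmann (b ᵥ* lam) i) = dual lam v b := by
  rw [hρ.1.sum_population_mul_neg_log_boltzmann (sum_smul_eq_conjDiag_vecMul hQ b), dual,
    dotProduct]
  simp only [hρ.2]

lemma vonNeumannEntropy_le_dual (hQ : ∀ j, Q j = conjDiag W (lam j)) {ρ : Matrix d d ℂ}
    (hρ : ρ ∈ microstates Q v) (b : ι → ℝ) : vonNeumannEntropy ρ ≤ dual lam v b := by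
  refine (hρ.1.vonNeumannEntropy_le_add_log_partition
    (sum_smul_eq_conjDiag_vecMul hQ b)).trans_eq ?_
  rw [dual, dotProduct]
  simp only [hρ.2]

lemma exists_tendsto_boltzmann_of_mem_closure [Nonempty d] (hQ : ∀ j, Q j = conjDiag W (lam j))
    {γ : Matrix d d ℂ} (hγ : γ ∈ closure (Set.range fun b : ι → ℝ => gibbs b Q)) :
    ∃ p ∈ stdSimplex ℝ d, γ = conjDiag W p ∧
      ∃ b : ℕ → ι → ℝ, Tendsto (fun n => boltzmann (b n ᵥ* lam)) atTop (𝓝 p) := by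
  have : FirstCountableTopology (Matrix d d ℂ) :=
    inferInstanceAs (FirstCountableTopology (d → d → ℂ))
  obtain ⟨x, hx, hlim⟩ := mem_closure_iff_seq_limit.1 hγ
  choose b hb using hx
  obtain rfl : x = fun n => conjDiag W (boltzmann (b n ᵥ* lam)) := funext fun n => by
    rw [← gibbs_eq_conjDiag (sum_smul_eq_conjDiag_vecMul hQ (b n)), ← hb n]
  have hlim_population : Tendsto (fun n => boltzmann (b n ᵥ* lam)) atTop (𝓝 (population W γ)) := by
    simpa only [Function.comp_def, population_conjDiag_self] using
      ((continuous_population W).tendsto γ).comp hlim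
  exact ⟨population W γ, (isClosed_stdSimplex ℝ d).mem_of_tendsto hlim_population
      (Eventually.of_forall fun n => boltzmann_mem_stdSimplex _),
    tendsto_nhds_unique hlim (((continuous_conjDiag W).tendsto _).comp hlim_population),
    b, hlim_population⟩

lemma IsEnsemble.mem_microstates [Nonempty d] (hQ : ∀ j, Q j = conjDiag W (lam j))
    {γ : Matrix d d ℂ} (h : IsEnsemble Q v γ) : γ ∈ microstates Q v := by
  obtain ⟨p, hp, hγ, -⟩ := exists_tendsto_boltzmann_of_mem_closure hQ h.1
  exact ⟨hγ ▸ isDensity_conjDiag W hp, h.2⟩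

lemma IsEnsemble.exists_dual_le [Nonempty d] (hQ : ∀ j, Q j = conjDiag W (lam j))
    {γ : Matrix d d ℂ} (h : IsEnsemble Q v γ) {η : ℝ} (hη : 0 < η) :
    ∃ b, dual lam v b ≤ vonNeumannEntropy γ + η := by
  have hγ := h.mem_microstates hQ
  obtain ⟨p, -, rfl, b, hb⟩ := exists_tendsto_boltzmann_of_mem_closure hQ h.1
  have hlim := tendsto_sum_mul_neg_log hb
  rw [← vonNeumannEntropy_conjDiag W] at hlim
  obtain ⟨n, hn⟩ := (hlim.eventually (gt_mem_nhds (lt_add_of_pos_right _ hη))).exists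
  refine ⟨b n, ?_⟩
  rw [← sum_population_mul_neg_log_boltzmann_vecMul hQ hγ, population_conjDiag_self]
  exact hn.le

lemma IsEnsemble.vonNeumannEntropy_le [Nonempty d] (hQ : ∀ j, Q j = conjDiag W (lam j))
    {γ : Matrix d d ℂ} (h : IsEnsemble Q v γ) {ρ : Matrix d d ℂ} (hρ : ρ ∈ microstates Q v) :
    vonNeumannEntropy ρ ≤ vonNeumannEntropy γ := by
  refine le_of_forall_pos_le_add fun η hη => ?_
  obtain ⟨b, hb⟩ := h.exists_dual_le hQ hη
  exact (vonNeumannEntropy_le_dual hQ hρ b).trans hb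

lemma IsEnsemble.unique [Nonempty d] (hQ : ∀ j, Q j = conjDiag W (lam j))
    {γ γ' : Matrix d d ℂ} (h : IsEnsemble Q v γ) (h' : IsEnsemble Q v γ') : γ = γ' := by
  obtain ⟨p, hp, rfl, -⟩ := exists_tendsto_boltzmann_of_mem_closure hQ h.1
  obtain ⟨p', hp', rfl, -⟩ := exists_tendsto_boltzmann_of_mem_closure hQ h'.1
  have hmean : lam *ᵥ population W (conjDiag W p) = v :=
    funext fun j => (expect_eq_mulVec_population hQ _ j).symm.trans (h.2 j)
  have hmean' : lam *ᵥ population W (conjDiag W p') = v :=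
    funext fun j => (expect_eq_mulVec_population hQ _ j).symm.trans (h'.2 j)
  rw [population_conjDiag_self] at hmean hmean'
  by_contra hne
  set r : d → ℝ := (1 / 2 : ℝ) • p + (1 / 2 : ℝ) • p' with hr
  have hmid : conjDiag W r ∈ microstates Q v := by
    refine ⟨isDensity_conjDiag W (convex_stdSimplex ℝ d hp hp' (by norm_num) (by norm_num)
      (by norm_num)), fun j => ?_⟩
    rw [expect_eq_mulVec_population hQ, population_conjDiag_self, hr, mulVec_add, mulVec_smul,
      mulVec_smul, hmean, hmean', ← add_smul]
    norm_num
  have hmax := h.vonNeumannEntropy_le hQ hmid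
  have hmax' := h'.vonNeumannEntropy_le hQ hmid
  simp only [vonNeumannEntropy_conjDiag] at hmax hmax'
  obtain ⟨k, hk⟩ := Function.ne_iff.1 fun hpp : p = p' => hne (congrArg _ hpp)
  have hlt : ∑ i, ((1 / 2 : ℝ) • Real.negMulLog (p i) + (1 / 2 : ℝ) • Real.negMulLog (p' i)) <
      ∑ i, Real.negMulLog (r i) :=
    Finset.sum_lt_sum
      (fun i _ => Real.concaveOn_negMulLog.2 (hp.1 i) (hp'.1 i) (by norm_num) (by norm_num)
        (by norm_num))
      ⟨k, Finset.mem_univ k, Real.strictConcaveOn_negMulLog.2 (hp.1 k) (hp'.1 k) hk (by norm_num)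
        (by norm_num) (by norm_num)⟩
  simp only [smul_eq_mul, Finset.sum_add_distrib, ← Finset.mul_sum] at hlt
  linarith

lemma exists_isEnsemble [Nonempty d] (hQ : ∀ j, Q j = conjDiag W (lam j))
    (hv : (microstates Q v).Nonempty) : ∃ γ, IsEnsemble Q v γ := by
  obtain ⟨ρ, hρ⟩ := hv
  choose b hb using fun n : ℕ => exists_abs_mulVec_boltzmann_sub_le
    (vonNeumannEntropy_le_dual hQ hρ) (ε := 1 / ((n : ℝ) + 1)) Nat.one_div_pos_of_nat
  obtain ⟨p, -, φ, hφ, hlim⟩ := (isCompact_stdSimplex ℝ d).tendsto_subseq fun n =>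
    boltzmann_mem_stdSimplex (b n ᵥ* lam)
  have hgibbs : Tendsto (fun n => gibbs (b (φ n)) Q) atTop (𝓝 (conjDiag W p)) := by
    simp only [gibbs_eq_conjDiag (sum_smul_eq_conjDiag_vecMul hQ _)]
    exact ((continuous_conjDiag W).tendsto p).comp hlim
  refine ⟨conjDiag W p, mem_closure_of_tendsto hgibbs (Eventually.of_forall fun n =>
    Set.mem_range_self _), fun j => ?_⟩
  refine tendsto_nhds_unique (((continuous_expect (Q j)).tendsto _).comp hgibbs) ?_
  rw [tendsto_iff_norm_sub_tendsto_zero]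
  refine squeeze_zero (fun n => norm_nonneg _) (fun n => ?_)
    (tendsto_one_div_add_atTop_nhds_zero_nat.comp hφ.tendsto_atTop)
  rw [Function.comp_apply, expect_eq_mulVec_population hQ,
    gibbs_eq_conjDiag (sum_smul_eq_conjDiag_vecMul hQ _), population_conjDiag_self]
  exact hb (φ n) j

end Ensemble

/-! ### Attainable transitions -/

section Entries

variable {d : Type*} [Fintype d]

lemma IsDensity.norm_apply_le_one {ρ : Matrix d d ℂ} (hρ : IsDensity ρ) (a b : d) :
    ‖ρ a b‖ ≤ 1 := by
  classical
  obtain ⟨W, p, hp, rfl⟩ := hρ.exists_eq_conjDiag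
  rw [conjDiag_apply, mul_apply, ← hp.2]
  refine norm_sum_le_of_le _ fun k _ => ?_
  rw [mul_diagonal, conjTranspose_apply, norm_mul, norm_mul, norm_star, Complex.norm_real,
    Real.norm_of_nonneg (hp.1 k)]
  exact (mul_le_of_le_one_right (mul_nonneg (norm_nonneg _) (hp.1 k))
    (entry_norm_bound_of_unitary W.2 b k)).trans
      (mul_le_of_le_one_left (hp.1 k) (entry_norm_bound_of_unitary W.2 a k))

lemma norm_evolve_apply_le [DecidableEq d] (U : unitaryGroup d ℂ) {A : Matrix d d ℂ} {δ : ℝ}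
    (hA : ∀ a b, ‖A a b‖ ≤ δ) (a b : d) : ‖evolve U A a b‖ ≤ (Fintype.card d : ℝ) ^ 2 * δ := by
  rw [evolve, mul_apply]
  calc _ ≤ ∑ _y : d, ∑ _x : d, δ := norm_sum_le_of_le _ fun y _ => by
        rw [norm_mul, conjTranspose_apply, norm_star, mul_apply]
        refine (mul_le_of_le_one_right (norm_nonneg _)
          (entry_norm_bound_of_unitary U.2 b y)).trans (norm_sum_le_of_le _ fun x _ => ?_)
        rw [norm_mul]
        exact (mul_le_of_le_one_left (norm_nonneg _)
          (entry_norm_bound_of_unitary U.2 a x)).trans (hA x y)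
    _ = (Fintype.card d : ℝ) ^ 2 * δ := by
      simp only [Finset.sum_const, Finset.card_univ, nsmul_eq_mul]
      ring

end Entries

lemma eventually_mul_le (M : ℝ) {ε : ℝ} (hε : 0 < ε) : ∀ᶠ δ in 𝓝[>] (0 : ℝ), M * δ ≤ ε := by
  have hlim : Tendsto (M * ·) (𝓝[>] 0) (𝓝 0) :=
    ((continuous_const_mul M).tendsto' 0 0 (mul_zero M)).mono_left nhdsWithin_le_nhds
  filter_upwards [hlim.eventually (gt_mem_nhds hε)] with δ hδ using hδ.le

section Polarisation

variable {ι : Type*} [Fintype ι] {β : ι → ℝ}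

lemma exists_sum_mul_eq_one (hβ : β ≠ 0) : ∃ t : ι → ℝ, ∑ j, β j * t j = 1 := by
  classical
  obtain ⟨j, hj⟩ := Function.ne_iff.1 hβ
  exact ⟨Pi.single j (β j)⁻¹, (dotProduct_single β _ j).trans (mul_inv_cancel₀ hj)⟩

lemma exists_mul_one_sub_two_mul_sigmoid_eq {s : ℝ} (hs : 0 < s) :
    ∃ x : ℝ, x * (1 - 2 * Real.sigmoid (-x)) = s := by
  have hcont : Continuous fun x : ℝ => x * (1 - 2 * Real.sigmoid (-x)) := by
    have := continuous_sigmoid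
    fun_prop
  have hend : s ≤ (2 * s + 2) * (1 - 2 * Real.sigmoid (-(2 * s + 2))) := by
    have hexp : 4 ≤ 1 + Real.exp (2 * s + 2) := by linarith [Real.add_one_le_exp (2 * s + 2)]
    have hsigmoid : Real.sigmoid (-(2 * s + 2)) ≤ 1 / 4 := by
      rw [Real.sigmoid_def, neg_neg, one_div]
      exact inv_anti₀ (by norm_num) hexp
    nlinarith
  obtain ⟨x, -, hx⟩ := intermediate_value_Icc (by linarith : (0 : ℝ) ≤ 2 * s + 2)
    hcont.continuousOn (show s ∈ Set.Icc _ _ from ⟨by simpa using hs.le, hend⟩)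
  exact ⟨x, hx⟩

/-- Inverting a qubit with the gaps `h` changes the observables by the left-hand sides. -/
lemma exists_ne_zero_mul_one_sub_two_mul_sigmoid_eq {η : ι → ℝ} (hη : 0 < ∑ j, β j * η j) :
    ∃ h : ι → ℝ, h ≠ 0 ∧
      ∀ j, h j * (1 - 2 * Real.sigmoid (-∑ k, β k * h k)) = η j := by
  obtain ⟨x, hx⟩ := exists_mul_one_sub_two_mul_sigmoid_eq hη
  have hne : 1 - 2 * Real.sigmoid (-x) ≠ 0 := fun hzero => by
    rw [hzero, mul_zero] at hx
    exact hη.ne hx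
  have hgap : ∑ j, β j * (η j / (1 - 2 * Real.sigmoid (-x))) = x := by
    simp only [← mul_div_assoc, ← Finset.sum_div]
    rw [← hx, mul_div_cancel_right₀ _ hne]
  have hinv : ∀ j, η j / (1 - 2 * Real.sigmoid (-x)) * (1 - 2 * Real.sigmoid (-x)) = η j :=
    fun j => div_mul_cancel₀ _ hne
  refine ⟨fun j => η j / (1 - 2 * Real.sigmoid (-x)), fun hzero => hη.ne ?_, by rwa [hgap]⟩
  refine (Finset.sum_eq_zero fun j _ => ?_).symm
  rw [← hinv j, congrFun hzero j, Pi.zero_apply, zero_mul, mul_zero]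

lemma exists_ne_zero_abs_one_sub_two_mul_sigmoid_le {t : ι → ℝ} (ht : ∑ j, β j * t j = 1) {δ : ℝ}
    (hδ : δ ∈ Set.Ioc 0 1) :
    ∃ h : ι → ℝ, h ≠ 0 ∧ |1 - 2 * Real.sigmoid (-∑ j, β j * h j)| ≤ δ := by
  have hu : 1 / 2 - δ / 4 ∈ Set.Ioo (0 : ℝ) 1 := ⟨by linarith [hδ.2], by linarith [hδ.1]⟩
  have hsigmoid := sigmoid_neg_thermalGap hu
  have hgap : ∑ j, β j * (thermalGap (1 / 2 - δ / 4) • t) j = thermalGap (1 / 2 - δ / 4) := by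
    simpa only [dotProduct, ht, smul_eq_mul, mul_one] using
      dotProduct_smul (thermalGap (1 / 2 - δ / 4)) β t
  refine ⟨thermalGap (1 / 2 - δ / 4) • t, fun hzero => ?_, ?_⟩
  · simp only [hzero, Pi.zero_apply, mul_zero, Finset.sum_const_zero] at hgap
    rw [← hgap, neg_zero, Real.sigmoid_zero] at hsigmoid
    linarith [hδ.1]
  · rw [hgap, hsigmoid, abs_le]
    constructor <;> linarith [hδ.1]

end Polarisation

section Attainable

variable {ι d : Type*} [Fintype ι] [Fintype d] [DecidableEq d]

/-- The macrostate `(v, Q)` can be taken to the microstates in `T` by macrostate operations that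
decrease the expectation values of the total observables by `w`. Macrostate operations and work
extraction are the cases `w = 0` and `w = W`. -/
def Attainable (β : ι → ℝ) (Q : ι → Matrix d d ℂ) (v : ι → ℝ) (T : Set (Matrix d d ℂ))
    (w : ι → ℝ) : Prop :=
  ∀ ε > (0 : ℝ), ∃ (E : Environment ι) (U : unitaryGroup (d × E.Idx) ℂ),
    ∀ ρ ∈ microstates Q v, ∀ σ ∈ E.thermalMicrostates β,
      (∃ ρ' ∈ T, traceNorm (partialTrace (E.final U ρ σ) - ρ') ≤ ε) ∧
        ∀ j, |E.decrease Q U ρ σ j - w j| ≤ ε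

variable {β v w t : ι → ℝ} {Q : ι → Matrix d d ℂ} {ρf : Matrix d d ℂ}

lemma attainable_of_forall_sub_smul {T : Set (Matrix d d ℂ)}
    (h : ∀ ν > (0 : ℝ), Attainable β Q v T (w - ν • t)) : Attainable β Q v T w := by
  intro ε hε
  obtain ⟨ν, hνt, hν⟩ := ((eventually_all.2 fun j =>
    eventually_mul_le |t j| (half_pos hε)).and self_mem_nhdsWithin).exists
  obtain ⟨E, U, hEU⟩ := h ν hν (ε / 2) (half_pos hε)
  refine ⟨E, U, fun ρ hρ σ hσ => ?_⟩
  obtain ⟨⟨ρ', hρ', hclose⟩, hdec⟩ := hEU ρ hρ σ hσ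
  refine ⟨⟨ρ', hρ', hclose.trans (half_le_self hε.le)⟩, fun j => ?_⟩
  calc |E.decrease Q U ρ σ j - w j| =
        |(E.decrease Q U ρ σ j - (w - ν • t) j) - t j * ν| := by
        rw [Pi.sub_apply, Pi.smul_apply, smul_eq_mul]
        ring_nf
    _ ≤ ε / 2 + ε / 2 := (abs_sub _ _).trans (add_le_add (hdec j) (by
        rw [abs_mul, abs_of_pos (show 0 < ν from hν)]
        exact hνt j))
    _ = ε := add_halves ε

lemma realizable_prepare [Nonempty ι] (ht : ∑ j, β j * t j = 1) (W : unitaryGroup d ℂ) {q : d → ℝ}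
    (hq : ∀ a, 0 < q a) (hq₁ : ∑ a, q a = 1) (hf : IsDensity ρf) {η : ι → ℝ}
    (hη : 0 < ∑ j, β j * η j) {δ : ℝ} (hδ : δ ∈ Set.Ioc 0 1) :
    Realizable β fun ρ ρ' c =>
      (∀ a b, ‖(ρ' - ρf) a b‖ ≤ (Fintype.card d : ℝ) ^ 2 * δ) ∧
      ∀ j, |c j - (t j * (∑ a, population W ρ a * -Real.log (q a) - vonNeumannEntropy ρf) + η j)|
        ≤ |t j| * δ := by
  obtain ⟨V, r, hr, rfl⟩ := hf.exists_eq_conjDiag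
  obtain ⟨h₁, hh₁, hinv⟩ := exists_ne_zero_mul_one_sub_two_mul_sigmoid_eq hη
  obtain ⟨h₂, hh₂, hpol⟩ := exists_ne_zero_abs_one_sub_two_mul_sigmoid_le ht hδ
  have hdrive := (Drives.const (W := W) ht hq hq₁ hr).realizable δ hδ.1
  refine (((hdrive.invert hh₁).dephase hh₂ hpol hδ.2 Finset.univ).unitary V).mono ?_
  rintro ρ - c - - ⟨ρ₂, ⟨ρ₁, hρ₁, ⟨c₁, ⟨C, hc₁, hC, hpop⟩, hc⟩, hdiag, -, hoff⟩, rfl⟩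
  refine ⟨?_, fun j => ?_⟩
  · have hentry : ∀ a b, ‖(ρ₂ - diagonal fun i => (r i : ℂ)) a b‖ ≤ δ := by
      intro a b
      rw [Matrix.sub_apply]
      rcases eq_or_ne a b with rfl | hab
      · have hreal : ((ρ₁ a a).re : ℂ) = ρ₁ a a := hρ₁.1.isHermitian.coe_re_apply_self a
        rw [diagonal_apply_eq, hdiag, ← hreal, ← Complex.ofReal_sub, Complex.norm_real]
        exact hpop a
      · rw [diagonal_apply_ne _ hab, sub_zero]
        exact (hoff a (Finset.mem_univ a) b hab).trans
          (mul_le_of_le_one_right hδ.1.le (hρ₁.norm_apply_le_one a b))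
    have hsub : evolve V ρ₂ - conjDiag V r = evolve V (ρ₂ - diagonal fun i => (r i : ℂ)) := by
      simp only [evolve, conjDiag_apply, Matrix.mul_sub, Matrix.sub_mul]
    rw [hsub]
    exact norm_evolve_apply_le V hentry
  · rw [vonNeumannEntropy_conjDiag, hc j, hc₁ j, hinv j, add_sub_add_right_eq_sub, ← mul_sub,
      abs_mul]
    exact mul_le_mul_of_nonneg_left hC (abs_nonneg _)

variable {W : unitaryGroup d ℂ} {lam : Matrix ι d ℝ}

lemma attainable_of_lt (hβ : β ≠ 0) (hQ : ∀ j, Q j = conjDiag W (lam j)) (hf : IsDensity ρf)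
    {b : ι → ℝ}
    (hlt : ∑ j, β j * w j + freeEntropy β Q ρf + dual lam v b < ∑ j, β j * v j) :
    Attainable β Q v {ρf} w := by
  intro ε hε
  have := hf.nonempty
  have : Nonempty ι := (Function.ne_iff.1 hβ).nonempty
  obtain ⟨t, ht⟩ := exists_sum_mul_eq_one hβ
  set D : ℝ := (Fintype.card d : ℝ) ^ 2
  set c₀ := dual lam v b - vonNeumannEntropy ρf with hc₀
  set η : ι → ℝ := fun j => v j - expect ρf (Q j) - t j * c₀ - w j with hη
  have hsurplus : 0 < ∑ j, β j * η j := by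
    simp only [hη, mul_sub, Finset.sum_sub_distrib, ← mul_assoc, ← Finset.sum_mul, ht, one_mul]
    rw [freeEntropy] at hlt
    linarith
  obtain ⟨δ, ⟨hδstate, hδcharge⟩, hδ⟩ := (((eventually_mul_le (D * D) hε).and
    (eventually_all.2 fun j => eventually_mul_le (D * entrySum (Q j) + |t j|) hε)).and
    (Ioc_mem_nhdsGT one_pos)).exists
  have hq := boltzmann_mem_stdSimplex (b ᵥ* lam)
  obtain ⟨E, U, hEU⟩ := realizable_prepare ht W (boltzmann_pos _) hq.2 hf hsurplus hδ
  refine ⟨E, U, fun ρ hρ σ hσ => ?_⟩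
  obtain ⟨hclose, henv⟩ := hEU ρ hρ.1 σ hσ
  have hD : 0 ≤ D * δ := mul_nonneg (sq_nonneg _) hδ.1.le
  refine ⟨⟨ρf, rfl, (traceNorm_le hD hclose).trans ?_⟩, fun j => ?_⟩
  · rwa [← mul_assoc]
  · have hcharge := abs_expect_le_of_norm_apply_le hclose (Q j)
    have henv := henv j
    rw [sum_population_mul_neg_log_boltzmann_vecMul hQ hρ, ← hc₀] at henv
    calc |E.decrease Q U ρ σ j - w j|
        = |-expect (partialTrace (E.final U ρ σ) - ρf) (Q j) -
            (E.envIncrease U ρ σ j - (t j * c₀ + η j))| := by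
          rw [E.decrease_eq Q U ρ (fun l => (hσ l).1), hρ.2 j, expect_sub_left]
          simp only [hη]
          ring_nf
      _ ≤ D * δ * entrySum (Q j) + |t j| * δ :=
          (abs_sub _ _).trans (add_le_add ((abs_neg _).trans_le hcharge) henv)
      _ = (D * entrySum (Q j) + |t j|) * δ := by ring
      _ ≤ ε := hδcharge j

lemma IsEnsemble.freeEntropy_eq {γ : Matrix d d ℂ} (hγ : IsEnsemble Q v γ) :
    freeEntropy β Q γ = ∑ j, β j * v j - vonNeumannEntropy γ := by
  simp only [freeEntropy, hγ.2]

lemma IsEnsemble.attainable (hβ : β ≠ 0) (hQ : ∀ j, Q j = conjDiag W (lam j)) {γ : Matrix d d ℂ}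
    (hγ : IsEnsemble Q v γ) (hf : IsDensity ρf)
    (hle : ∑ j, β j * w j ≤ freeEntropy β Q γ - freeEntropy β Q ρf) :
    Attainable β Q v {ρf} w := by
  have := hf.nonempty
  obtain ⟨t, ht⟩ := exists_sum_mul_eq_one hβ
  refine attainable_of_forall_sub_smul (t := t) fun ν hν => ?_
  obtain ⟨b, hb⟩ := hγ.exists_dual_le hQ (half_pos hν)
  refine attainable_of_lt hβ hQ hf (b := b) ?_
  have hshift : ∑ j, β j * (w - ν • t) j = ∑ j, β j * w j - ν := by
    change β ⬝ᵥ (w - ν • t) = β ⬝ᵥ w - ν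
    rw [dotProduct_sub, dotProduct_smul, show β ⬝ᵥ t = 1 from ht, smul_eq_mul, mul_one]
  rw [hγ.freeEntropy_eq] at hle
  linarith

end Attainable

/-! ### Unattainable transitions -/

section Converse

variable {ι d : Type*} [Fintype ι] [Fintype d] [DecidableEq d] {β v v' w : ι → ℝ}
  {Q : ι → Matrix d d ℂ} {γ γ' ρ ρ' ρf : Matrix d d ℂ} {ε : ℝ}

lemma sub_le_freeEntropy_of_traceNorm_le {K : Matrix d d ℂ}
    (hK : vonNeumannEntropy ρ' ≤ expect ρ' K) (hclose : traceNorm (ρ' - ρ) ≤ ε) :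
    ∑ j, β j * expect ρ (Q j) - expect ρ K - entrySum (∑ j, (β j : ℂ) • Q j - K) * ε ≤
      freeEntropy β Q ρ' := by
  set M := ∑ j, (β j : ℂ) • Q j - K with hM
  have hexpect : ∀ τ, expect τ M = ∑ j, β j * expect τ (Q j) - expect τ K := fun τ => by
    rw [← expect_sum_smul_right, hM]
    simp only [expect, Matrix.mul_sub, trace_sub, Complex.sub_re]
  have hdiff := abs_expect_le (ρ' - ρ) M
  rw [expect_sub_left, hexpect, hexpect] at hdiff
  have herror : traceNorm (ρ' - ρ) * entrySum M ≤ entrySum M * ε := by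
    rw [mul_comm]
    exact mul_le_mul_of_nonneg_left hclose (entrySum_nonneg M)
  rw [freeEntropy]
  linarith [(abs_le.1 hdiff).1]

lemma sum_mul_sub_le_of_abs_sub_le {c : ι → ℝ} (hc : ∀ j, |c j - w j| ≤ ε) :
    ∑ j, β j * w j - (∑ j, |β j|) * ε ≤ ∑ j, β j * c j := by
  rw [Finset.sum_mul, ← Finset.sum_sub_distrib]
  refine Finset.sum_le_sum fun j _ => ?_
  have hj : |β j * (c j - w j)| ≤ |β j| * ε := by
    rw [abs_mul]
    exact mul_le_mul_of_nonneg_left (hc j) (abs_nonneg _)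
  linarith [(abs_le.1 hj).1]

/-- The operators `K` replace the continuity of the entropy on `T`: they bound it from above on all
states, by an affine function. -/
lemma Attainable.sum_mul_le {T : Set (Matrix d d ℂ)} (h : Attainable β Q v T w)
    (hγ : γ ∈ microstates Q v) {g : ℝ}
    (hT : ∀ η > 0, ∃ K : Matrix d d ℂ, (∀ ρ, IsDensity ρ → vonNeumannEntropy ρ ≤ expect ρ K) ∧
      ∀ ρ ∈ T, g - η ≤ ∑ j, β j * expect ρ (Q j) - expect ρ K) :
    ∑ j, β j * w j ≤ freeEntropy β Q γ - g := by
  refine le_of_forall_pos_le_add fun η hη => ?_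
  obtain ⟨K, hK, hKT⟩ := hT (η / 2) (half_pos hη)
  obtain ⟨ε, herror, hε⟩ := ((eventually_mul_le
    (entrySum (∑ j, (β j : ℂ) • Q j - K) + ∑ j, |β j|) (half_pos hη)).and
    self_mem_nhdsWithin).exists
  obtain ⟨E, U, hEU⟩ := h ε hε
  have hσ := E.gibbsFamily_mem_thermalMicrostates β
  obtain ⟨⟨ρ, hρ, hclose⟩, hdec⟩ := hEU γ hγ _ hσ
  have hfinal := (E.isDensity_final U hγ.1 fun l => (hσ l).1).partialTrace
  have hentropy := sub_le_freeEntropy_of_traceNorm_le (β := β) (Q := Q) (hK _ hfinal) hclose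
  have hcharge := sum_mul_sub_le_of_abs_sub_le (β := β) hdec
  have hbalance := E.sum_mul_decrease_le β Q U hγ.1
  linarith [hKT ρ hρ]

lemma Attainable.sum_mul_le_of_singleton (h : Attainable β Q v {ρf} w)
    (hγ : γ ∈ microstates Q v) (hf : IsDensity ρf) :
    ∑ j, β j * w j ≤ freeEntropy β Q γ - freeEntropy β Q ρf := by
  refine h.sum_mul_le hγ fun η hη => ?_
  obtain ⟨K, hK, hKf⟩ := hf.exists_vonNeumannEntropy_le_expect hη
  refine ⟨K, hK, ?_⟩
  rintro ρ rfl
  rw [freeEntropy]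
  linarith

lemma Attainable.sum_mul_le_of_microstates {W : unitaryGroup d ℂ} {lam : Matrix ι d ℝ}
    (h : Attainable β Q v (microstates Q v') w) (hQ : ∀ j, Q j = conjDiag W (lam j))
    (hγ : γ ∈ microstates Q v) (hγ' : IsEnsemble Q v' γ') :
    ∑ j, β j * w j ≤ freeEntropy β Q γ - freeEntropy β Q γ' := by
  have := hγ.1.nonempty
  refine h.sum_mul_le hγ fun η hη => ?_
  obtain ⟨b, hb⟩ := hγ'.exists_dual_le hQ hη
  refine ⟨conjDiag W fun i => -Real.log (boltzmann (b ᵥ* lam) i), fun ρ hρ => ?_, fun ρ hρ => ?_⟩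
  · rw [expect_conjDiag]
    have hq := boltzmann_mem_stdSimplex (b ᵥ* lam)
    exact hρ.vonNeumannEntropy_le W hq.1 hq.2.le fun i hi => absurd hi (boltzmann_pos _ i).ne'
  · rw [expect_conjDiag, sum_population_mul_neg_log_boltzmann_vecMul hQ hρ, hγ'.freeEntropy_eq]
    simp only [hρ.2]
    linarith

end Converse

/-! ### The second law -/

section SecondLaw

variable {ι d : Type*} [Fintype ι] [Fintype d] [DecidableEq d] {β v v' w : ι → ℝ}
  {Q : ι → Matrix d d ℂ} {ρf : Matrix d d ℂ}

lemma existsUnique_isEnsemble (hQ : ∀ j, (Q j).IsHermitian) (hcomm : ∀ i j, Commute (Q i) (Q j))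
    (hv : (microstates Q v).Nonempty) : ∃! γ, IsEnsemble Q v γ := by
  obtain ⟨W, lam, hlam⟩ := exists_eq_conjDiag_of_commute hQ hcomm
  have := hv.some_mem.1.nonempty
  obtain ⟨γ, hγ⟩ := exists_isEnsemble hlam hv
  exact ⟨γ, hγ, fun γ' hγ' => hγ'.unique hlam hγ⟩

lemma isEnsemble_ensemble (hQ : ∀ j, (Q j).IsHermitian) (hcomm : ∀ i j, Commute (Q i) (Q j))
    (hv : (microstates Q v).Nonempty) : IsEnsemble Q v (ensemble Q v) := by
  have h := (existsUnique_isEnsemble hQ hcomm hv).exists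
  rw [ensemble, dif_pos h]
  exact h.choose_spec

lemma ensemble_mem_microstates (hQ : ∀ j, (Q j).IsHermitian) (hcomm : ∀ i j, Commute (Q i) (Q j))
    (hv : (microstates Q v).Nonempty) : ensemble Q v ∈ microstates Q v := by
  obtain ⟨W, lam, hlam⟩ := exists_eq_conjDiag_of_commute hQ hcomm
  have := hv.some_mem.1.nonempty
  exact (isEnsemble_ensemble hQ hcomm hv).mem_microstates hlam

lemma attainable_singleton_iff (hQ : ∀ j, (Q j).IsHermitian)
    (hcomm : ∀ i j, Commute (Q i) (Q j)) (hβ : β ≠ 0) (hv : (microstates Q v).Nonempty)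
    (hf : IsDensity ρf) :
    Attainable β Q v {ρf} w ↔
      ∑ j, β j * w j ≤ freeEntropy β Q (ensemble Q v) - freeEntropy β Q ρf := by
  obtain ⟨W, lam, hlam⟩ := exists_eq_conjDiag_of_commute hQ hcomm
  exact ⟨fun h => h.sum_mul_le_of_singleton (ensemble_mem_microstates hQ hcomm hv) hf,
    (isEnsemble_ensemble hQ hcomm hv).attainable hβ hlam hf⟩

lemma Attainable.sum_mul_le_ensemble (h : Attainable β Q v (microstates Q v') w)
    (hQ : ∀ j, (Q j).IsHermitian) (hcomm : ∀ i j, Commute (Q i) (Q j))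
    (hv : (microstates Q v).Nonempty) (hv' : (microstates Q v').Nonempty) :
    ∑ j, β j * w j ≤ freeEntropy β Q (ensemble Q v) - freeEntropy β Q (ensemble Q v') := by
  obtain ⟨W, lam, hlam⟩ := exists_eq_conjDiag_of_commute hQ hcomm
  exact h.sum_mul_le_of_microstates hlam (ensemble_mem_microstates hQ hcomm hv)
    (isEnsemble_ensemble hQ hcomm hv')

lemma macReach_iff_attainable : MacReach β Q v ρf ↔ Attainable β Q v {ρf} 0 := by
  simp only [MacReach, Attainable, Set.mem_singleton_iff, exists_eq_left, Pi.zero_apply, sub_zero]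
  refine ⟨fun h ε hε => h ε hε ε hε, fun h ε hε ε' hε' => ?_⟩
  obtain ⟨E, U, hEU⟩ := h _ (lt_min hε hε')
  exact ⟨E, U, fun ρ hρ σ hσ => ⟨(hEU ρ hρ σ hσ).1.trans (min_le_left _ _),
    fun j => ((hEU ρ hρ σ hσ).2 j).trans (min_le_right _ _)⟩⟩

lemma MacToMac.attainable (h : MacToMac β Q v v') :
    Attainable β Q v (microstates Q v') 0 := by
  simpa only [Attainable, Pi.zero_apply, sub_zero] using fun ε hε => h ε hε ε hε

lemma MacReach.macToMac (h : MacReach β Q v ρf) (hf : ρf ∈ microstates Q v') :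
    MacToMac β Q v v' := by
  intro ε hε ε' hε'
  obtain ⟨E, U, hEU⟩ := h ε hε ε' hε'
  exact ⟨E, U, fun ρ hρ σ hσ => ⟨⟨ρf, hf, (hEU ρ hρ σ hσ).1⟩, (hEU ρ hρ σ hσ).2⟩⟩

lemma macReach_iff (hQ : ∀ j, (Q j).IsHermitian) (hcomm : ∀ i j, Commute (Q i) (Q j))
    (hβ : β ≠ 0) (hv : (microstates Q v).Nonempty) (hf : IsDensity ρf) :
    MacReach β Q v ρf ↔ freeEntropy β Q (ensemble Q v) ≥ freeEntropy β Q ρf := by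
  rw [macReach_iff_attainable, attainable_singleton_iff hQ hcomm hβ hv hf]
  simp only [Pi.zero_apply, mul_zero, Finset.sum_const_zero, sub_nonneg, ge_iff_le]

end SecondLaw

/-! ### Energy, heat and work -/

section Energy

variable {d : Type*} [Fintype d] [DecidableEq d] {β : ℝ} {H ρ ρf : Matrix d d ℂ} {e e' : ℝ}

lemma freeEntropy_eq_mul_freeEnergy (hβ : β ≠ 0) (H ρ : Matrix d d ℂ) :
    freeEntropy (fun _ : Unit => β) (fun _ => H) ρ = β * freeEnergy β H ρ := by
  rw [freeEntropy, freeEnergy, Fintype.sum_unique]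
  field_simp

lemma canonical_mem_energyMicrostates (hH : H.IsHermitian)
    (he : (energyMicrostates H e).Nonempty) : canonical H e ∈ energyMicrostates H e :=
  ensemble_mem_microstates (fun _ => hH) (fun _ _ => Commute.refl H) he

lemma isDensity_thermal [Nonempty d] (hH : H.IsHermitian) (β : ℝ) : IsDensity (thermal β H) :=
  isDensity_gibbs (fun _ => hH) _

lemma freeEnergy_thermal_le (hH : H.IsHermitian) (hβ : 0 < β) (hρ : IsDensity ρ) :
    freeEnergy β H (thermal β H) ≤ freeEnergy β H ρ := by
  rw [← mul_le_mul_iff_right₀ hβ, ← freeEntropy_eq_mul_freeEnergy hβ.ne',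
    ← freeEntropy_eq_mul_freeEnergy hβ.ne']
  exact freeEntropy_gibbs_le (fun _ => hH) _ hρ

lemma energyMacReach_iff (hH : H.IsHermitian) (hβ : 0 < β)
    (he : (energyMicrostates H e).Nonempty) (hf : IsDensity ρf) :
    EnergyMacReach β H e ρf ↔ freeEnergy β H (canonical H e) ≥ freeEnergy β H ρf := by
  rw [EnergyMacReach, macReach_iff (fun _ => hH) (fun _ _ => Commute.refl H)
    (Function.ne_iff.2 ⟨(), hβ.ne'⟩) he hf, freeEntropy_eq_mul_freeEnergy hβ.ne',
    freeEntropy_eq_mul_freeEnergy hβ.ne', ge_iff_le, mul_le_mul_iff_right₀ hβ]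
  rfl

lemma EnergyMacToMac.freeEnergy_le (h : EnergyMacToMac β H e e') (hH : H.IsHermitian)
    (hβ : 0 < β) (he : (energyMicrostates H e).Nonempty)
    (he' : (energyMicrostates H e').Nonempty) :
    freeEnergy β H (canonical H e') ≤ freeEnergy β H (canonical H e) := by
  have hle := h.attainable.sum_mul_le_ensemble (fun _ => hH) (fun _ _ => Commute.refl H) he he'
  simp only [Pi.zero_apply, mul_zero, Finset.sum_const_zero, sub_nonneg] at hle
  rwa [freeEntropy_eq_mul_freeEnergy hβ.ne', freeEntropy_eq_mul_freeEnergy hβ.ne',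
    mul_le_mul_iff_right₀ hβ] at hle

lemma macroEntropy_eq (hH : H.IsHermitian) (hβ : β ≠ 0) (he : (energyMicrostates H e).Nonempty) :
    macroEntropy β H e = vonNeumannEntropy (canonical H e) := by
  have hmean : expect (canonical H e) H = e := (canonical_mem_energyMicrostates hH he).2 ()
  rw [macroEntropy, macroFreeEnergy, freeEnergy, hmean]
  field_simp
  ring

lemma mul_macroEntropy_sub_le_iff (hβ : β ≠ 0) (H : Matrix d d ℂ) (e e' : ℝ) :
    1 / β * (macroEntropy β H e - macroEntropy β H e') ≤ e - e' ↔
      macroFreeEnergy β H e' ≤ macroFreeEnergy β H e := by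
  have hcancel : 1 / β * (macroEntropy β H e - macroEntropy β H e') =
      e - macroFreeEnergy β H e - (e' - macroFreeEnergy β H e') := by
    rw [macroEntropy, macroEntropy]
    field_simp
  rw [hcancel]
  constructor <;> intro h <;> linarith

lemma clausius_tfae (hH : H.IsHermitian) (hβ : 0 < β) (he : (energyMicrostates H e).Nonempty)
    (he' : (energyMicrostates H e').Nonempty) :
    List.TFAE [EnergyMacReach β H e (canonical H e'),
      ∃ ρf ∈ energyMicrostates H e', EnergyMacReach β H e ρf,
      EnergyMacToMac β H e e',
      e - e' ≥ 1 / β * (macroEntropy β H e - macroEntropy β H e')] := by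
  have hmem := canonical_mem_energyMicrostates hH he'
  rw [ge_iff_le, mul_macroEntropy_sub_le_iff hβ.ne']
  tfae_have 1 → 2 := fun h => ⟨_, hmem, h⟩
  tfae_have 2 → 3 := fun ⟨_, hf, h⟩ => MacReach.macToMac h hf
  tfae_have 3 → 4 := fun h => h.freeEnergy_le hH hβ he he'
  tfae_have 4 → 1 := (energyMacReach_iff hH hβ he hmem.1).2
  tfae_finish

lemma mem_extractableWorkTo_iff_attainable {w : ℝ} :
    w ∈ extractableWorkTo β H e ρf ↔
      Attainable (fun _ : Unit => β) (fun _ => H) (fun _ => e) {ρf} fun _ => w := by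
  simp only [Attainable, Set.mem_singleton_iff, exists_eq_left]
  refine ⟨fun h ε hε => ?_, fun h ε hε ε' hε' => ?_⟩
  · obtain ⟨E, U, hEU⟩ := h ε hε ε hε
    exact ⟨E, U, fun ρ hρ σ hσ => ⟨(hEU ρ hρ σ hσ).1, fun _ => (hEU ρ hρ σ hσ).2⟩⟩
  · obtain ⟨E, U, hEU⟩ := h _ (lt_min hε hε')
    exact ⟨E, U, fun ρ hρ σ hσ => ⟨(hEU ρ hρ σ hσ).1.trans (min_le_left _ _),
      ((hEU ρ hρ σ hσ).2 ()).trans (min_le_right _ _)⟩⟩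

lemma mem_extractableWorkTo_iff (hH : H.IsHermitian) (hβ : 0 < β)
    (he : (energyMicrostates H e).Nonempty) (hf : IsDensity ρf) {w : ℝ} :
    w ∈ extractableWorkTo β H e ρf ↔ w ≤ macroFreeEnergy β H e - freeEnergy β H ρf := by
  rw [mem_extractableWorkTo_iff_attainable, attainable_singleton_iff (fun _ => hH)
    (fun _ _ => Commute.refl H) (Function.ne_iff.2 ⟨(), hβ.ne'⟩) he hf,
    freeEntropy_eq_mul_freeEnergy hβ.ne', freeEntropy_eq_mul_freeEnergy hβ.ne',
    Fintype.sum_unique, ← mul_sub, mul_le_mul_iff_right₀ hβ]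
  rfl

lemma isGreatest_extractableWorkTo (hH : H.IsHermitian) (hβ : 0 < β)
    (he : (energyMicrostates H e).Nonempty) (hf : IsDensity ρf) :
    IsGreatest (extractableWorkTo β H e ρf) (macroFreeEnergy β H e - freeEnergy β H ρf) :=
  ⟨(mem_extractableWorkTo_iff hH hβ he hf).2 le_rfl,
    fun _ hw => (mem_extractableWorkTo_iff hH hβ he hf).1 hw⟩

lemma work_gibbsFamily_le (hH : H.IsHermitian) (hβ : 0 < β) (hρ : IsDensity ρ)
    (E : Environment Unit) (U : unitaryGroup (d × E.Idx) ℂ) :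
    work H E U ρ (E.gibbsFamily fun _ => β) ≤
      freeEnergy β H ρ - freeEnergy β H (thermal β H) := by
  have hbalance := E.sum_mul_decrease_le (fun _ => β) (fun _ => H) U hρ
  have hfinal := (E.isDensity_final U hρ
    fun l => (E.gibbsFamily_mem_thermalMicrostates (fun _ => β) l).1).partialTrace
  rw [freeEntropy_eq_mul_freeEnergy hβ.ne', freeEntropy_eq_mul_freeEnergy hβ.ne',
    Fintype.sum_unique, ← mul_sub, mul_le_mul_iff_right₀ hβ] at hbalance
  exact hbalance.trans (sub_le_sub_left (freeEnergy_thermal_le hH hβ hfinal) _)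

lemma isGreatest_extractableWork (hH : H.IsHermitian) (hβ : 0 < β)
    (he : (energyMicrostates H e).Nonempty) :
    IsGreatest (extractableWork β H e)
      (macroFreeEnergy β H e - freeEnergy β H (thermal β H)) := by
  have hmem := canonical_mem_energyMicrostates hH he
  have := hmem.1.nonempty
  refine ⟨fun ε hε => ?_, fun w hw => le_of_forall_pos_le_add fun ε hε => ?_⟩
  · obtain ⟨E, U, hEU⟩ :=
      (isGreatest_extractableWorkTo hH hβ he (isDensity_thermal hH β)).1 ε hε ε hε
    exact ⟨E, U, fun ρ hρ σ hσ => (hEU ρ hρ σ hσ).2⟩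
  · obtain ⟨E, U, hEU⟩ := hw ε hε
    have hclose := hEU _ hmem _ (E.gibbsFamily_mem_thermalMicrostates _)
    have hle := work_gibbsFamily_le hH hβ hmem.1 E U
    rw [macroFreeEnergy]
    linarith [(abs_le.1 hclose).1]

lemma isLUB_microWork (hH : H.IsHermitian) (hβ : 0 < β)
    (he : (energyMicrostates H e).Nonempty) :
    IsLUB (microWork β H (canonical H e))
      (macroFreeEnergy β H e - freeEnergy β H (thermal β H)) := by
  have hmem := canonical_mem_energyMicrostates hH he
  refine ⟨?_, fun B hB => le_of_forall_pos_le_add fun ε hε => ?_⟩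
  · rintro w ⟨E, U, rfl⟩
    exact work_gibbsFamily_le hH hβ hmem.1 E U
  · obtain ⟨E, U, hEU⟩ := (isGreatest_extractableWork hH hβ he).1 ε hε
    have hclose := hEU _ hmem _ (E.gibbsFamily_mem_thermalMicrostates _)
    linarith [hB ⟨E, U, rfl⟩, (abs_le.1 hclose).1]

end Energy

end MacroThermo

open MacroThermo in
theorem mainTheorem5_general {d : Type*} [Fintype d] [DecidableEq d] :
    (∀ (H : Matrix d d ℂ) (β : ℝ), H.IsHermitian → 0 < β →
      ∀ e : ℝ, (energyMicrostates H e).Nonempty →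
        (∃! γ, IsCanonical H e γ) ∧
        macroEntropy β H e = vonNeumannEntropy (canonical H e) ∧
        (∀ ρf : Matrix d d ℂ, IsDensity ρf →
          (EnergyMacReach β H e ρf ↔
            freeEnergy β H (canonical H e) ≥ freeEnergy β H ρf)) ∧
        (∀ e' : ℝ, (energyMicrostates H e').Nonempty →
          List.TFAE [
            EnergyMacReach β H e (canonical H e'),
            ∃ ρf ∈ energyMicrostates H e', EnergyMacReach β H e ρf,
            EnergyMacToMac β H e e',
            e - e' ≥ 1 / β * (macroEntropy β H e - macroEntropy β H e')]) ∧
        (∀ ρf : Matrix d d ℂ, IsDensity ρf →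
          IsGreatest (extractableWorkTo β H e ρf)
            (macroFreeEnergy β H e - freeEnergy β H ρf)) ∧
        IsGreatest (extractableWork β H e)
          (macroFreeEnergy β H e - freeEnergy β H (thermal β H)) ∧
        IsLUB (microWork β H (canonical H e))
          (macroFreeEnergy β H e - freeEnergy β H (thermal β H))) ∧
    (∀ {ι : Type*} [Fintype ι] (Q : ι → Matrix d d ℂ) (β v : ι → ℝ),
      (∀ j, (Q j).IsHermitian) → (∀ i j, Commute (Q i) (Q j)) → β ≠ 0 →
      (microstates Q v).Nonempty →
        (∃! γ, IsEnsemble Q v γ) ∧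
        ∀ ρf : Matrix d d ℂ, IsDensity ρf →
          (MacReach β Q v ρf ↔
            freeEntropy β Q (ensemble Q v) ≥ freeEntropy β Q ρf)) :=
  ⟨fun _ _ hH hβ _ he => ⟨existsUnique_isEnsemble (fun _ => hH) (fun _ _ => Commute.refl _) he,
      macroEntropy_eq hH hβ.ne' he,
      fun _ hf => energyMacReach_iff hH hβ he hf,
      fun _ he' => clausius_tfae hH hβ he he',
      fun _ hf => isGreatest_extractableWorkTo hH hβ he hf,
      isGreatest_extractableWork hH hβ he,
      isLUB_microWork hH hβ he⟩,
    fun _ _ _ hQ hcomm hβ hv => ⟨existsUnique_isEnsemble hQ hcomm hv,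
      fun _ hf => macReach_iff hQ hcomm hβ hv hf⟩⟩

theorem mainTheorem5 {d : Type*} [Fintype d] [DecidableEq d] :
    -- one observable, the energy
    (∀ (H : Matrix d d ℂ) (β : ℝ), H.IsHermitian → 0 < β →
      ∀ e : ℝ, (MacroThermo.energyMicrostates H e).Nonempty →
        -- the canonical ensemble exists and is unique, so that free energy and entropy are
        -- functions of the macrostate, and the latter is the entropy of the canonical ensemble
        (∃! γ, MacroThermo.IsCanonical H e γ) ∧
        MacroThermo.macroEntropy β H e =
          MacroThermo.vonNeumannEntropy (MacroThermo.canonical H e) ∧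
        -- the second law
        (∀ ρf : Matrix d d ℂ, MacroThermo.IsDensity ρf →
          (MacroThermo.EnergyMacReach β H e ρf ↔
            MacroThermo.freeEnergy β H (MacroThermo.canonical H e) ≥
              MacroThermo.freeEnergy β H ρf)) ∧
        -- the Clausius inequality for transitions between macrostates
        (∀ e' : ℝ, (MacroThermo.energyMicrostates H e').Nonempty →
          List.TFAE [
            MacroThermo.EnergyMacReach β H e (MacroThermo.canonical H e'),
            ∃ ρf ∈ MacroThermo.energyMicrostates H e', MacroThermo.EnergyMacReach β H e ρf,
            MacroThermo.EnergyMacToMac β H e e',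
            e - e' ≥ 1 / β *
              (MacroThermo.macroEntropy β H e - MacroThermo.macroEntropy β H e')]) ∧
        -- optimal work extraction, with prescribed and with arbitrary final state
        (∀ ρf : Matrix d d ℂ, MacroThermo.IsDensity ρf →
          IsGreatest (MacroThermo.extractableWorkTo β H e ρf)
            (MacroThermo.macroFreeEnergy β H e - MacroThermo.freeEnergy β H ρf)) ∧
        IsGreatest (MacroThermo.extractableWork β H e)
          (MacroThermo.macroFreeEnergy β H e -
            MacroThermo.freeEnergy β H (MacroThermo.thermal β H)) ∧
        IsLUB (MacroThermo.microWork β H (MacroThermo.canonical H e))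
          (MacroThermo.macroFreeEnergy β H e -
            MacroThermo.freeEnergy β H (MacroThermo.thermal β H))) ∧
    -- several commuting observables
    (∀ {ι : Type*} [Fintype ι] [Nonempty ι] (Q : ι → Matrix d d ℂ) (β v : ι → ℝ),
      (∀ j, (Q j).IsHermitian) → (∀ i j, Commute (Q i) (Q j)) → (∀ j, β j ≠ 0) →
      (MacroThermo.microstates Q v).Nonempty →
        (∃! γ, MacroThermo.IsEnsemble Q v γ) ∧
        ∀ ρf : Matrix d d ℂ, MacroThermo.IsDensity ρf →
          (MacroThermo.MacReach β Q v ρf ↔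
            MacroThermo.freeEntropy β Q (MacroThermo.ensemble Q v) ≥
              MacroThermo.freeEntropy β Q ρf)) :=
  mainTheorem5_general.imp_right fun several _ _ _ Q β v hQ hcomm hβ =>
    several Q β v hQ hcomm fun hzero => hβ (Classical.arbitrary _) (congrFun hzero _)
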